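/- Let $X$ be a compact connected Riemann surface with canonical bundle $K$, and let $\omega$ be a holomorphic one-form on $X$, not identically zero, all of whose zeros are simple (if $X$ has genus $g>1$ there are then exactly $2g-2$ zeros; for $g=1$ there are none). Let $C$ be a holomorphic line bundle on $X$ with a holomorphic isomorphism $C\otimes C\cong K$. Equip $X$ with the flat conical metric $|\omega|^2=\rho^{-2}(z,\bar z)|dz|^2$ with area form $dS$, and $C$ with the hermitian metric $h=|\omega|^{-1}$ (under the isomorphism, $|s|_h^2=|c|$ whenever $s\otimes s=c\,\omega$); both are singular at the zeros of $\omega$. Let $L_2(X;C)$ be the Hilbert space of square integrable sections of $C$ with scalar product $(a,b)=\int_X a\,h\,\overline b\,dS$, let $\dot X$ be $X$ without the zeros of $\omega$, and let $\Delta_{min}$ be the closure in $L_2(X;C)$ of the Laplacian $$\Delta u=-\rho^{2}h^{-1}\partial\big(h\,\overline\partial u\big)$$ with domain $C_c^\infty(\dot X;C)$, the smooth sections of $C$ with compact support in $\dot X$. Then every self-adjoint extension $A$ of $\Delta_{min}$ in $L_2(X;C)$ has discrete spectrum: the spectrum of $A$ has no accumulation point in $\mathbb C$, and each of its points is an eigenvalue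 of $A$ of finite multiplicity. -/

import Mathlib

open scoped Manifold ContDiff Topology ComplexConjugate TensorProduct
open MeasureTheory Bundle Filter

set_option linter.unusedSectionVars false

noncomputable section

namespace ConicalSpinor

/-! ### Holomorphic one-forms on a Riemann surface -/

section OneForms

variable {X : Type*} [TopologicalSpace X] [ChartedSpace ℂ X]

/-- The tangent vector at `x` with coordinate `1` in the preferred chart at `x`. -/
def tangentOne {M : Type*} [TopologicalSpace M] [ChartedSpace ℂ M] (x : M) :
    TangentSpace 𝓘(ℂ) x :=
  (1 : ℂ)

/-- The coefficient function `f` in the expression `ξ = f(z) dz` of a section `ξ` of the canonical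
bundle `K` (the complex cotangent bundle) in the coordinate `z` given by the chart `e`. -/
def coeffIn (e : OpenPartialHomeomorph X ℂ) (ξ : ∀ x : X, TangentSpace 𝓘(ℂ) x →L[ℂ] ℂ) (z : ℂ) : ℂ :=
  ξ (e.symm z) (mfderiv 𝓘(ℂ) 𝓘(ℂ) e.symm z (tangentOne z))

variable (X) in
/-- A holomorphic one-form: a section of the canonical bundle whose coefficient in every chart of
the surface is holomorphic. -/
structure HolomorphicOneForm where
  toFun : ∀ x : X, TangentSpace 𝓘(ℂ) x →L[ℂ] ℂ
  holomorphic : ∀ e ∈ atlas ℂ X, DifferentiableOn ℂ (coeffIn e toFun) e.target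

/-- All zeros of the one-form `η` are simple: at a zero, the coefficient of `η` in a local
coordinate has non-zero derivative. (In particular `η` does not vanish identically.) -/
def HolomorphicOneForm.HasSimpleZeros (η : HolomorphicOneForm X) : Prop :=
  ∀ x : X, η.toFun x = 0 → deriv (coeffIn (chartAt ℂ x) η.toFun) (chartAt ℂ x x) ≠ 0

/-- The area measure `|η(z)|² dx dy` of the metric `|η|²` in the chart `e`, as a measure on `X`
concentrated on the domain of `e`. -/
def localArea [MeasurableSpace X] (η : HolomorphicOneForm X) (e : OpenPartialHomeomorph X ℂ) :
    Measure X :=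
  Measure.map e.symm
    ((volume.restrict e.target).withDensity fun z => ENNReal.ofReal (‖coeffIn e η.toFun z‖ ^ 2))

/-- The area measure `dS` of the flat conical metric `|η|²` on `X`. The measures `localArea η e`
agree on overlaps of charts, so their supremum is the measure that they define together. -/
def areaMeasure [MeasurableSpace X] (η : HolomorphicOneForm X) : Measure X :=
  ⨆ e ∈ atlas ℂ X, localArea η e

end OneForms

/-! ### Spinor bundles -/

section Spinor

variable {X : Type*} [TopologicalSpace X] [ChartedSpace ℂ X]
  (C : X → Type*) [∀ x, AddCommGroup (C x)] [∀ x, Module ℂ (C x)] [∀ x, TopologicalSpace (C x)]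
  [TopologicalSpace (TotalSpace ℂ C)] [FiberBundle ℂ C]

/-- An isomorphism `C ⊗ C ≅ K` of holomorphic line bundles, for a line bundle `C`: a family of
linear isomorphisms of the fibers such that, for every local holomorphic frame `s` of `C`, the image
of `s ⊗ s` is a holomorphic one-form on the domain of the frame. -/
structure SpinStructure where
  iso : ∀ x : X, (C x ⊗[ℂ] C x) ≃ₗ[ℂ] (TangentSpace 𝓘(ℂ) x →L[ℂ] ℂ)
  holomorphic : ∀ e ∈ atlas ℂ X, ∀ τ : Trivialization ℂ (π ℂ C), MemTrivializationAtlas τ →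
    DifferentiableOn ℂ (coeffIn e fun x => iso x (τ.symm x 1 ⊗ₜ τ.symm x 1))
      (e.target ∩ e.symm ⁻¹' τ.baseSet)

variable {C} (η : HolomorphicOneForm X) (S : SpinStructure C)

/-- The weight `h = |s|²` of the frame `s` of `C` given by the trivialization `τ`, for the hermitian
metric `h = |η|⁻¹` on `C`: if `s ⊗ s = c η` in the canonical bundle, then `h = |c|`.
The number `c` is found by evaluating both covectors at a non-zero tangent vector. -/
def weight (τ : Trivialization ℂ (π ℂ C)) (x : X) : ℝ :=
  ‖S.iso x (τ.symm x 1 ⊗ₜ τ.symm x 1) (tangentOne x)‖ / ‖η.toFun x (tangentOne x)‖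

/-- The hermitian product `a h b̄` of two vectors of the fiber of `C` at `x` (it does not depend on
the trivialization). -/
def herm (x : X) (a b : C x) : ℂ :=
  (weight η S (trivializationAt ℂ C x) x : ℂ) * (trivializationAt ℂ C x ⟨x, a⟩).2 *
    conj (trivializationAt ℂ C x ⟨x, b⟩).2

/-! ### The Dolbeault Laplacian -/

/-- The Wirtinger derivative `∂f/∂z`. -/
def dz (f : ℂ → ℂ) (z : ℂ) : ℂ :=
  (fderiv ℝ f z 1 - Complex.I * fderiv ℝ f z Complex.I) / 2

/-- The Wirtinger derivative `∂f/∂z̄`. -/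
def dzbar (f : ℂ → ℂ) (z : ℂ) : ℂ :=
  (fderiv ℝ f z 1 + Complex.I * fderiv ℝ f z Complex.I) / 2

/-- The coefficient, in the frame of `C` given by `τ` and the coordinate given by `e`, of a
section `u` of `C`. -/
def sectionCoeff (e : OpenPartialHomeomorph X ℂ) (τ : Trivialization ℂ (π ℂ C)) (u : ∀ x, C x)
    (z : ℂ) : ℂ :=
  (τ ⟨e.symm z, u (e.symm z)⟩).2

/-- The Laplacian `Δu = -ρ² h⁻¹ ∂(h ∂̄u)` with `ρ⁻² = |η(z)|²` and `h = |η|⁻¹`, computed at `x` in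
the holomorphic coordinate `z` and the holomorphic frame of `C` preferred at `x` (it does not depend
on this choice where `u` is smooth and `η` does not vanish). -/
def laplacian (u : ∀ x, C x) (x : X) : C x :=
  let e := chartAt ℂ x
  let τ := trivializationAt ℂ C x
  let h : ℂ → ℂ := fun z => (weight η S τ (e.symm z) : ℂ)
  let ρinvsq : ℂ := ((‖coeffIn e η.toFun (e x)‖ ^ 2 : ℝ) : ℂ)
  τ.symm x (-(ρinvsq⁻¹ * (h (e x))⁻¹ * dz (fun z => h z * dzbar (sectionCoeff e τ u) z) (e x)))

/-- `u ∈ C_c^∞(Ẋ; C)`: the section `u` is smooth (in the real sense) and the closure of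
`{u ≠ 0}` does not meet the zeros of `η`. (On a compact surface the support is compact.) -/
def IsTestSection (u : ∀ x, C x) : Prop :=
  ContMDiff 𝓘(ℝ, ℂ) (𝓘(ℝ, ℂ).prod 𝓘(ℝ, ℂ)) ∞ (fun x => TotalSpace.mk' ℂ x (u x)) ∧
    closure {x | u x ≠ 0} ⊆ {x | η.toFun x ≠ 0}

/-! ### Square integrable sections -/

/-- A section of `C` is (almost everywhere) measurable if its coefficients in local frames are. -/
def AEMeasurableSection [MeasurableSpace X] (u : ∀ x, C x) : Prop :=
  ∀ p : X, AEMeasurable (fun x => (trivializationAt ℂ C p ⟨x, u x⟩).2)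
    ((areaMeasure η).restrict (trivializationAt ℂ C p).baseSet)

/-- `u` is measurable and `∫ |u|²_h dS < ∞`. -/
def IsSquareIntegrable [MeasurableSpace X] (u : ∀ x, C x) : Prop :=
  AEMeasurableSection η u ∧ ∫⁻ x, ENNReal.ofReal (herm η S x (u x) (u x)).re ∂areaMeasure η < ⊤

end Spinor

/-! ### A measurable unitary frame -/

section Tangent

variable {M : Type*} [TopologicalSpace M] [ChartedSpace ℂ M]

theorem exists_eq_smul_tangentOne {x : M} (v : TangentSpace 𝓘(ℂ) x) :
    ∃ c : ℂ, v = c • tangentOne x :=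
  ⟨(v : ℂ), (mul_one (M := ℂ) v).symm⟩

theorem tangentOne_ne_zero (x : M) : tangentOne x ≠ 0 :=
  one_ne_zero (α := ℂ)

theorem covector_eq_zero {x : M} {ξ : TangentSpace 𝓘(ℂ) x →L[ℂ] ℂ}
    (h : ξ (tangentOne x) = 0) : ξ = 0 := by
  refine ContinuousLinearMap.ext fun v => ?_
  obtain ⟨c, rfl⟩ := exists_eq_smul_tangentOne v
  rw [map_smul, h, smul_zero]
  rfl

end Tangent

section Frame

variable {X : Type*} [TopologicalSpace X] [ChartedSpace ℂ X]
  {C : X → Type*} [∀ x, AddCommGroup (C x)] [∀ x, Module ℂ (C x)] [∀ x, TopologicalSpace (C x)]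
  [TopologicalSpace (TotalSpace ℂ C)] [FiberBundle ℂ C] [VectorBundle ℂ ℂ C]
  (η : HolomorphicOneForm X) (S : SpinStructure C)

theorem spin_ne_zero (τ : Trivialization ℂ (π ℂ C)) [MemTrivializationAtlas τ] {x : X}
    (hx : x ∈ τ.baseSet) : S.iso x (τ.symm x 1 ⊗ₜ τ.symm x 1) (tangentOne x) ≠ 0 := by
  intro h
  have h0 := covector_eq_zero h
  have h1 : τ.symm x 1 ⊗ₜ[ℂ] τ.symm x 1 = (0 : C x ⊗[ℂ] C x) := by
    simpa using h0
  have h2 := congrArg (LinearMap.mul' ℂ ℂ ∘ₗ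
    TensorProduct.map (τ.linearMapAt ℂ x) (τ.linearMapAt ℂ x)) h1
  simp only [LinearMap.comp_apply, TensorProduct.map_tmul, map_zero, LinearMap.mul'_apply,
    τ.linearMapAt_symm hx] at h2
  norm_num at h2

theorem herm_eq (τ : Trivialization ℂ (π ℂ C)) [MemTrivializationAtlas τ] {x : X}
    (hx : x ∈ τ.baseSet) (a b : C x) :
    herm η S x a b = (weight η S τ x : ℂ) * (τ ⟨x, a⟩).2 * conj (τ ⟨x, b⟩).2 := by
  unfold herm
  set τ' := trivializationAt ℂ C x with hτ'
  have hx' : x ∈ τ'.baseSet := FiberBundle.mem_baseSet_trivializationAt' x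
  have key : ∀ v : C x, (τ' ⟨x, v⟩).2 = (τ ⟨x, v⟩).2 * (τ' ⟨x, τ.symm x 1⟩).2 := by
    intro v
    have hv : v = (τ ⟨x, v⟩).2 • τ.symm x 1 := by
      rw [← τ.symmₗ_apply (R := ℂ) hx, ← map_smul, smul_eq_mul, mul_one, τ.symmₗ_apply hx,
        τ.symm_apply_apply_mk hx]
    have := (τ'.linear ℂ hx').map_smul (τ ⟨x, v⟩).2 (τ.symm x 1)
    rw [← hv] at this
    simpa using this
  have hs : τ.symm x 1 = (τ' ⟨x, τ.symm x 1⟩).2 • τ'.symm x 1 := by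
    rw [← τ'.symmₗ_apply (R := ℂ) hx', ← map_smul, smul_eq_mul, mul_one, τ'.symmₗ_apply hx',
      τ'.symm_apply_apply_mk hx']
  have hw : weight η S τ x = ‖(τ' ⟨x, τ.symm x 1⟩).2‖ ^ 2 * weight η S τ' x := by
    unfold weight
    conv_lhs => rw [hs]
    rw [TensorProduct.smul_tmul_smul, map_smul, smul_apply, norm_smul, norm_mul]
    ring
  rw [key a, key b, hw, map_mul]
  push_cast
  rw [← Complex.mul_conj']
  ring

variable [IsManifold 𝓘(ℂ) ω X]

theorem coeffIn_eq {e : OpenPartialHomeomorph X ℂ} (he : e ∈ atlas ℂ X) {z : ℂ}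
    (hz : z ∈ e.target) : ∃ c : ℂ, c ≠ 0 ∧ ∀ ξ : ∀ x : X, TangentSpace 𝓘(ℂ) x →L[ℂ] ℂ,
      coeffIn e ξ z = c * ξ (e.symm z) (tangentOne (e.symm z)) := by
  have : IsManifold 𝓘(ℂ) 1 X := IsManifold.of_le (n := ω) (by simp)
  have hm := (mdifferentiable_of_mem_atlas (I := 𝓘(ℂ)) he).symm
  have hinj := hm.mfderiv_injective (x := z) hz
  obtain ⟨c, hc⟩ := exists_eq_smul_tangentOne (mfderiv 𝓘(ℂ) 𝓘(ℂ) e.symm z (tangentOne z))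
  refine ⟨c, ?_, fun ξ => ?_⟩
  · rintro rfl
    rw [zero_smul] at hc
    exact tangentOne_ne_zero z (hinj (hc.trans (map_zero _).symm))
  · rw [coeffIn, hc, map_smul, smul_eq_mul]

theorem weight_eq {e : OpenPartialHomeomorph X ℂ} (he : e ∈ atlas ℂ X)
    (τ : Trivialization ℂ (π ℂ C)) {x : X} (hx : x ∈ e.source) :
    weight η S τ x = ‖coeffIn e (fun x => S.iso x (τ.symm x 1 ⊗ₜ τ.symm x 1)) (e x)‖ /
      ‖coeffIn e η.toFun (e x)‖ := by
  obtain ⟨c, hc, h⟩ := coeffIn_eq he (e.map_source hx)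
  rw [h, h, e.left_inv hx, norm_mul, norm_mul, mul_div_mul_left _ _ (norm_ne_zero_iff.2 hc)]
  rfl

variable [MeasurableSpace X] [BorelSpace X]

theorem aemeasurable_weight (μ : Measure X) {e : OpenPartialHomeomorph X ℂ} (he : e ∈ atlas ℂ X)
    (τ : Trivialization ℂ (π ℂ C)) [hτ : MemTrivializationAtlas τ] :
    AEMeasurable (weight η S τ) (μ.restrict (e.source ∩ τ.baseSet)) := by
  have hms : MeasurableSet (e.source ∩ τ.baseSet) :=
    (e.open_source.inter τ.open_baseSet).measurableSet
  have hcont : ContinuousOn e (e.source ∩ τ.baseSet) := e.continuousOn.mono Set.inter_subset_left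
  have h1 : AEMeasurable (fun x => ‖coeffIn e (fun x => S.iso x (τ.symm x 1 ⊗ₜ τ.symm x 1)) (e x)‖)
      (μ.restrict (e.source ∩ τ.baseSet)) := by
    refine (ContinuousOn.norm ?_).aemeasurable hms
    refine ((S.holomorphic e he τ hτ).continuousOn).comp hcont fun x hx => ⟨e.map_source hx.1, ?_⟩
    simpa [e.left_inv hx.1] using hx.2
  have h2 : AEMeasurable (fun x => ‖coeffIn e η.toFun (e x)‖)
      (μ.restrict (e.source ∩ τ.baseSet)) := by
    refine (ContinuousOn.norm ?_).aemeasurable hms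
    exact ((η.holomorphic e he).continuousOn).comp hcont fun x hx => e.map_source hx.1
  refine (h1.div h2).congr ?_
  filter_upwards [ae_restrict_mem hms] with x hx
  simp [weight_eq η S he τ hx.1]

theorem isClosed_zeros : IsClosed {x : X | η.toFun x = 0} := by
  rw [← isOpen_compl_iff, isOpen_iff_mem_nhds]
  intro x hx
  have he := chart_mem_atlas ℂ x
  have key : ∀ y ∈ (chartAt ℂ x).source,
      (coeffIn (chartAt ℂ x) η.toFun (chartAt ℂ x y) = 0 ↔ η.toFun y = 0) := by
    intro y hy
    obtain ⟨c, hc, h⟩ := coeffIn_eq he ((chartAt ℂ x).map_source hy)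
    rw [h, (chartAt ℂ x).left_inv hy]
    constructor
    · intro h0
      exact covector_eq_zero ((mul_eq_zero.1 h0).resolve_left hc)
    · intro h0
      rw [h0]
      exact mul_zero c
  have hcont : ContinuousAt (fun y => coeffIn (chartAt ℂ x) η.toFun (chartAt ℂ x y)) x := by
    refine ContinuousAt.comp (g := coeffIn (chartAt ℂ x) η.toFun) (f := chartAt ℂ x) ?_ ((chartAt ℂ x).continuousAt (mem_chart_source ℂ x))
    exact (η.holomorphic _ he).continuousOn.continuousAt
      ((chartAt ℂ x).open_target.mem_nhds (mem_chart_target ℂ x))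
  have hne : coeffIn (chartAt ℂ x) η.toFun (chartAt ℂ x x) ≠ 0 := fun h =>
    hx ((key x (mem_chart_source ℂ x)).1 h)
  filter_upwards [hcont.eventually_ne hne,
    (chartAt ℂ x).open_source.mem_nhds (mem_chart_source ℂ x)] with y hy hys h0
  exact hy ((key y hys).2 h0)

theorem area_zeros : areaMeasure η {x : X | η.toFun x = 0} = 0 := by
  set Z := {x : X | η.toFun x = 0}
  have hZ : MeasurableSet Z := (isClosed_zeros η).measurableSet
  have hle : areaMeasure η ≤ (areaMeasure η).restrict Zᶜ := by
    refine iSup₂_le fun e he => ?_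
    have hloc : localArea η e Z = 0 := by
      have hae : AEMeasurable e.symm ((volume.restrict e.target).withDensity
          fun z => ENNReal.ofReal (‖coeffIn e η.toFun z‖ ^ 2)) :=
        ((e.continuousOn_symm).aemeasurable e.open_target.measurableSet).mono_ac
          (withDensity_absolutelyContinuous _ _)
      rw [localArea, Measure.map_apply_of_aemeasurable hae hZ, withDensity_apply']
      refine le_antisymm ?_ zero_le
      calc _ ≤ ∫⁻ z in e.symm ⁻¹' Z, 0 ∂(volume.restrict e.target) := by
            refine lintegral_mono_ae ?_
            have h1 : ∀ z, z ∈ e.symm ⁻¹' Z → coeffIn e η.toFun z = 0 := by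
              intro z hz
              have hz' : η.toFun (e.symm z) = 0 := hz
              unfold coeffIn
              rw [hz']; simp
            have : ∀ᵐ z ∂((volume.restrict e.target).restrict (e.symm ⁻¹' Z)),
                z ∈ e.symm ⁻¹' Z := by
              have hnm : NullMeasurableSet (e.symm ⁻¹' Z) (volume.restrict e.target) :=
                ((e.continuousOn_symm).aemeasurable
                  e.open_target.measurableSet).nullMeasurable hZ
              exact ae_restrict_mem₀ hnm
            filter_upwards [this] with z hz
            simp [h1 z hz]
        _ = 0 := by simp
    calc localArea η e = (localArea η e).restrict Zᶜ :=
          (Measure.restrict_eq_self_of_ae_mem (by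
            rw [ae_iff]; simpa using hloc)).symm
      _ ≤ (areaMeasure η).restrict Zᶜ :=
          Measure.restrict_mono_measure (le_iSup₂ (f := fun e _ => localArea η e) e he) _
  have := hle Z
  rw [Measure.restrict_apply hZ] at this
  simpa using this

end Frame

section Coordinate

variable {X : Type*} [TopologicalSpace X] [ChartedSpace ℂ X] [IsManifold 𝓘(ℂ) ω X]
  [CompactSpace X] [ConnectedSpace X] [MeasurableSpace X] [BorelSpace X]
  {C : X → Type*} [∀ x, AddCommGroup (C x)] [∀ x, Module ℂ (C x)] [∀ x, TopologicalSpace (C x)]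
  [TopologicalSpace (TotalSpace ℂ C)] [FiberBundle ℂ C] [VectorBundle ℂ ℂ C]
  (η : HolomorphicOneForm X) (S : SpinStructure C)

/-- There is a measurable unitary coordinate on the fibers of `C` (away from the zeros of `η`). -/
theorem exists_unitary_coordinate : ∃ Φ : ∀ x, C x →ₗ[ℂ] ℂ,
    (∀ x a b, herm η S x a b = Φ x a * conj (Φ x b)) ∧
    (∀ u : ∀ x, C x, AEMeasurableSection η u →
      AEMeasurable (fun x => Φ x (u x)) (areaMeasure η)) ∧
    (∀ f : X → ℂ, AEMeasurable f (areaMeasure η) → ∃ u : ∀ x, C x, AEMeasurableSection η u ∧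
      ∀ᵐ x ∂areaMeasure η, Φ x (u x) = f x) ∧
    (∀ x, η.toFun x ≠ 0 → ∀ a, Φ x a = 0 → a = 0) := by
  classical
  set μ := areaMeasure η with hμ
  let U : X → Set X := fun p => (chartAt ℂ p).source ∩ (trivializationAt ℂ C p).baseSet
  have hUo : ∀ p, IsOpen (U p) := fun p =>
    (chartAt ℂ p).open_source.inter (trivializationAt ℂ C p).open_baseSet
  have hUn : ∀ p, U p ∈ 𝓝 p := fun p => (hUo p).mem_nhds
    ⟨mem_chart_source ℂ p, FiberBundle.mem_baseSet_trivializationAt' p⟩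
  obtain ⟨p, hp⟩ : ∃ p : ℕ → X, ∀ x, ∃ n, x ∈ U (p n) := by
    obtain ⟨t, ht⟩ := CompactSpace.elim_nhds_subcover U hUn
    have hne : (t : Set X).Nonempty := by
      obtain ⟨x⟩ := (inferInstance : Nonempty X)
      have hx : x ∈ ⋃ y ∈ t, U y := by rw [ht]; trivial
      obtain ⟨y, hy, -⟩ := Set.mem_iUnion₂.1 hx
      exact ⟨y, hy⟩
    obtain ⟨p, hpr⟩ := t.countable_toSet.exists_eq_range hne
    refine ⟨p, fun x => ?_⟩
    have hx : x ∈ ⋃ y ∈ t, U y := by rw [ht]; trivial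
    obtain ⟨y, hy, hxy⟩ := Set.mem_iUnion₂.1 hx
    have : y ∈ Set.range p := by rw [← hpr]; exact hy
    obtain ⟨n, rfl⟩ := this
    exact ⟨n, hxy⟩
  let i : X → ℕ := fun x => Nat.find (hp x)
  have hi : ∀ x, x ∈ U (p (i x)) := fun x => Nat.find_spec (hp x)
  have him : Measurable i := measurable_find hp fun n => (hUo (p n)).measurableSet
  let A : ℕ → Set X := fun n => i ⁻¹' {n}
  have hAm : ∀ n, MeasurableSet (A n) := fun n => him (measurableSet_singleton n)
  have hAU : ∀ n, A n ⊆ U (p n) := by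
    rintro n x rfl
    exact hi x
  have hAcov : ⋃ n, A n = Set.univ := by
    ext x
    simp [A]
  have glue : ∀ (ν : Measure X) (f : X → ℂ), (∀ n, AEMeasurable f (ν.restrict (A n))) →
      AEMeasurable f ν := by
    intro ν f hf
    have := aemeasurable_iUnion_iff.2 hf
    rwa [hAcov, Measure.restrict_univ] at this
  let τ : ℕ → Trivialization ℂ (π ℂ C) := fun n => trivializationAt ℂ C (p n)
  have hτ : ∀ x, x ∈ (τ (i x)).baseSet := fun x => (hi x).2
  let w : ℕ → X → ℂ := fun n x => ((Real.sqrt (weight η S (τ n) x) : ℝ) : ℂ)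
  have hwpos : ∀ n x, 0 ≤ weight η S (τ n) x := fun n x =>
    div_nonneg (norm_nonneg _) (norm_nonneg _)
  have hwm : ∀ (s : Set X) n, s ⊆ U (p n) → AEMeasurable (w n) (μ.restrict s) := by
    intro s n hs
    have h1 := (aemeasurable_weight η S μ (chart_mem_atlas ℂ (p n)) (τ n)).mono_measure
      (Measure.restrict_mono hs le_rfl)
    exact (Complex.measurable_ofReal.comp Real.continuous_sqrt.measurable).comp_aemeasurable h1
  have hw0 : ∀ x, η.toFun x ≠ 0 → w (i x) x ≠ 0 := by
    intro x hx
    have h1 : weight η S (τ (i x)) x ≠ 0 :=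
      div_ne_zero (norm_ne_zero_iff.2 (spin_ne_zero S (τ (i x)) (hτ x)))
        (norm_ne_zero_iff.2 fun h => hx (covector_eq_zero h))
    exact Complex.ofReal_ne_zero.2 ((Real.sqrt_ne_zero (hwpos _ _)).2 h1)
  let Φ : ∀ x, C x →ₗ[ℂ] ℂ := fun x => w (i x) x • (τ (i x)).linearMapAt ℂ x
  have hΦ : ∀ x (a : C x), Φ x a = w (i x) x * (τ (i x) ⟨x, a⟩).2 := by
    intro x a
    simp only [Φ, LinearMap.smul_apply, smul_eq_mul]
    rw [(τ (i x)).coe_linearMapAt_of_mem (hτ x)]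
  refine ⟨Φ, ?_, ?_, ?_, ?_⟩
  · intro x a b
    rw [herm_eq η S (τ (i x)) (hτ x), hΦ, hΦ, map_mul, Complex.conj_ofReal]
    have : ((weight η S (τ (i x)) x : ℝ) : ℂ) = w (i x) x * w (i x) x := by
      simp only [w]
      rw [← Complex.ofReal_mul, Real.mul_self_sqrt (hwpos _ _)]
    rw [this]
    simp only [w]
    ring
  · intro u hu
    refine glue μ _ fun n => ?_
    have h1 : AEMeasurable (fun x => w n x * (τ n ⟨x, u x⟩).2) (μ.restrict (A n)) :=
      (hwm _ n (hAU n)).mul ((hu (p n)).mono_measure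
        (Measure.restrict_mono (fun x hx => (hAU n hx).2) le_rfl))
    refine h1.congr ?_
    filter_upwards [ae_restrict_mem (hAm n)] with x hx
    have : i x = n := hx
    rw [hΦ, this]
  · intro f hf
    refine ⟨fun x => (τ (i x)).symm x (f x / w (i x) x), ?_, ?_⟩
    · intro q
      refine glue _ _ fun n => ?_
      set σ := trivializationAt ℂ C q with hσ
      have hσm : MeasurableSet σ.baseSet := σ.open_baseSet.measurableSet
      rw [Measure.restrict_restrict (hAm n)]
      have hsub : A n ∩ σ.baseSet ⊆ (τ n).baseSet ∩ σ.baseSet := fun x hx =>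
        ⟨(hAU n hx.1).2, hx.2⟩
      have hc : AEMeasurable (fun x => ((τ n).coordChangeL ℂ σ x : ℂ →L[ℂ] ℂ) 1)
          (μ.restrict (A n ∩ σ.baseSet)) := by
        have h0 := (continuousOn_coordChange ℂ (τ n) σ).clm_apply
          (continuousOn_const (c := (1 : ℂ)))
        exact (h0.aemeasurable (((τ n).open_baseSet.inter σ.open_baseSet).measurableSet)).mono_measure
          (Measure.restrict_mono hsub le_rfl)
      have h1 : AEMeasurable (fun x => (f x / w n x) *
          ((τ n).coordChangeL ℂ σ x : ℂ →L[ℂ] ℂ) 1) (μ.restrict (A n ∩ σ.baseSet)) :=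
        ((hf.mono_measure Measure.restrict_le_self).div
          (hwm _ n (Set.inter_subset_left.trans (hAU n)))).mul hc
      refine h1.congr ?_
      filter_upwards [ae_restrict_mem ((hAm n).inter hσm)] with x hx
      have hix : i x = n := hx.1
      rw [← smul_eq_mul, ← map_smul, smul_eq_mul, mul_one, hix]
      exact (τ n).coordChangeL_apply σ (hsub hx) _
    · have hae : ∀ᵐ x ∂μ, η.toFun x ≠ 0 := by
        rw [ae_iff]
        simpa using area_zeros η
      filter_upwards [hae] with x hx
      rw [hΦ, (τ (i x)).apply_mk_symm (hτ x)]
      exact mul_div_cancel₀ _ (hw0 x hx)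
  · intro x hx a ha
    rw [hΦ] at ha
    have h1 := (mul_eq_zero.1 ha).resolve_left (hw0 x hx)
    have h2 := (τ (i x)).symm_apply_apply_mk (hτ x) a
    rw [h1, ← (τ (i x)).symmₗ_apply (R := ℂ) (hτ x), map_zero] at h2
    exact h2.symm

end Coordinate

/-! ### The Hilbert space of square integrable sections -/

section HilbertSpace

variable {X : Type*} [TopologicalSpace X] [ChartedSpace ℂ X] [IsManifold 𝓘(ℂ) ω X]
  [CompactSpace X] [ConnectedSpace X] [MeasurableSpace X] [BorelSpace X]
  {C : X → Type*} [∀ x, AddCommGroup (C x)] [∀ x, Module ℂ (C x)] [∀ x, TopologicalSpace (C x)]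
  [TopologicalSpace (TotalSpace ℂ C)] [FiberBundle ℂ C] [VectorBundle ℂ ℂ C]
  (η : HolomorphicOneForm X) (S : SpinStructure C)

variable {η} in
theorem AEMeasurableSection.add_smul {u v : ∀ x, C x} (hu : AEMeasurableSection η u)
    (hv : AEMeasurableSection η v) (c : ℂ) : AEMeasurableSection η (u + c • v) := by
  intro p
  refine ((hu p).add ((hv p).const_mul c)).congr ?_
  filter_upwards [ae_restrict_mem (trivializationAt ℂ C p).open_baseSet.measurableSet] with x hx
  have h := (trivializationAt ℂ C p).linear ℂ hx
  exact ((h.map_add (u x) (c • v x)).trans (congrArg _ (h.map_smul c (v x)))).symm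

theorem aemeasurableSection_zero : AEMeasurableSection η (0 : ∀ x, C x) := by
  intro p
  refine (aemeasurable_const (b := (0 : ℂ))).congr ?_
  filter_upwards [ae_restrict_mem (trivializationAt ℂ C p).open_baseSet.measurableSet] with x hx
  exact (((trivializationAt ℂ C p).linear ℂ hx).map_zero).symm

theorem isSquareIntegrable_iff {Φ : ∀ x, C x →ₗ[ℂ] ℂ}
    (h1 : ∀ x a b, herm η S x a b = Φ x a * conj (Φ x b))
    (h2 : ∀ u : ∀ x, C x, AEMeasurableSection η u →
      AEMeasurable (fun x => Φ x (u x)) (areaMeasure η)) (u : ∀ x, C x) :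
    IsSquareIntegrable η S u ↔
      AEMeasurableSection η u ∧ MemLp (fun x => Φ x (u x)) 2 (areaMeasure η) := by
  refine and_congr_right fun hu => ?_
  have key : ∀ x, ENNReal.ofReal (herm η S x (u x) (u x)).re = ‖Φ x (u x)‖ₑ ^ (2 : ℝ) := by
    intro x
    rw [h1, Complex.mul_conj']
    norm_cast
    rw [ENNReal.ofReal_pow (norm_nonneg _), ofReal_norm]
  simp only [key]
  rw [MemLp, eLpNorm_lt_top_iff_lintegral_rpow_enorm_lt_top (by norm_num) (by norm_num)]
  simp [(h2 u hu).aestronglyMeasurable]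

/-- The space of square integrable sections, before identifying sections that agree almost
everywhere. -/
def squareIntegrable : Submodule ℂ (∀ x, C x) where
  carrier := {u | IsSquareIntegrable η S u}
  zero_mem' := by
    obtain ⟨Φ, h1, h2, -, -⟩ := exists_unitary_coordinate η S
    refine (isSquareIntegrable_iff η S h1 h2 _).2 ⟨aemeasurableSection_zero η, ?_⟩
    simp
  add_mem' := by
    intro u v hu hv
    obtain ⟨Φ, h1, h2, -, -⟩ := exists_unitary_coordinate η S
    have hu' := (isSquareIntegrable_iff η S h1 h2 _).1 hu
    have hv' := (isSquareIntegrable_iff η S h1 h2 _).1 hv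
    refine (isSquareIntegrable_iff η S h1 h2 _).2 ⟨by simpa using hu'.1.add_smul hv'.1 1, ?_⟩
    simpa [Pi.add_def] using hu'.2.add hv'.2
  smul_mem' := by
    intro c u hu
    obtain ⟨Φ, h1, h2, -, -⟩ := exists_unitary_coordinate η S
    have hu' := (isSquareIntegrable_iff η S h1 h2 _).1 hu
    refine (isSquareIntegrable_iff η S h1 h2 _).2
      ⟨by simpa using (aemeasurableSection_zero η).add_smul hu'.1 c, ?_⟩
    simpa [Pi.smul_def] using hu'.2.const_smul c

/-- The sections that vanish almost everywhere. -/
def nullSections : Submodule ℂ (squareIntegrable η S) where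
  carrier := {u | ∀ᵐ x ∂areaMeasure η, u.1 x = 0}
  zero_mem' := by simp
  add_mem' := by
    intro u v hu hv
    have hu' : ∀ᵐ x ∂areaMeasure η, u.1 x = 0 := hu
    have hv' : ∀ᵐ x ∂areaMeasure η, v.1 x = 0 := hv
    change ∀ᵐ x ∂areaMeasure η, (u + v).1 x = 0
    filter_upwards [hu', hv'] with x hux hvx
    simp [hux, hvx]
  smul_mem' := by
    intro c u hu
    have hu' : ∀ᵐ x ∂areaMeasure η, u.1 x = 0 := hu
    change ∀ᵐ x ∂areaMeasure η, (c • u).1 x = 0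
    filter_upwards [hu'] with x hux
    simp [hux]

/-- `L₂(X; C)`: square integrable sections of `C`, modulo equality almost everywhere. -/
def L2 : Type _ := squareIntegrable η S ⧸ nullSections η S

namespace L2

instance : AddCommGroup (L2 η S) :=
  inferInstanceAs (AddCommGroup (squareIntegrable η S ⧸ nullSections η S))

instance : Module ℂ (L2 η S) :=
  inferInstanceAs (Module ℂ (squareIntegrable η S ⧸ nullSections η S))

variable {η S} in
/-- The class of a square integrable section. -/
def mk (u : ∀ x, C x) (hu : IsSquareIntegrable η S u) : L2 η S :=
  (nullSections η S).mkQ ⟨u, hu⟩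

variable {η S} in
/-- A section representing the class `U`. -/
def rep (U : L2 η S) : ∀ x, C x :=
  (Function.surjInv (nullSections η S).mkQ_surjective U).1

theorem rep_spec (U : L2 η S) : ∃ hu : IsSquareIntegrable η S U.rep, mk U.rep hu = U :=
  ⟨(Function.surjInv (nullSections η S).mkQ_surjective U).2,
    Function.surjInv_eq (nullSections η S).mkQ_surjective U⟩

variable {η S} in
/-- The scalar product `(U, V) = ∫ U h V̄ dS`. -/
def scalarProduct (U V : L2 η S) : ℂ :=
  ∫ x, herm η S x (U.rep x) (V.rep x) ∂areaMeasure η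

theorem exists_equiv_Lp : ∃ T : L2 η S ≃ₗ[ℂ] Lp ℂ 2 (areaMeasure η),
    (∀ U V : L2 η S, scalarProduct V U = inner ℂ (T U) (T V)) ∧
    ∀ (u v : ∀ x, C x) (hu : IsSquareIntegrable η S u) (hv : IsSquareIntegrable η S v),
      inner ℂ (T (mk v hv)) (T (mk u hu)) = ∫ x, herm η S x (u x) (v x) ∂areaMeasure η := by
  obtain ⟨Φ, h1, h2, h3, h4⟩ := exists_unitary_coordinate η S
  have hm : ∀ u, IsSquareIntegrable η S u → MemLp (fun x => Φ x (u x)) 2 (areaMeasure η) :=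
    fun u hu => ((isSquareIntegrable_iff η S h1 h2 u).1 hu).2
  let T0 : squareIntegrable η S →ₗ[ℂ] Lp ℂ 2 (areaMeasure η) :=
    { toFun := fun u => (hm u.1 u.2).toLp _
      map_add' := by
        intro u v
        rw [← MemLp.toLp_add]
        congr 1
        ext x
        simp
      map_smul' := by
        intro c u
        rw [RingHom.id_apply, ← MemLp.toLp_const_smul]
        congr 1
        ext x
        simp }
  have hker : ∀ u : squareIntegrable η S, T0 u = 0 ↔ u ∈ nullSections η S := by
    intro u
    have hae : ∀ᵐ x ∂areaMeasure η, η.toFun x ≠ 0 := by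
      rw [ae_iff]
      simpa using area_zeros η
    change (hm u.1 u.2).toLp _ = 0 ↔ ∀ᵐ x ∂areaMeasure η, u.1 x = 0
    rw [Lp.eq_zero_iff_ae_eq_zero, (MemLp.coeFn_toLp (hm u.1 u.2)).congr_left]
    constructor
    · intro h
      filter_upwards [h, hae] with x hx hx0
      exact h4 x hx0 _ hx
    · intro h
      filter_upwards [h] with x hx
      simp [hx]
  let T1 : L2 η S →ₗ[ℂ] Lp ℂ 2 (areaMeasure η) :=
    (nullSections η S).liftQ T0 fun u hu => (hker u).2 hu
  have hT1 : ∀ u hu, T1 (mk u hu) = (hm u hu).toLp _ := fun u hu => rfl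
  have hinj : Function.Injective T1 := by
    rw [injective_iff_map_eq_zero]
    intro U hU
    obtain ⟨u, rfl⟩ := (nullSections η S).mkQ_surjective U
    exact (Submodule.Quotient.mk_eq_zero _).2 ((hker u).1 hU)
  have hsurj : Function.Surjective T1 := by
    intro f
    obtain ⟨u, hu, huf⟩ := h3 f (Lp.aestronglyMeasurable f).aemeasurable
    have hu2 : IsSquareIntegrable η S u :=
      (isSquareIntegrable_iff η S h1 h2 u).2 ⟨hu, (memLp_congr_ae huf).2 (Lp.memLp f)⟩
    refine ⟨mk u hu2, ?_⟩
    rw [hT1]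
    exact Lp.ext ((MemLp.coeFn_toLp _).trans huf)
  have hin : ∀ (u v : ∀ x, C x) (hu : IsSquareIntegrable η S u) (hv : IsSquareIntegrable η S v),
      inner ℂ (T1 (mk v hv)) (T1 (mk u hu)) = ∫ x, herm η S x (u x) (v x) ∂areaMeasure η := by
    intro u v hu hv
    rw [MeasureTheory.L2.inner_def]
    refine integral_congr_ae ?_
    rw [hT1, hT1]
    filter_upwards [MemLp.coeFn_toLp (hm u hu), MemLp.coeFn_toLp (hm v hv)] with x hx hy
    rw [hx, hy, h1]
    simp [RCLike.inner_apply]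
  refine ⟨LinearEquiv.ofBijective T1 ⟨hinj, hsurj⟩, ?_, hin⟩
  intro U V
  obtain ⟨hu, hU⟩ := rep_spec η S U
  obtain ⟨hv, hV⟩ := rep_spec η S V
  have := hin V.rep U.rep hv hu
  rw [hU, hV] at this
  exact this.symm

/-- The scalar product of `L₂(X; C)` satisfies the axioms of an inner product. (An inner product is
conjugate linear in its first argument here, so `inner ℂ V U` is `(U, V)`.) -/
@[reducible]
def core : InnerProductSpace.Core ℂ (L2 η S) where
  inner V U := scalarProduct U V
  conj_inner_symm U V := by
    obtain ⟨T, hT, -⟩ := exists_equiv_Lp η S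
    rw [hT, hT, inner_conj_symm]
  re_inner_nonneg U := by
    obtain ⟨T, hT, -⟩ := exists_equiv_Lp η S
    rw [hT]
    exact inner_self_nonneg
  add_left U V W := by
    obtain ⟨T, hT, -⟩ := exists_equiv_Lp η S
    rw [hT, hT, hT, map_add, inner_add_left]
  smul_left U V c := by
    obtain ⟨T, hT, -⟩ := exists_equiv_Lp η S
    rw [hT, hT, map_smul, inner_smul_left]
  definite U h := by
    obtain ⟨T, hT, -⟩ := exists_equiv_Lp η S
    replace h : scalarProduct U U = 0 := h
    rw [hT, inner_self_eq_zero] at h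
    exact (map_eq_zero_iff T T.injective).1 h

instance : NormedAddCommGroup (L2 η S) := (core η S).toNormedAddCommGroup

instance : InnerProductSpace ℂ (L2 η S) := InnerProductSpace.ofCore (core η S).toCore

theorem inner_eq (U V : L2 η S) : inner ℂ V U = scalarProduct U V :=
  rfl

theorem inner_mk (u v : ∀ x, C x) (hu : IsSquareIntegrable η S u)
    (hv : IsSquareIntegrable η S v) :
    inner ℂ (mk v hv) (mk u hu) = ∫ x, herm η S x (u x) (v x) ∂areaMeasure η := by
  obtain ⟨T, hT, hT'⟩ := exists_equiv_Lp η S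
  rw [inner_eq, hT, hT']

instance : CompleteSpace (L2 η S) := by
  obtain ⟨T, hT, -⟩ := exists_equiv_Lp η S
  let T' : L2 η S ≃ₗᵢ[ℂ] Lp ℂ 2 (areaMeasure η) :=
    { T with
      norm_map' := fun U => by
        have h := hT U U
        rw [← inner_eq, inner_self_eq_norm_sq_to_K, inner_self_eq_norm_sq_to_K] at h
        have h' : ‖U‖ ^ 2 = ‖T U‖ ^ 2 := by exact_mod_cast h
        exact ((sq_eq_sq₀ (norm_nonneg _) (norm_nonneg _)).1 h').symm }
  exact (completeSpace_congr (e := T'.toEquiv) T'.isometry.isUniformEmbedding).2 inferInstance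

end L2

end HilbertSpace

/-! ### The minimal operator -/

section Minimal

variable {X : Type*} [TopologicalSpace X] [ChartedSpace ℂ X] [IsManifold 𝓘(ℂ) ω X]
  [CompactSpace X] [ConnectedSpace X] [MeasurableSpace X] [BorelSpace X]
  {C : X → Type*} [∀ x, AddCommGroup (C x)] [∀ x, Module ℂ (C x)] [∀ x, TopologicalSpace (C x)]
  [TopologicalSpace (TotalSpace ℂ C)] [FiberBundle ℂ C] [VectorBundle ℂ ℂ C]
  (η : HolomorphicOneForm X) (S : SpinStructure C)

/-- The graph in `L₂(X; C) × L₂(X; C)` of the minimal operator `Δ_min`: the closure of the graph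
`{(u, Δu)}` of the Laplacian with domain `C_c^∞(Ẋ; C)`. (Square integrability of such `u` and `Δu` is
automatic; it is mentioned to form their classes in `L₂(X; C)`.) -/
def minimalLaplacianGraph : Submodule ℂ (L2 η S × L2 η S) :=
  (Submodule.span ℂ {p | ∃ u : ∀ x, C x, IsTestSection η u ∧
    ∃ (hu : IsSquareIntegrable η S u) (hv : IsSquareIntegrable η S (laplacian η S u)),
      p = (L2.mk u hu, L2.mk (laplacian η S u) hv)}).topologicalClosure

/-- The operator `A` is a self-adjoint extension of `Δ_min`. -/
def IsSelfAdjointExtension (A : L2 η S →ₗ.[ℂ] L2 η S) : Prop :=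
  minimalLaplacianGraph η S ≤ A.graph ∧ IsSelfAdjoint A

end Minimal

/-! ### Discrete spectrum of an unbounded operator -/

section Spectrum

variable {H : Type*} [NormedAddCommGroup H] [InnerProductSpace ℂ H]

/-- The resolvent set of an operator `A`: all `z` such that `A - z` is a bijection from the domain
of `A` onto `H` with bounded inverse `R`. -/
def resolventSet (A : H →ₗ.[ℂ] H) : Set ℂ :=
  {z | ∃ R : H →L[ℂ] H, (∀ y : H, ∃ hy : R y ∈ A.domain, A ⟨R y, hy⟩ - z • R y = y) ∧
    ∀ x : A.domain, R (A x - z • (x : H)) = x}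

/-- The spectrum of an operator. -/
def spectrum (A : H →ₗ.[ℂ] H) : Set ℂ :=
  (resolventSet A)ᶜ

/-- The eigenspace `{x ∈ Dom A : A x = z x}`. -/
def eigenspace (A : H →ₗ.[ℂ] H) (z : ℂ) : Submodule ℂ A.domain :=
  LinearMap.ker (A.toFun - z • A.domain.subtype)

/-- The spectrum is (purely) discrete: it has no accumulation point in `ℂ`, and each of its points
is an eigenvalue of finite multiplicity. -/
def HasDiscreteSpectrum (A : H →ₗ.[ℂ] H) : Prop :=
  (∀ z : ℂ, ¬ AccPt z (𝓟 (spectrum A))) ∧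
    ∀ z ∈ spectrum A, eigenspace A z ≠ ⊥ ∧ FiniteDimensional ℂ (eigenspace A z)

end Spectrum

end ConicalSpinor

end

/-! A self-adjoint operator whose domain, with the graph norm, embeds compactly in the Hilbert space
has discrete spectrum (`hasDiscreteSpectrum_of_hasCompactDomain`). So everything rests on
compactness of this embedding for an arbitrary extension `A`. `HasCompactDomain` expresses
compactness as an inequality: the norm is at most a small multiple of the graph norm plus finitely
many functionals. Such inequalities can be added over a finite cover of `X`, so it suffices to prove
one near each point (`exists_local_estimate`).

Near a point there are a coordinate `ζ` with `η = ζᵐ q dζ`, `q ≠ 0`, and a frame of `C` with square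
`q dζ` (`exists_adaptedChart`). In this frame the weight `h` is `|ζ|⁻ᵐ`, and `Δu = f` becomes
`∂(|ζ|⁻ᵐ ∂̄u) = -|ζ|ᵐ |q|² f`. Since `A` is symmetric and extends `Δ_min`, pairing with test
sections supported in the punctured disc shows that every element of the domain of `A` is a weak
solution there (`weakLaplace_pull`). This is all that is used about `A` near a zero of `η`, so the
boundary condition that selects the extension plays no role.

On the disc the equation splits into Fourier modes. For the mode `n` put `α = max(n, m - n)` and `d
= 2α - m`; then `(ζ/|ζ|)ⁿ |ζ|^α` solves the homogeneous equation off the origin, and on the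
functions `(ζ/|ζ|)ⁿ |ζ|^α q(|ζ|)` the operator acts as `q ↦ (r^(d+1) q')'` up to a power of `r`
(`conicalOp_modeFun`). The coefficients of `u` are estimated by duality, without any regularity
theory: for a given `g` the radial equation with right-hand side `g` is solved by two integrations,
the solution is cut off and used as a test function (`l2norm_radial_le`).

Test functions have to vanish near the origin. If `2α ≥ 3m + 2`, functions constant near the origin
are admissible too, by a limit (`WeakRadial.extend`). The finitely many remaining modes, which carry
the freedom in the choice of extension, need a constant of integration, and this costs finitely many
functionals. Modes of high order are uniformly small in a smaller disc
(`exists_forall_l2norm_radial_le`), each single mode depends compactly on the data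
(`exists_l2norm_radial_le`), and Parseval's identity assembles the modes (`exists_l2norm_disc_le`).
-/

set_option linter.unusedSectionVars false

noncomputable section

namespace ConicalSpinor

/-! ### A criterion for discreteness of the spectrum -/

section DiscreteSpectrum

variable {H : Type*} [NormedAddCommGroup H] [InnerProductSpace ℂ H]

/-- The domain of `A` with its graph norm embeds compactly in `H`: up to arbitrarily small
multiples of the graph norm, the norm of `H` is controlled by finitely many continuous functionals
on the graph. -/
def HasCompactDomain (A : H →ₗ.[ℂ] H) : Prop :=
  ∀ ε : ℝ, 0 < ε → ∃ s : Finset ((H × H) →L[ℂ] ℂ), ∀ x : A.domain,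
    ‖(x : H)‖ ^ 2 ≤ ε * (‖(x : H)‖ ^ 2 + ‖A x‖ ^ 2) + ∑ l ∈ s, ‖l ((x : H), A x)‖ ^ 2

/-- The operator `A - z` on the domain of `A`. -/
def shift (A : H →ₗ.[ℂ] H) (z : ℂ) : A.domain →ₗ[ℂ] H :=
  A.toFun - z • A.domain.subtype

theorem shift_apply (A : H →ₗ.[ℂ] H) (z : ℂ) (x : A.domain) : shift A z x = A x - z • (x : H) :=
  rfl

/-- Since `A x = (A - z) x + z x`, the graph norm is controlled by `‖(A - z) x‖` and `‖x‖`, and for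
small `ε` the latter is absorbed on the left. -/
theorem HasCompactDomain.exists_norm_le {A : H →ₗ.[ℂ] H} (hA : HasCompactDomain A) (z : ℂ) :
    ∃ (s : Finset ((H × H) →L[ℂ] ℂ)) (C : ℝ), ∀ x : A.domain,
      ‖(x : H)‖ ^ 2 ≤ C * ‖shift A z x‖ ^ 2 + 2 * ∑ l ∈ s, ‖l ((x : H), A x)‖ ^ 2 := by
  -- Chosen so that the total coefficient of `‖x‖²` on the right, `ε (1 + 2‖z‖²)`, equals `1/2`.
  set ε : ℝ := 1 / (2 * (1 + 2 * ‖z‖ ^ 2)) with hε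
  have hpos : 0 < ε := by positivity
  have hε2 : ε * (1 + 2 * ‖z‖ ^ 2) = 1 / 2 := by rw [hε]; field_simp
  obtain ⟨s, hs⟩ := hA ε hpos
  refine ⟨s, 4 * ε, fun x => ?_⟩
  have h1 := hs x
  have h2 : ‖A x‖ ≤ ‖shift A z x‖ + ‖z‖ * ‖(x : H)‖ := by
    rw [← norm_smul]
    calc ‖A x‖ = ‖shift A z x + z • (x : H)‖ := by rw [shift_apply]; simp
      _ ≤ _ := norm_add_le _ _
  have h3 : ‖A x‖ ^ 2 ≤ 2 * ‖shift A z x‖ ^ 2 + 2 * (‖z‖ ^ 2 * ‖(x : H)‖ ^ 2) := by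
    calc ‖A x‖ ^ 2 ≤ (‖shift A z x‖ + ‖z‖ * ‖(x : H)‖) ^ 2 := by gcongr
      _ ≤ _ := by nlinarith [sq_nonneg (‖shift A z x‖ - ‖z‖ * ‖(x : H)‖)]
  have h4 : ε * ‖A x‖ ^ 2 ≤ ε * (2 * ‖shift A z x‖ ^ 2 + 2 * (‖z‖ ^ 2 * ‖(x : H)‖ ^ 2)) := by
    gcongr
  have h5 : ε * (1 + 2 * ‖z‖ ^ 2) * ‖(x : H)‖ ^ 2 = 1 / 2 * ‖(x : H)‖ ^ 2 := by rw [hε2]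
  linarith

/-- On the eigenspace `(A - z) x` vanishes, so finitely many functionals already separate its
points. -/
theorem HasCompactDomain.finiteDimensional {A : H →ₗ.[ℂ] H} (hA : HasCompactDomain A) (z : ℂ) :
    FiniteDimensional ℂ (eigenspace A z) := by
  obtain ⟨s, C, h⟩ := hA.exists_norm_le z
  let L : eigenspace A z →ₗ[ℂ] (s → ℂ) := LinearMap.pi fun l =>
    l.1.toLinearMap ∘ₗ (LinearMap.prod A.domain.subtype A.toFun) ∘ₗ (eigenspace A z).subtype
  refine FiniteDimensional.of_injective L ?_
  rw [injective_iff_map_eq_zero]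
  intro x hx
  have h0 : shift A z x.1 = 0 := x.2
  have h1 := h x.1
  have h2 : ∑ l ∈ s, ‖l ((x.1 : H), A x.1)‖ ^ 2 = 0 := by
    refine Finset.sum_eq_zero fun l hl => ?_
    have : L x ⟨l, hl⟩ = 0 := by rw [hx]; rfl
    have h' : l ((x.1 : H), A x.1) = 0 := this
    simp [h']
  rw [h0, h2] at h1
  have h3 : ‖(x.1 : H)‖ = 0 := by
    have := norm_nonneg (x.1 : H)
    norm_num at h1
    simpa using h1
  exact Subtype.ext (Subtype.ext (norm_eq_zero.1 h3))

/-- The finitely many functionals take bounded values on the sequence, so by Bolzano–Weierstrass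
they converge along a subsequence. The estimate applied to differences then makes the vectors
Cauchy, and closedness of `A` identifies the limit. -/
theorem HasCompactDomain.exists_tendsto [CompleteSpace H] {A : H →ₗ.[ℂ] H}
    (hA : HasCompactDomain A) (hcl : A.IsClosed) (z : ℂ) {x : ℕ → A.domain} {M : ℝ}
    (hM : ∀ k, ‖(x k : H)‖ ≤ M) {w : H} (hw : Tendsto (fun k => shift A z (x k)) atTop (𝓝 w)) :
    ∃ (φ : ℕ → ℕ) (y : A.domain), StrictMono φ ∧
      Tendsto (fun k => (x (φ k) : H)) atTop (𝓝 (y : H)) ∧ shift A z y = w := by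
  obtain ⟨s, C, h⟩ := hA.exists_norm_le z
  have hAx : ∀ y : A.domain, A y = shift A z y + z • (y : H) := fun y => by
    rw [shift_apply]; simp
  let L : A.domain →ₗ[ℂ] (s → ℂ) := LinearMap.pi fun l =>
    l.1.toLinearMap ∘ₗ (LinearMap.prod A.domain.subtype A.toFun)
  obtain ⟨B, hB⟩ := hw.norm.bddAbove_range
  have hB' : ∀ k, ‖shift A z (x k)‖ ≤ B := fun k => hB ⟨k, rfl⟩
  have hbd : ∀ k, L (x k) ∈ Set.pi Set.univ
      fun l : s => Metric.closedBall (0 : ℂ) (‖l.1‖ * (M + (B + ‖z‖ * M))) := by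
    intro k l _
    rw [mem_closedBall_zero_iff]
    change ‖l.1 ((x k : H), A (x k))‖ ≤ _
    refine (l.1.le_opNorm _).trans ?_
    gcongr
    rw [Prod.norm_def]
    have h1 : ‖A (x k)‖ ≤ B + ‖z‖ * M := by
      rw [hAx]
      refine (norm_add_le _ _).trans ?_
      rw [norm_smul]
      gcongr
      exacts [hB' k, hM k]
    have h2 := hM k
    have h3 := (norm_nonneg _).trans h1
    have h4 := (norm_nonneg _).trans h2
    exact max_le (by linarith) (by linarith)
  obtain ⟨a, -, φ, hφ, ha⟩ :=
    (isCompact_univ_pi fun l : s => isCompact_closedBall (0 : ℂ) _).tendsto_subseq hbd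
  have hz : CauchySeq fun k => (shift A z (x (φ k)), L (x (φ k))) :=
    ((hw.comp hφ.tendsto_atTop).prodMk_nhds ha).cauchySeq
  have hle : ∀ y : A.domain, ‖(y : H)‖ ^ 2 ≤ (|C| + 2 * s.card) * ‖(shift A z y, L y)‖ ^ 2 := by
    intro y
    have h1 : ‖shift A z y‖ ≤ ‖(shift A z y, L y)‖ := le_max_left _ _
    have h2 : ‖L y‖ ≤ ‖(shift A z y, L y)‖ := le_max_right _ _
    calc ‖(y : H)‖ ^ 2 ≤ C * ‖shift A z y‖ ^ 2 + 2 * ∑ l ∈ s, ‖l ((y : H), A y)‖ ^ 2 := h y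
      _ ≤ |C| * ‖(shift A z y, L y)‖ ^ 2 + 2 * ∑ l ∈ s, ‖(shift A z y, L y)‖ ^ 2 := by
        gcongr with l hl
        · exact le_abs_self C
        · exact (norm_le_pi_norm (L y) ⟨l, hl⟩).trans h2
      _ = _ := by rw [Finset.sum_const, nsmul_eq_mul]; ring
  have hx : CauchySeq fun k => (x (φ k) : H) := by
    rw [Metric.cauchySeq_iff] at hz ⊢
    intro ε hε
    set D := |C| + 2 * (s.card : ℝ)
    have hD : 0 ≤ D := by positivity
    obtain ⟨N, hN⟩ := hz (ε / (Real.sqrt D + 1)) (by positivity)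
    refine ⟨N, fun i hi j hj => ?_⟩
    have h1 := hN i hi j hj
    rw [dist_eq_norm] at h1 ⊢
    have h2 := hle (x (φ i) - x (φ j))
    rw [map_sub, map_sub, ← Prod.mk_sub_mk] at h2
    have h3 := Real.sqrt_le_sqrt h2
    rw [Real.sqrt_sq (norm_nonneg _), Real.sqrt_mul hD, Real.sqrt_sq (norm_nonneg _)] at h3
    rw [lt_div_iff₀ (by positivity)] at h1
    refine lt_of_le_of_lt h3 (lt_of_le_of_lt ?_ h1)
    rw [mul_comm]
    gcongr
    linarith
  obtain ⟨y, hy⟩ := cauchySeq_tendsto_of_complete hx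
  have hAy : Tendsto (fun k => A (x (φ k))) atTop (𝓝 (w + z • y)) := by
    simp_rw [hAx]
    exact (hw.comp hφ.tendsto_atTop).add (hy.const_smul z)
  have hmem : (y, w + z • y) ∈ A.graph :=
    hcl.mem_of_tendsto (hy.prodMk_nhds hAy) (Eventually.of_forall fun k => A.mem_graph (x (φ k)))
  obtain ⟨y', hy1, hy2⟩ := (LinearPMap.mem_graph_iff A).1 hmem
  simp only at hy1 hy2
  refine ⟨φ, y', hφ, by rw [hy1]; exact hy, ?_⟩
  rw [shift_apply, hy2, hy1]
  simp

variable [CompleteSpace H] {A : H →ₗ.[ℂ] H}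

theorem inner_apply_of_isSelfAdjoint (hA : IsSelfAdjoint A) (x y : A.domain) :
    inner ℂ (A x) (y : H) = inner ℂ (x : H) (A y) := by
  have h := LinearPMap.adjoint_isFormalAdjoint (T := A) hA.dense_domain
  rw [show A.adjoint = A from hA] at h
  exact h x y

/-- The hypothesis says that `(y, w)` lies in the graph of the adjoint, which is `A` itself. This is
how membership in the domain is obtained for vectors orthogonal to a range. -/
theorem exists_apply_eq_of_isSelfAdjoint (hA : IsSelfAdjoint A) {y w : H}
    (h : ∀ x : A.domain, inner ℂ w (x : H) = inner ℂ y (A x)) :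
    ∃ y' : A.domain, (y' : H) = y ∧ A y' = w := by
  have hadj : A.adjoint = A := hA
  have h1 : (y, w) ∈ A.adjoint.graph := by
    have hy := LinearPMap.mem_adjoint_domain_of_exists (T := A) y ⟨w, h⟩
    have := LinearPMap.adjoint_apply_eq (T := A) hA.dense_domain ⟨y, hy⟩ (x₀ := w) h
    rw [← this]
    exact A.adjoint.mem_graph ⟨y, hy⟩
  rw [hadj] at h1
  exact (LinearPMap.mem_graph_iff A).1 h1

/-- The Fredholm alternative: injectivity of `A - z` and compactness give a lower bound, hence
closed range, and the orthogonal complement of the range is the kernel of `A - z̄`, which is trivial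
as well. -/
theorem mem_resolventSet (hA : IsSelfAdjoint A) (hc : HasCompactDomain A) {z : ℂ}
    (hz : ∀ x : A.domain, shift A z x = 0 → x = 0) : z ∈ resolventSet A := by
  -- An eigenvalue of a symmetric operator is real, so a kernel of `A - z̄` would force `z̄ = z`.
  have hz' : ∀ x : A.domain, shift A (conj z) x = 0 → x = 0 := by
    intro x hx
    by_contra hne
    have hx' : A x = conj z • (x : H) := sub_eq_zero.1 hx
    have h1 := inner_apply_of_isSelfAdjoint hA x x
    rw [hx', inner_smul_left, inner_smul_right] at h1
    have hne' : inner ℂ (x : H) (x : H) ≠ 0 := by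
      rw [Ne, inner_self_eq_zero]
      exact fun h => hne (Subtype.ext h)
    have h2 : conj z = z := by simpa [eq_comm] using mul_right_cancel₀ hne' h1
    rw [h2] at hx
    exact hne (hz x hx)
  -- Otherwise there are unit vectors with `(A - z) y_k → 0`; a subsequence converges to a unit
  -- vector in the kernel.
  obtain ⟨c, hc0, hcb⟩ : ∃ c : ℝ, 0 < c ∧ ∀ x : A.domain, c * ‖(x : H)‖ ≤ ‖shift A z x‖ := by
    by_contra! hcon
    choose x hx using fun k : ℕ => hcon (1 / ((k : ℝ) + 1)) (by positivity)
    have hx0 : ∀ k, (x k : H) ≠ 0 := by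
      intro k h
      have := hx k
      rw [h, norm_zero, mul_zero] at this
      exact absurd this (not_lt.2 (norm_nonneg _))
    let y : ℕ → A.domain := fun k => ((‖(x k : H)‖⁻¹ : ℝ) : ℂ) • x k
    have hy1 : ∀ k, ‖(y k : H)‖ = 1 := fun k => by
      simp [y, norm_smul, norm_ne_zero_iff.2 (hx0 k)]
    have hyT : Tendsto (fun k => shift A z (y k)) atTop (𝓝 0) := by
      refine squeeze_zero_norm (fun k => ?_) tendsto_one_div_add_atTop_nhds_zero_nat
      rw [map_smul, norm_smul, Complex.norm_real, norm_inv, norm_norm, inv_mul_le_iff₀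
        (norm_pos_iff.2 (hx0 k)), mul_comm]
      exact (hx k).le
    obtain ⟨φ, w, -, hw, hw0⟩ := hc.exists_tendsto hA.isClosed z (fun k => (hy1 k).le) hyT
    have hw1 := hw.norm
    simp only [hy1] at hw1
    have := tendsto_nhds_unique hw1 tendsto_const_nhds
    rw [hz w hw0] at this
    simp at this
  have hclosed : IsClosed ((LinearMap.range (shift A z) : Submodule ℂ H) : Set H) := by
    refine isClosed_of_closure_subset fun w hw => ?_
    obtain ⟨v, hv, hvw⟩ := mem_closure_iff_seq_limit.1 hw
    choose x hx using hv
    obtain ⟨B, hB⟩ := hvw.norm.bddAbove_range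
    have hM : ∀ k, ‖(x k : H)‖ ≤ B / c := by
      intro k
      rw [le_div_iff₀ hc0, mul_comm]
      refine (hcb _).trans ?_
      rw [hx]
      exact hB ⟨k, rfl⟩
    obtain ⟨-, y, -, -, hy⟩ := hc.exists_tendsto hA.isClosed z (x := x) (w := w) hM
      (by simpa only [hx] using hvw)
    exact ⟨y, hy⟩
  have hrange : LinearMap.range (shift A z) = ⊤ := by
    have hcomp : CompleteSpace (LinearMap.range (shift A z)) := hclosed.completeSpace_coe
    rw [← Submodule.orthogonal_eq_bot_iff, Submodule.eq_bot_iff]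
    intro y hy
    rw [Submodule.mem_orthogonal'] at hy
    obtain ⟨y', rfl, hy2⟩ := exists_apply_eq_of_isSelfAdjoint hA (y := y) (w := conj z • y) <| by
      intro x
      have h1 := hy _ ⟨x, rfl⟩
      rw [shift_apply, inner_sub_right, sub_eq_zero, inner_smul_right] at h1
      rw [h1, inner_smul_left, Complex.conj_conj]
    rw [hz' y' (sub_eq_zero.2 hy2)]
    rfl
  let T : A.domain ≃ₗ[ℂ] H := LinearEquiv.ofBijective (shift A z)
    ⟨(injective_iff_map_eq_zero _).2 hz, LinearMap.range_eq_top.1 hrange⟩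
  have hT : ∀ x, T x = shift A z x := fun _ => rfl
  let R : H →L[ℂ] H := (A.domain.subtype ∘ₗ T.symm.toLinearMap).mkContinuous c⁻¹ fun y => by
    rw [inv_mul_eq_div, le_div_iff₀ hc0, mul_comm]
    have := hcb (T.symm y)
    rwa [← hT, T.apply_symm_apply] at this
  refine ⟨R, fun y => ⟨(T.symm y).2, ?_⟩, fun x => ?_⟩
  · have := T.apply_symm_apply y
    rw [hT, shift_apply] at this
    exact this
  · change ((T.symm (shift A z x) : A.domain) : H) = x
    rw [← hT, T.symm_apply_apply]

/-- A self-adjoint operator whose domain embeds compactly has discrete spectrum. -/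
theorem hasDiscreteSpectrum_of_hasCompactDomain (hA : IsSelfAdjoint A) (hc : HasCompactDomain A) :
    HasDiscreteSpectrum A := by
  refine ⟨fun z hacc => ?_, fun z hz => ⟨fun h => hz (mem_resolventSet hA hc fun x hx => ?_),
    hc.finiteDimensional z⟩⟩
  -- Spectral points different from `z` that tend to `z` are eigenvalues; their unit eigenvectors
  -- subconverge to a unit eigenvector `w` for `z`.
  · have hev : ∀ k : ℕ, ∃ μ x, ‖μ - z‖ ≤ 1 / ((k : ℝ) + 1) ∧ μ ≠ z ∧ shift A μ x = 0 ∧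
        ‖(x : H)‖ = 1 := by
      intro k
      obtain ⟨μ, ⟨hμ1, hμ2⟩, hμ3⟩ := accPt_iff_nhds.1 hacc (Metric.ball z (1 / ((k : ℝ) + 1)))
        (Metric.ball_mem_nhds _ (by positivity))
      have h1 : ¬ ∀ x : A.domain, shift A μ x = 0 → x = 0 := fun h =>
        hμ2 (mem_resolventSet hA hc h)
      push Not at h1
      obtain ⟨x, hx, hx0⟩ := h1
      have hx0' : (x : H) ≠ 0 := fun h => hx0 (Subtype.ext h)
      refine ⟨μ, ((‖(x : H)‖⁻¹ : ℝ) : ℂ) • x, ?_, hμ3, by rw [map_smul, hx, smul_zero], ?_⟩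
      · rw [← dist_eq_norm]
        exact (Metric.mem_ball.1 hμ1).le
      · simp [norm_smul, norm_ne_zero_iff.2 hx0']
    choose μ x hμ hne hx hx1 using hev
    have hAx : ∀ k, A (x k) = μ k • (x k : H) := fun k => sub_eq_zero.1 (hx k)
    have hT : Tendsto (fun k => shift A z (x k)) atTop (𝓝 0) := by
      refine squeeze_zero_norm (fun k => ?_) tendsto_one_div_add_atTop_nhds_zero_nat
      rw [shift_apply, hAx, ← sub_smul, norm_smul, hx1, mul_one]
      exact hμ k
    obtain ⟨φ, w, -, hw, hw0⟩ := hc.exists_tendsto hA.isClosed z (fun k => (hx1 k).le) hT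
    have hAw : A w = z • (w : H) := sub_eq_zero.1 hw0
    have hw1 : ‖(w : H)‖ = 1 := by
      have := hw.norm
      simp only [hx1] at this
      exact (tendsto_nhds_unique this tendsto_const_nhds)
    have hww : inner ℂ (w : H) (w : H) ≠ 0 := by
      rw [Ne, inner_self_eq_zero]
      exact norm_ne_zero_iff.1 (by rw [hw1]; exact one_ne_zero)
    have hreal : conj z = z := by
      have h1 := inner_apply_of_isSelfAdjoint hA w w
      rw [hAw, inner_smul_left, inner_smul_right] at h1
      exact mul_right_cancel₀ hww h1
    -- Eigenvectors for distinct eigenvalues are orthogonal, which contradicts convergence of a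
    -- subsequence of `x k` to `w`.
    have horth : ∀ k, inner ℂ (w : H) (x k : H) = 0 := by
      intro k
      have h1 := inner_apply_of_isSelfAdjoint hA w (x k)
      rw [hAw, hAx, inner_smul_left, inner_smul_right, hreal] at h1
      by_contra h
      exact hne k (mul_right_cancel₀ h h1).symm
    have hlim : Tendsto (fun k => inner ℂ (w : H) (x (φ k) : H)) atTop
        (𝓝 (inner ℂ (w : H) (w : H))) := tendsto_const_nhds.inner hw
    simp only [horth] at hlim
    exact hww (tendsto_nhds_unique hlim tendsto_const_nhds)
  · exact (Submodule.eq_bot_iff _).1 h x hx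

end DiscreteSpectrum

/-! ### Estimates in `L²` by duality -/

section L2Norm

variable {T : Type*} [MeasurableSpace T]

/-- The `L²` norm of a function. -/
def l2norm (μ : Measure T) (f : T → ℂ) : ℝ :=
  Real.sqrt (∫ x, ‖f x‖ ^ 2 ∂μ)

theorem l2norm_nonneg (μ : Measure T) (f : T → ℂ) : 0 ≤ l2norm μ f :=
  Real.sqrt_nonneg _

theorem l2norm_sq (μ : Measure T) (f : T → ℂ) : l2norm μ f ^ 2 = ∫ x, ‖f x‖ ^ 2 ∂μ :=
  Real.sq_sqrt (integral_nonneg fun _ => by positivity)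

theorem l2norm_toLp {μ : Measure T} {f : T → ℂ} (hf : MemLp f 2 μ) :
    ‖hf.toLp f‖ = l2norm μ f := by
  rw [Lp.norm_toLp, hf.eLpNorm_eq_integral_rpow_norm (by norm_num) (by norm_num),
    ENNReal.toReal_ofReal (by positivity), l2norm, Real.sqrt_eq_rpow]
  norm_num

theorem norm_integral_mul_le {μ : Measure T} {f g : T → ℂ} (hf : MemLp f 2 μ) (hg : MemLp g 2 μ) :
    ‖∫ x, f x * g x ∂μ‖ ≤ l2norm μ f * l2norm μ g := by
  refine (norm_integral_le_integral_norm _).trans ?_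
  have h := integral_mul_le_Lp_mul_Lq_of_nonneg (μ := μ) (f := fun x => ‖f x‖)
    (g := fun x => ‖g x‖) Real.HolderConjugate.two_two (ae_of_all _ fun _ => norm_nonneg _)
    (ae_of_all _ fun _ => norm_nonneg _) (by simpa using hf.norm) (by simpa using hg.norm)
  simp only [norm_mul, l2norm, Real.sqrt_eq_rpow]
  simpa using h

theorem integrable_mul_of_memLp {μ : Measure T} {f g : T → ℂ} (hf : MemLp f 2 μ)
    (hg : MemLp g 2 μ) : Integrable (fun x => f x * g x) μ :=
  MemLp.integrable_mul hf hg

theorem l2norm_mono_measure {μ ν : Measure T} {f : T → ℂ} (hf : MemLp f 2 ν) (h : μ ≤ ν) :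
    l2norm μ f ≤ l2norm ν f := by
  refine Real.sqrt_le_sqrt (integral_mono_measure h (ae_of_all _ fun _ => by positivity) ?_)
  have := hf.integrable_norm_rpow (by norm_num) (by norm_num)
  simpa using this

theorem l2norm_le_of_bound {μ : Measure T} [IsFiniteMeasure μ] {g : T → ℂ} {C : ℝ} (hC : 0 ≤ C)
    (h : ∀ᵐ x ∂μ, ‖g x‖ ≤ C) : l2norm μ g ≤ C * Real.sqrt (μ.real Set.univ) := by
  refine Real.sqrt_le_iff.2 ⟨by positivity, ?_⟩
  rw [mul_pow, Real.sq_sqrt (by positivity)]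
  calc ∫ x, ‖g x‖ ^ 2 ∂μ ≤ ∫ x, C ^ 2 ∂μ := by
        refine integral_mono_of_nonneg (ae_of_all _ fun _ => by positivity) (integrable_const _) ?_
        filter_upwards [h] with x hx
        gcongr
    _ = C ^ 2 * μ.real Set.univ := by simp [mul_comm]

/-- The `L²` norm on an open set is determined by testing against smooth functions with compact
support. -/
theorem l2norm_le_of_forall_test {μ : Measure ℝ} [IsLocallyFiniteMeasure μ] {U : Set ℝ}
    (hU : IsOpen U) {f : ℝ → ℂ} (hf : MemLp f 2 (μ.restrict U)) {M : ℝ} (hM : 0 ≤ M)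
    (h : ∀ g : ℝ → ℂ, ContDiff ℝ ∞ g → HasCompactSupport g → tsupport g ⊆ U →
      ‖∫ x in U, f x * g x ∂μ‖ ≤ M * l2norm (μ.restrict U) g) :
    l2norm (μ.restrict U) f ≤ M := by
  have hmem : ∀ g : ℝ → ℂ, ContDiff ℝ ∞ g → HasCompactSupport g → MemLp g 2 (μ.restrict U) :=
    fun g hg hgc => hg.continuous.memLp_of_hasCompactSupport hgc
  let S : Submodule ℂ (Lp ℂ 2 (μ.restrict U)) :=
    { carrier := {v | ∃ (g : ℝ → ℂ) (hg : ContDiff ℝ ∞ g) (hgc : HasCompactSupport g),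
        tsupport g ⊆ U ∧ (hmem g hg hgc).toLp g = v}
      zero_mem' := ⟨fun _ => 0, contDiff_const, HasCompactSupport.zero, by simp [tsupport],
        MemLp.toLp_zero _⟩
      add_mem' := by
        rintro _ _ ⟨g, hg, hgc, hgU, rfl⟩ ⟨k, hk, hkc, hkU, rfl⟩
        exact ⟨g + k, hg.add hk, hgc.add hkc,
          (tsupport_add g k).trans (Set.union_subset hgU hkU), MemLp.toLp_add _ _⟩
      smul_mem' := by
        rintro c _ ⟨g, hg, hgc, hgU, rfl⟩
        refine ⟨c • g, contDiff_const.smul hg, hgc.smul_left (f := fun _ => c), ?_,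
          MemLp.toLp_const_smul _ _⟩
        exact (closure_mono (Function.support_const_smul_subset c g)).trans hgU }
  -- A vector orthogonal to all test functions vanishes almost everywhere by the fundamental lemma
  -- of the calculus of variations; real test functions suffice for this.
  have hdense : S.topologicalClosure = ⊤ := by
    rw [Submodule.topologicalClosure_eq_top_iff, Submodule.eq_bot_iff]
    intro v hv
    rw [Submodule.mem_orthogonal] at hv
    have hv0 : ∀ᵐ x ∂μ.restrict U, x ∈ U → v x = 0 := by
      have hvi : LocallyIntegrable v (μ.restrict U) :=
        (Lp.memLp v).locallyIntegrable (by norm_num)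
      refine hU.ae_eq_zero_of_integral_contDiff_smul_eq_zero (hvi.locallyIntegrableOn U) ?_
      intro g hg hgc hgU
      have hgs : ContDiff ℝ ∞ fun x => (g x : ℂ) := Complex.ofRealCLM.contDiff.comp hg
      have hgcs : HasCompactSupport fun x => (g x : ℂ) := hgc.comp_left Complex.ofReal_zero
      have h1 := hv _ ⟨_, hgs, hgcs, (closure_mono (Function.support_comp_subset
        Complex.ofReal_zero g)).trans hgU, rfl⟩
      rw [MeasureTheory.L2.inner_def] at h1
      rw [← h1]
      refine integral_congr_ae ?_
      filter_upwards [(hmem _ hgs hgcs).coeFn_toLp] with x hx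
      rw [hx, RCLike.inner_apply, Complex.conj_ofReal, mul_comm, Complex.real_smul]
    rw [Lp.eq_zero_iff_ae_eq_zero]
    filter_upwards [hv0, ae_restrict_mem hU.measurableSet] with x hx hxU using hx hxU
  -- The hypothesis concerns the bilinear pairing `∫ f g`; conjugating `f` turns it into an inner
  -- product.
  let f' : ℝ → ℂ := fun x => conj (f x)
  have hf' : MemLp f' 2 (μ.restrict U) :=
    memLp_congr_norm (Complex.continuous_conj.comp_aestronglyMeasurable hf.1) hf.1 (ae_of_all _ fun x => by simp) |>.2 hf
  have key : ∀ v : Lp ℂ 2 (μ.restrict U), ‖inner ℂ (hf'.toLp f') v‖ ≤ M * ‖v‖ := by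
    have hcl : IsClosed {v : Lp ℂ 2 (μ.restrict U) | ‖inner ℂ (hf'.toLp f') v‖ ≤ M * ‖v‖} :=
      isClosed_le (by fun_prop) (by fun_prop)
    intro v
    have hv : v ∈ S.topologicalClosure := by rw [hdense]; trivial
    refine closure_minimal ?_ hcl hv
    rintro _ ⟨g, hg, hgc, hgU, rfl⟩
    have h1 := h g hg hgc hgU
    change ‖inner ℂ (hf'.toLp f') ((hmem g hg hgc).toLp g)‖ ≤ M * ‖(hmem g hg hgc).toLp g‖
    rw [l2norm_toLp, MeasureTheory.L2.inner_def]
    refine le_of_eq_of_le (congrArg _ (integral_congr_ae ?_)) h1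
    filter_upwards [(hmem g hg hgc).coeFn_toLp, hf'.coeFn_toLp] with x hx hx'
    rw [hx, hx', RCLike.inner_apply, Complex.conj_conj, mul_comm]
  -- By density the bound holds for all vectors; for the vector itself it reads `‖f‖² ≤ M ‖f‖`.
  have h2 := key (hf'.toLp f')
  rw [inner_self_eq_norm_sq_to_K] at h2
  have h3 : ‖hf'.toLp f'‖ = l2norm (μ.restrict U) f := by
    rw [l2norm_toLp]
    simp [l2norm, f']
  rw [h3] at h2
  have h4 : l2norm (μ.restrict U) f ^ 2 ≤ M * l2norm (μ.restrict U) f := by simpa using h2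
  by_contra! hlt
  nlinarith

end L2Norm

/-! ### The radial equation -/

section Radial

variable {m α d : ℕ} {R : ℝ}

/-- The measure `r^(m+1) dr` on `(0, R)`. -/
def radial (m : ℕ) (R : ℝ) : Measure ℝ :=
  (volume.restrict (Set.Ioo 0 R)).withDensity fun r => ENNReal.ofReal (r ^ (m + 1))

theorem integral_radial {E : Type*} [NormedAddCommGroup E] [NormedSpace ℝ E] (f : ℝ → E) :
    ∫ r, f r ∂radial m R = ∫ r in Set.Ioo 0 R, r ^ (m + 1) • f r := by
  rw [radial, integral_withDensity_eq_integral_toReal_smul (by fun_prop) (by simp)]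
  refine setIntegral_congr_fun measurableSet_Ioo fun r hr => ?_
  have : 0 ≤ r ^ (m + 1) := pow_nonneg hr.1.le _
  simp [ENNReal.toReal_ofReal this]

theorem radial_restrict {t : ℝ} (ht : t ≤ R) : (radial m R).restrict (Set.Ioo 0 t) = radial m t := by
  rw [radial, restrict_withDensity measurableSet_Ioo, Measure.restrict_restrict measurableSet_Ioo,
    Set.inter_eq_self_of_subset_left (Set.Ioo_subset_Ioo_right ht), radial]

theorem radial_mono {t : ℝ} (ht : t ≤ R) : radial m t ≤ radial m R := by
  rw [← radial_restrict ht]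
  exact Measure.restrict_le_self

theorem ae_radial : ∀ᵐ r ∂radial m R, r ∈ Set.Ioo 0 R :=
  (withDensity_absolutelyContinuous _ _).ae_le (ae_restrict_mem measurableSet_Ioo)

instance : IsFiniteMeasure (radial m R) := by
  refine isFiniteMeasure_withDensity_ofReal ?_
  have h : IntegrableOn (fun r : ℝ => r ^ (m + 1)) (Set.Ioo 0 R) :=
    ((by fun_prop : Continuous fun r : ℝ => r ^ (m + 1)).integrableOn_Icc (a := 0) (b := R)).mono_set
      Set.Ioo_subset_Icc_self
  exact h.hasFiniteIntegral

theorem memLp_radial_of_bound {f : ℝ → ℂ} (hf : Measurable f) {C : ℝ}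
    (h : ∀ r ∈ Set.Ioo 0 R, ‖f r‖ ≤ C) : MemLp f 2 (radial m R) :=
  MemLp.of_bound hf.aestronglyMeasurable C (ae_radial.mono h)

/-- A measurable function that is bounded on `(0, R)`. -/
def BoundedMeasurableOn (R : ℝ) (f : ℝ → ℂ) : Prop :=
  Measurable f ∧ ∃ C : ℝ, ∀ r ∈ Set.Ioo 0 R, ‖f r‖ ≤ C

theorem BoundedMeasurableOn.memLp {f : ℝ → ℂ} (hf : BoundedMeasurableOn R f) :
    MemLp f 2 (radial m R) :=
  memLp_radial_of_bound hf.1 hf.2.choose_spec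

theorem BoundedMeasurableOn.const_mul {f : ℝ → ℂ} (hf : BoundedMeasurableOn R f) (c : ℂ) :
    BoundedMeasurableOn R fun r => c * f r := by
  obtain ⟨h, C, hC⟩ := hf
  refine ⟨h.const_mul c, ‖c‖ * C, fun r hr => ?_⟩
  rw [norm_mul]
  exact mul_le_mul_of_nonneg_left (hC r hr) (norm_nonneg _)

theorem Continuous.boundedMeasurableOn {f : ℝ → ℂ} (hf : Continuous f) :
    BoundedMeasurableOn R f := by
  obtain ⟨C, hC⟩ := (isCompact_Icc (a := (0 : ℝ)) (b := R)).exists_bound_of_continuousOn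
    hf.continuousOn
  exact ⟨hf.measurable, C, fun r hr => hC r (Set.Ioo_subset_Icc_self hr)⟩

theorem BoundedMeasurableOn.indicator {f : ℝ → ℂ} (hf : BoundedMeasurableOn R f) {s : Set ℝ}
    (hs : MeasurableSet s) : BoundedMeasurableOn R (s.indicator f) := by
  obtain ⟨h, C, hC⟩ := hf
  exact ⟨h.indicator hs, C, fun r hr => (norm_indicator_le_norm_self _ _).trans (hC r hr)⟩

theorem integral_radial_of_support {E : Type*} [NormedAddCommGroup E] [NormedSpace ℝ E] {t : ℝ}
    (ht : t ≤ R) {f : ℝ → E} (hf : ∀ r, t ≤ r → f r = 0) :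
    ∫ r, f r ∂radial m R = ∫ r, f r ∂radial m t := by
  rw [← radial_restrict ht, ← integral_indicator measurableSet_Ioo]
  refine integral_congr_ae ?_
  filter_upwards [ae_radial] with r hr
  by_cases h : r < t
  · rw [Set.indicator_of_mem (show r ∈ Set.Ioo 0 t from ⟨hr.1, h⟩)]
  · rw [hf r (not_lt.1 h), Set.indicator_of_notMem fun h' => h h'.2]

theorem memLp_radial_of_continuous {f : ℝ → ℂ} (hf : Continuous f) : MemLp f 2 (radial m R) :=
  (Continuous.boundedMeasurableOn hf).memLp

/-- The norm of `r^α` on `(0, t)`. -/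
def powNorm (m α : ℕ) (t : ℝ) : ℝ := l2norm (radial m t) fun r => (r : ℂ) ^ α

theorem powNorm_nonneg (t : ℝ) : 0 ≤ powNorm m α t := l2norm_nonneg _ _

theorem powNorm_sq {t : ℝ} (ht : 0 ≤ t) :
    powNorm m α t ^ 2 = t ^ (2 * α + m + 2) / (2 * α + m + 2) := by
  rw [powNorm, l2norm_sq, integral_radial, ← integral_Ioc_eq_integral_Ioo,
    ← intervalIntegral.integral_of_le ht]
  have : ∀ r : ℝ, r ^ (m + 1) • ‖(r : ℂ) ^ α‖ ^ 2 = r ^ (2 * α + m + 1) := by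
    intro r
    rw [norm_pow, Complex.norm_real, ← pow_mul, mul_comm α 2, pow_mul, Real.norm_eq_abs, sq_abs,
      ← pow_mul, smul_eq_mul, ← pow_add]
    ring_nf
  simp only [this, integral_pow]
  push_cast
  rw [zero_pow (by omega), sub_zero]
  ring_nf

theorem powNorm_mono {s t : ℝ} (h : s ≤ t) : powNorm m α s ≤ powNorm m α t :=
  l2norm_mono_measure (memLp_radial_of_continuous (by fun_prop)) (radial_mono h)

theorem norm_integral_radial_le {f k : ℝ → ℂ} {t : ℝ} (ht : t ≤ R) (hf : MemLp f 2 (radial m R))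
    (hk : Measurable k) (hk1 : ∀ r ∈ Set.Ioo 0 t, ‖k r‖ ≤ r ^ α) :
    ‖∫ r, f r * k r ∂radial m t‖ ≤ l2norm (radial m R) f * powNorm m α t := by
  have hk2 : ∀ r ∈ Set.Ioo 0 t, ‖k r‖ ≤ t ^ α := fun r hr =>
    (hk1 r hr).trans (pow_le_pow_left₀ hr.1.le hr.2.le _)
  refine (norm_integral_mul_le (hf.mono_measure (radial_mono ht))
    (memLp_radial_of_bound hk hk2)).trans ?_
  refine mul_le_mul (l2norm_mono_measure hf (radial_mono ht)) ?_ (l2norm_nonneg _ _)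
    (l2norm_nonneg _ _)
  refine Real.sqrt_le_sqrt (integral_mono_of_nonneg (ae_of_all _ fun _ => by positivity) ?_ ?_)
  · have h := (memLp_radial_of_continuous (m := m) (R := t)
      (by fun_prop : Continuous fun r : ℝ => (r : ℂ) ^ α)).integrable_norm_rpow (by norm_num)
      (by norm_num)
    simpa using h
  · filter_upwards [ae_radial] with r hr
    have := hk1 r hr
    rw [norm_pow, Complex.norm_real, Real.norm_of_nonneg hr.1.le]
    gcongr

/-- The operator `(r^(d+1) q')'`. -/
def radialOp (d : ℕ) (q : ℝ → ℂ) (r : ℝ) : ℂ :=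
  deriv (fun s : ℝ => (s : ℂ) ^ (d + 1) * deriv q s) r

/-- The weak form of the equation that the Fourier coefficients of a solution of
`∂(|ζ|⁻ᵐ ∂̄u) = -|ζ|ᵐ F` satisfy. -/
def WeakRadial (m α d : ℕ) (R : ℝ) (u F : ℝ → ℂ) : Prop :=
  ∀ q : ℝ → ℂ, ContDiff ℝ ∞ q → HasCompactSupport q → tsupport q ⊆ Set.Ioo 0 R →
    ∫ r, u r * (radialOp d q r / (r : ℂ) ^ (α + m + 1)) ∂radial m R =
      -4 * ∫ r, F r * (q r * (r : ℂ) ^ α) ∂radial m R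

theorem contDiff_deriv_of_smooth {q : ℝ → ℂ} (hq : ContDiff ℝ ∞ q) : ContDiff ℝ ∞ (deriv q) :=
  (contDiff_infty_iff_deriv.1 hq).2

theorem radialOp_eq {q : ℝ → ℂ} (hq : ContDiff ℝ ∞ q) (r : ℝ) :
    radialOp d q r = (d + 1) * (r : ℂ) ^ d * deriv q r + (r : ℂ) ^ (d + 1) * deriv (deriv q) r := by
  have h1 : HasDerivAt (fun s : ℝ => (s : ℂ) ^ (d + 1)) ((d + 1) * (r : ℂ) ^ d) r := by
    simpa using (hasDerivAt_id r).ofReal_comp.fun_pow (d + 1)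
  have h2 : HasDerivAt (deriv q) (deriv (deriv q) r) r :=
    ((contDiff_deriv_of_smooth hq).differentiable (by simp)).differentiableAt.hasDerivAt
  exact (h1.mul h2).deriv

theorem continuous_radialOp {q : ℝ → ℂ} (hq : ContDiff ℝ ∞ q) : Continuous (radialOp d q) := by
  have h1 := contDiff_deriv_of_smooth hq
  have h2 := contDiff_deriv_of_smooth h1
  have : radialOp d q = fun r : ℝ =>
      (d + 1) * (r : ℂ) ^ d * deriv q r + (r : ℂ) ^ (d + 1) * deriv (deriv q) r :=
    funext fun r => radialOp_eq hq r
  rw [this]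
  have := h1.continuous
  have := h2.continuous
  fun_prop

theorem radialOp_sub_smul {q w : ℝ → ℂ} (hq : ContDiff ℝ ∞ q) (hw : ContDiff ℝ ∞ w) (c : ℂ)
    (r : ℝ) : radialOp d (fun s => q s - c * w s) r = radialOp d q r - c * radialOp d w r := by
  have hd : ∀ {f : ℝ → ℂ}, ContDiff ℝ ∞ f → Differentiable ℝ f := fun h =>
    h.differentiable (by simp)
  have hq1 := contDiff_deriv_of_smooth hq
  have hw1 := contDiff_deriv_of_smooth hw
  have h1 : deriv (fun s => q s - c * w s) = fun s => deriv q s - c * deriv w s := by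
    ext s
    rw [deriv_fun_sub (hd hq s) ((hd hw s).const_mul c), deriv_const_mul _ (hd hw s)]
  have h2 : deriv (fun s => deriv q s - c * deriv w s) r =
      deriv (deriv q) r - c * deriv (deriv w) r := by
    rw [deriv_fun_sub (hd hq1 r) ((hd hw1 r).const_mul c), deriv_const_mul _ (hd hw1 r)]
  rw [radialOp_eq (by fun_prop), radialOp_eq hq, radialOp_eq hw, h1, h2]
  ring

theorem tsupport_subset_of_eq_zero {q : ℝ → ℂ} {a b : ℝ} (h1 : ∀ r, r ≤ a → q r = 0)
    (h2 : ∀ r, b ≤ r → q r = 0) : tsupport q ⊆ Set.Icc a b := by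
  refine closure_minimal (fun r hr => ?_) isClosed_Icc
  by_contra h
  rw [Set.mem_Icc, not_and_or, not_le, not_le] at h
  exact hr (h.elim (fun h => h1 r h.le) fun h => h2 r h.le)

theorem tendsto_l2norm_radial (hR : 0 < R) {f : ℝ → ℂ} (hf : MemLp f 2 (radial m R)) {t : ℕ → ℝ}
    (ht : Tendsto t atTop (𝓝 0)) : Tendsto (fun k => l2norm (radial m (t k)) f) atTop (𝓝 0) := by
  have h1 : Tendsto (fun k => ∫ r, (Set.Ioo 0 (t k)).indicator (fun r => ‖f r‖ ^ 2) r ∂radial m R)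
      atTop (𝓝 (∫ r, (0 : ℝ) ∂radial m R)) := by
    refine tendsto_integral_of_dominated_convergence (fun r => ‖f r‖ ^ 2) ?_ ?_ ?_ ?_
    · intro k
      exact ((hf.1.norm.pow 2).indicator measurableSet_Ioo)
    · have := hf.integrable_norm_rpow (by norm_num) (by norm_num)
      simpa using this
    · intro k
      refine ae_of_all _ fun r => ?_
      exact (norm_indicator_le_norm_self _ _).trans (by simp)
    · filter_upwards [ae_radial] with r hr
      refine tendsto_const_nhds.congr' ?_
      filter_upwards [ht.eventually_lt_const hr.1] with k hk
      rw [Set.indicator_of_notMem fun h => (h.2.trans hk).false]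
  rw [integral_zero] at h1
  have h2 : Tendsto (fun k => Real.sqrt (∫ r, (Set.Ioo 0 (t k)).indicator
      (fun r => ‖f r‖ ^ 2) r ∂radial m R)) atTop (𝓝 0) := by
    simpa [Function.comp_def] using (Real.continuous_sqrt.tendsto 0).comp h1
  refine h2.congr' ?_
  filter_upwards [ht.eventually_le_const hR] with k hk
  rw [integral_indicator measurableSet_Ioo, radial_restrict hk, l2norm]

end Radial

/-! ### Cutoffs, and test functions that are constant near the origin -/

section RadialWeak

variable {m α d : ℕ} {R : ℝ}

/-- A smooth cutoff function. -/
theorem exists_cutoff {b c : ℝ} (h : b < c) : ∃ χ : ℝ → ℂ, ContDiff ℝ ∞ χ ∧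
    (∀ r, r ≤ b → χ r = 1) ∧ (∀ r, c ≤ r → χ r = 0) ∧ ∀ r, ‖χ r‖ ≤ 1 := by
  refine ⟨fun r => (Real.smoothTransition ((c - r) / (c - b)) : ℂ), ?_, ?_, ?_, ?_⟩
  · refine Complex.ofRealCLM.contDiff.comp (Real.smoothTransition.contDiff.comp ?_)
    fun_prop
  · intro r hr
    beta_reduce
    rw [Real.smoothTransition.one_of_one_le, Complex.ofReal_one]
    rw [le_div_iff₀ (by linarith)]
    linarith
  · intro r hr
    beta_reduce
    rw [Real.smoothTransition.zero_of_nonpos, Complex.ofReal_zero]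
    exact div_nonpos_of_nonpos_of_nonneg (by linarith) (by linarith)
  · intro r
    rw [Complex.norm_real, Real.norm_of_nonneg (Real.smoothTransition.nonneg _)]
    exact Real.smoothTransition.le_one _

theorem deriv_eq_zero_of_le {f : ℝ → ℂ} {b : ℝ} {c : ℂ} (h : ∀ r, r ≤ b → f r = c) {r : ℝ}
    (hr : r < b) : deriv f r = 0 := by
  have : f =ᶠ[𝓝 r] fun _ => c := by
    filter_upwards [eventually_lt_nhds hr] with s hs using h s hs.le
  rw [this.deriv_eq]
  simp

theorem deriv_eq_zero_of_ge {f : ℝ → ℂ} {b : ℝ} {c : ℂ} (h : ∀ r, b ≤ r → f r = c) {r : ℝ}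
    (hr : b < r) : deriv f r = 0 := by
  have : f =ᶠ[𝓝 r] fun _ => c := by
    filter_upwards [eventually_gt_nhds hr] with s hs using h s hs.le
  rw [this.deriv_eq]
  simp

theorem radialOp_eq_zero_of_le {f : ℝ → ℂ} {b : ℝ} {c : ℂ} (h : ∀ r, r ≤ b → f r = c) {r : ℝ}
    (hr : r < b) : radialOp d f r = 0 := by
  have : (fun s : ℝ => (s : ℂ) ^ (d + 1) * deriv f s) =ᶠ[𝓝 r] fun _ => 0 := by
    filter_upwards [eventually_lt_nhds hr] with s hs
    rw [deriv_eq_zero_of_le h hs, mul_zero]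
  rw [radialOp, this.deriv_eq]
  simp

theorem radialOp_eq_zero_of_ge {f : ℝ → ℂ} {b : ℝ} {c : ℂ} (h : ∀ r, b ≤ r → f r = c) {r : ℝ}
    (hr : b < r) : radialOp d f r = 0 := by
  have : (fun s : ℝ => (s : ℂ) ^ (d + 1) * deriv f s) =ᶠ[𝓝 r] fun _ => 0 := by
    filter_upwards [eventually_gt_nhds hr] with s hs
    rw [deriv_eq_zero_of_ge h hs, mul_zero]
  rw [radialOp, this.deriv_eq]
  simp

/-- Cutting off at the origin costs nothing in the limit for modes of high order. -/
theorem exists_radialOp_bound {w : ℝ → ℂ} (hw : ContDiff ℝ ∞ w)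
    (hw2 : ∀ r, 2 ≤ r → w r = 0) (d : ℕ) : ∃ C : ℝ, 0 ≤ C ∧ ∀ (k : ℝ), 0 < k → ∀ r : ℝ, 0 < r →
      ‖radialOp d (fun s => w (k * s)) r‖ * r ^ 2 ≤ C * r ^ (d + 1) := by
  have hw' := contDiff_deriv_of_smooth hw
  have hw'' := contDiff_deriv_of_smooth hw'
  -- Multiplied by `r^(1-d)`, the operator is of Euler type and commutes with dilations. So one
  -- bound of this function of `x = k r` on `[0, 2]` serves all `k`.
  have hcont : Continuous fun x : ℝ => (d + 1) * (x : ℂ) * deriv w x + (x : ℂ) ^ 2 *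
      deriv (deriv w) x := by
    have := hw'.continuous
    have := hw''.continuous
    fun_prop
  obtain ⟨C, hC⟩ := (isCompact_Icc (a := (0 : ℝ)) (b := 2)).exists_bound_of_continuousOn
    hcont.continuousOn
  refine ⟨|C|, abs_nonneg _, fun k hk r hr => ?_⟩
  by_cases hkr : k * r ≤ 2
  · have h1 : deriv (fun s => w (k * s)) = fun s => k * deriv w (k * s) := by
      ext s
      have := ((hw.differentiable (by simp)).differentiableAt (x := k * s)).hasDerivAt.scomp s
        ((hasDerivAt_id s).const_mul k)
      simpa [Function.comp_def] using this.deriv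
    have h2 : deriv (fun s => (k : ℂ) * deriv w (k * s)) r = k ^ 2 * deriv (deriv w) (k * r) := by
      have := ((hw'.differentiable (by simp)).differentiableAt (x := k * r)).hasDerivAt.scomp r
        ((hasDerivAt_id r).const_mul k)
      have := (this.const_mul (k : ℂ)).deriv
      simp only [Function.comp_def, mul_one] at this
      rw [this, Complex.real_smul]
      ring
    have hsm : ContDiff ℝ ∞ fun s => w (k * s) := hw.comp (by fun_prop)
    have h3 := hC (k * r) ⟨by positivity, hkr⟩
    have h4 : radialOp d (fun s => w (k * s)) r * (r : ℂ) ^ 2 = (r : ℂ) ^ (d + 1) *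
        ((d + 1) * ((k * r : ℝ) : ℂ) * deriv w (k * r) +
          ((k * r : ℝ) : ℂ) ^ 2 * deriv (deriv w) (k * r)) := by
      rw [radialOp_eq hsm, h1, h2]
      push_cast
      ring
    have h5 := congrArg norm h4
    rw [norm_mul, norm_mul, norm_pow, norm_pow, Complex.norm_real, Real.norm_of_nonneg hr.le] at h5
    rw [h5, mul_comm |C|]
    gcongr
    exact h3.trans (le_abs_self C)
  · rw [radialOp_eq_zero_of_ge (b := 2 / k) (c := 0), norm_zero, zero_mul]
    · positivity
    · intro s hs
      exact hw2 _ (by rwa [div_le_iff₀' hk] at hs)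
    · rw [div_lt_iff₀' hk]
      exact not_le.1 hkr

theorem measurable_radialOp_div {q : ℝ → ℂ} (hq : ContDiff ℝ ∞ q) (n : ℕ) :
    Measurable fun r : ℝ => radialOp d q r / (r : ℂ) ^ n := by
  have := (continuous_radialOp (d := d) hq).measurable
  fun_prop

/-- If `q` is constant near the origin, `(r^(d+1) q')' / r^n` is bounded. -/
theorem boundedMeasurableOn_radialOp_div {q : ℝ → ℂ} (hq : ContDiff ℝ ∞ q) {δ : ℝ} (hδ : 0 < δ)
    {c : ℂ} (h : ∀ r, r ≤ δ → q r = c) (n : ℕ) :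
    BoundedMeasurableOn R fun r : ℝ => radialOp d q r / (r : ℂ) ^ n := by
  obtain ⟨C, hC⟩ := (isCompact_Icc (a := (0 : ℝ)) (b := R)).exists_bound_of_continuousOn
    (continuous_radialOp (d := d) hq).continuousOn
  refine ⟨measurable_radialOp_div hq n, |C| / δ ^ n, fun r hr => ?_⟩
  beta_reduce
  by_cases hr' : r < δ
  · rw [radialOp_eq_zero_of_le h hr', zero_div, norm_zero]
    positivity
  · rw [norm_div, norm_pow, Complex.norm_real, Real.norm_of_nonneg hr.1.le]
    gcongr
    · exact (hC r (Set.Ioo_subset_Icc_self hr)).trans (le_abs_self C)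
    · exact not_lt.1 hr'

theorem memLp_radialOp_div {q : ℝ → ℂ} (hq : ContDiff ℝ ∞ q) {δ : ℝ} (hδ : 0 < δ) {c : ℂ}
    (h : ∀ r, r ≤ δ → q r = c) (n : ℕ) :
    MemLp (fun r : ℝ => radialOp d q r / (r : ℂ) ^ n) 2 (radial m R) :=
  (boundedMeasurableOn_radialOp_div hq hδ h n).memLp

/-- For `c ≠ 0`, subtract `c w((k+1) r)` from `q`, where `w` is a cutoff, so that the difference
vanishes near the origin, and let `k → ∞`. The error terms are integrals over `(0, 2/(k+1))`. The
condition `3m + 2 ≤ 2α` keeps the `L²` norm of `(r^(d+1) w_k')' / r^(α+m+1)` bounded, while the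
norms of `u` and `F` over the shrinking interval tend to zero. -/
theorem WeakRadial.extend {u F : ℝ → ℂ} (h : WeakRadial m α d R u F) (hR : 0 < R) (hR1 : R ≤ 1)
    (hd : d + m = 2 * α) (hu : MemLp u 2 (radial m R)) (hF : MemLp F 2 (radial m R))
    {q : ℝ → ℂ} (hq : ContDiff ℝ ∞ q) {b δ : ℝ} (hbR : b < R) (hδ : 0 < δ) {c : ℂ}
    (h0 : ∀ r, r ≤ δ → q r = c) (h1 : ∀ r, b ≤ r → q r = 0) (hc : c = 0 ∨ 3 * m + 2 ≤ 2 * α) :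
    ∫ r, u r * (radialOp d q r / (r : ℂ) ^ (α + m + 1)) ∂radial m R =
      -4 * ∫ r, F r * (q r * (r : ℂ) ^ α) ∂radial m R := by
  have test : ∀ {q : ℝ → ℂ} {δ b : ℝ}, ContDiff ℝ ∞ q → 0 < δ → b < R → (∀ r, r ≤ δ → q r = 0) →
      (∀ r, b ≤ r → q r = 0) →
      ∫ r, u r * (radialOp d q r / (r : ℂ) ^ (α + m + 1)) ∂radial m R =
        -4 * ∫ r, F r * (q r * (r : ℂ) ^ α) ∂radial m R := by
    intro q δ b hq hδ hb h0 h1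
    have hs := tsupport_subset_of_eq_zero h0 h1
    exact h q hq (isCompact_Icc.of_isClosed_subset (isClosed_tsupport _) hs)
      (hs.trans (Set.Icc_subset_Ioo hδ hb))
  by_cases hc0 : c = 0
  · exact test hq hδ hbR (by simpa [hc0] using h0) h1
  replace hc := hc.resolve_left hc0
  have hb0 : 0 < max δ b := lt_max_of_lt_left hδ
  obtain ⟨w, hw, hw1, hw2, hwn⟩ := exists_cutoff (one_lt_two (α := ℝ))
  have hwk : ∀ k : ℕ, ContDiff ℝ ∞ fun s => w (((k : ℝ) + 1) * s) := fun k => hw.comp (by fun_prop)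
  have ht : Tendsto (fun k : ℕ => 2 / ((k : ℝ) + 1)) atTop (𝓝 0) := by
    have := (tendsto_one_div_add_atTop_nhds_zero_nat (𝕜 := ℝ)).const_mul 2
    simpa [div_eq_mul_inv] using this
  have hwz : ∀ (k : ℕ) (r : ℝ), 2 / ((k : ℝ) + 1) ≤ r → w (((k : ℝ) + 1) * r) = 0 := by
    intro k r hr
    rw [div_le_iff₀' (by positivity)] at hr
    exact hw2 _ hr
  have hwo : ∀ (k : ℕ) (r : ℝ), r ≤ 1 / ((k : ℝ) + 1) → w (((k : ℝ) + 1) * r) = 1 := by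
    intro k r hr
    rw [le_div_iff₀' (by positivity)] at hr
    exact hw1 _ hr
  obtain ⟨C, hC0, hC⟩ := exists_radialOp_bound hw hw2 d
  -- the two error terms
  have hlim1 : Tendsto (fun k : ℕ => ∫ r, F r * (w (((k : ℝ) + 1) * r) * (r : ℂ) ^ α) ∂radial m R)
      atTop (𝓝 0) := by
    have h2 := (tendsto_l2norm_radial hR hF ht).mul_const (powNorm m α R)
    rw [zero_mul] at h2
    refine squeeze_zero_norm' ?_ h2
    filter_upwards [ht.eventually_le_const hR] with k hk
    rw [integral_radial_of_support hk fun r hr => by rw [hwz k r hr]; simp]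
    refine (norm_integral_radial_le le_rfl (hF.mono_measure (radial_mono hk)) (α := α) ?_ ?_).trans
      (mul_le_mul_of_nonneg_left (powNorm_mono hk) (l2norm_nonneg _ _))
    · exact (hwk k).continuous.measurable.mul (by fun_prop)
    · intro r hr
      rw [norm_mul, norm_pow, Complex.norm_real, Real.norm_of_nonneg hr.1.le]
      exact mul_le_of_le_one_left (pow_nonneg hr.1.le _) (hwn _)
  have hlim2 : Tendsto (fun k : ℕ => ∫ r, u r * (radialOp d (fun s => w (((k : ℝ) + 1) * s)) r /
      (r : ℂ) ^ (α + m + 1)) ∂radial m R) atTop (𝓝 0) := by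
    have h2 := (tendsto_l2norm_radial hR hu ht).mul_const (Real.sqrt (2 * C ^ 2))
    rw [zero_mul] at h2
    refine squeeze_zero_norm' ?_ h2
    filter_upwards [ht.eventually_lt_const hR] with k hk
    have hk0 : (0 : ℝ) < (k : ℝ) + 1 := by positivity
    set t : ℝ := 2 / ((k : ℝ) + 1) with htdef
    have ht0 : 0 < t := by positivity
    have hmem : MemLp (fun r : ℝ => radialOp d (fun s => w (((k : ℝ) + 1) * s)) r /
      (r : ℂ) ^ (α + m + 1)) 2 (radial m R) :=
        memLp_radialOp_div (hwk k) (δ := 1 / ((k : ℝ) + 1)) (by positivity) (hwo k) _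
    have hae : ∫ r, u r * (radialOp d (fun s => w (((k : ℝ) + 1) * s)) r /
        (r : ℂ) ^ (α + m + 1)) ∂radial m R = ∫ r, u r * (radialOp d
          (fun s => w (((k : ℝ) + 1) * s)) r / (r : ℂ) ^ (α + m + 1)) ∂radial m t := by
      have hle := hk.le
      rw [← radial_restrict (m := m) hle, ← integral_indicator measurableSet_Ioo]
      have hne : ∀ᵐ r ∂radial m R, r ≠ t :=
        (withDensity_absolutelyContinuous _ _).ae_le (ae_restrict_of_ae (Measure.ae_ne _ t))
      refine integral_congr_ae ?_
      filter_upwards [ae_radial, hne] with r hr hrt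
      by_cases h : r < t
      · rw [Set.indicator_of_mem (show r ∈ Set.Ioo 0 t from ⟨hr.1, h⟩)]
      · rw [Set.indicator_of_notMem fun h' => h h'.2, radialOp_eq_zero_of_ge (b := t) (c := 0)
          (fun s hs => hwz k s hs) (lt_of_le_of_ne (not_lt.1 h) hrt.symm)]
        simp
    rw [hae]
    refine (norm_integral_mul_le (hu.mono_measure (radial_mono hk.le))
      (hmem.mono_measure (radial_mono hk.le))).trans ?_
    refine mul_le_mul_of_nonneg_left (Real.sqrt_le_sqrt ?_) (l2norm_nonneg _ _)
    rw [integral_radial]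
    -- Since `|(r^(d+1) w_k')'| ≤ C r^(d-1)` and `d = 2α - m`, the left side is at most `C²
    -- r^(2α-3m-3)`. The exponent is at least `-1`, and `1/r ≤ k + 1` where the derivatives of `w_k`
    -- do not vanish. The interval has length `2/(k+1)`, so the integral is at most `2C²`.
    have hpt : ∀ r ∈ Set.Ioo 0 t, r ^ (m + 1) • ‖radialOp d (fun s => w (((k : ℝ) + 1) * s)) r /
        (r : ℂ) ^ (α + m + 1)‖ ^ 2 ≤ C ^ 2 * ((k : ℝ) + 1) := by
      intro r hr
      have hr0 := hr.1
      by_cases hrk : r < 1 / ((k : ℝ) + 1)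
      · rw [radialOp_eq_zero_of_le (hwo k) hrk]
        simp
        positivity
      · have h3 := hC ((k : ℝ) + 1) hk0 r hr0
        rw [not_lt, div_le_iff₀ hk0] at hrk
        set Y := ‖radialOp d (fun s => w (((k : ℝ) + 1) * s)) r‖
        have hY : 0 ≤ Y := norm_nonneg _
        have h4 : (Y * r ^ 2) ^ 2 ≤ (C * r ^ (d + 1)) ^ 2 := by gcongr
        obtain ⟨j, hj⟩ := Nat.exists_eq_add_of_le hc
        have hr1 : r ≤ 1 := (hr.2.trans hk).le.trans hR1
        have hrj : r ^ j ≤ 1 := pow_le_one₀ hr0.le hr1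
        have e : r * r ^ (d + 1 + (d + 1) + (m + 1)) =
            (r ^ (α + m + 1)) ^ 2 * (r ^ 2) ^ 2 * r ^ j := by
          rw [← pow_mul, ← pow_mul, ← pow_add, ← pow_add, ← pow_succ']
          congr 1
          omega
        rw [norm_div, norm_pow, Complex.norm_real, Real.norm_of_nonneg hr0.le, smul_eq_mul, div_pow,
          ← mul_div_assoc, div_le_iff₀ (by positivity)]
        have h5 : (r * (r ^ (m + 1) * Y ^ 2)) * (r ^ 2) ^ 2 ≤
            (C ^ 2 * (r ^ (α + m + 1)) ^ 2) * (r ^ 2) ^ 2 := by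
          calc (r * (r ^ (m + 1) * Y ^ 2)) * (r ^ 2) ^ 2 = r * r ^ (m + 1) * (Y * r ^ 2) ^ 2 := by
                ring
            _ ≤ r * r ^ (m + 1) * (C * r ^ (d + 1)) ^ 2 := by gcongr
            _ = C ^ 2 * (r * r ^ (d + 1 + (d + 1) + (m + 1))) := by ring
            _ = C ^ 2 * (r ^ (α + m + 1)) ^ 2 * (r ^ 2) ^ 2 * r ^ j := by rw [e]; ring
            _ ≤ _ := mul_le_of_le_one_right (by positivity) hrj
        have h6 := le_of_mul_le_mul_right h5 (by positivity)
        calc r ^ (m + 1) * Y ^ 2 ≤ (r * ((k : ℝ) + 1)) * (r ^ (m + 1) * Y ^ 2) :=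
              le_mul_of_one_le_left (by positivity) hrk
          _ = ((k : ℝ) + 1) * (r * (r ^ (m + 1) * Y ^ 2)) := by ring
          _ ≤ ((k : ℝ) + 1) * (C ^ 2 * (r ^ (α + m + 1)) ^ 2) := by gcongr
          _ = _ := by ring
    calc _ ≤ ∫ r in Set.Ioo 0 t, C ^ 2 * ((k : ℝ) + 1) := by
          refine integral_mono_of_nonneg ?_ (integrable_const _) ?_
          · filter_upwards [ae_restrict_mem measurableSet_Ioo] with r hr
            have := hr.1
            simp only [Pi.zero_apply, smul_eq_mul]
            positivity
          · filter_upwards [ae_restrict_mem measurableSet_Ioo] with r hr using hpt r hr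
      _ = 2 * C ^ 2 := by
          rw [setIntegral_const, Measure.real, Real.volume_Ioo, sub_zero,
            ENNReal.toReal_ofReal ht0.le, htdef, smul_eq_mul]
          field_simp
  -- the identity for the functions that vanish near the origin
  have hmain : ∀ᶠ k : ℕ in atTop,
      (∫ r, u r * (radialOp d q r / (r : ℂ) ^ (α + m + 1)) ∂radial m R) +
        4 * ∫ r, F r * (q r * (r : ℂ) ^ α) ∂radial m R =
      c * (∫ r, u r * (radialOp d (fun s => w (((k : ℝ) + 1) * s)) r /
        (r : ℂ) ^ (α + m + 1)) ∂radial m R) +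
      c * (4 * ∫ r, F r * (w (((k : ℝ) + 1) * r) * (r : ℂ) ^ α) ∂radial m R) := by
    filter_upwards [ht.eventually_lt_const hR, ht.eventually_lt_const hδ] with k hk hkδ
    have hk0 : (0 : ℝ) < (k : ℝ) + 1 := by positivity
    have h12 : 1 / ((k : ℝ) + 1) ≤ 2 / ((k : ℝ) + 1) := by gcongr; norm_num
    have h3 := test (q := fun s => q s - c * w (((k : ℝ) + 1) * s)) (δ := 1 / ((k : ℝ) + 1))
      (b := max b (2 / ((k : ℝ) + 1))) (hq.sub (contDiff_const.mul (hwk k))) (by positivity)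
      (max_lt hbR hk) (fun r hr => by
        rw [h0 r (by linarith), hwo k r hr]; ring) (fun r hr => by
        rw [h1 r (le_of_max_le_left hr), hwz k r (le_of_max_le_right hr)]; ring)
    have hm1 : MemLp (fun r : ℝ => radialOp d q r / (r : ℂ) ^ (α + m + 1)) 2 (radial m R) :=
      memLp_radialOp_div hq hδ h0 _
    have hm2 : MemLp (fun r : ℝ => radialOp d (fun s => w (((k : ℝ) + 1) * s)) r /
      (r : ℂ) ^ (α + m + 1)) 2 (radial m R) :=
        memLp_radialOp_div (hwk k) (δ := 1 / ((k : ℝ) + 1)) (by positivity) (hwo k) _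
    have hm3 : MemLp (fun r : ℝ => q r * (r : ℂ) ^ α) 2 (radial m R) :=
      memLp_radial_of_continuous (by have := hq.continuous; fun_prop)
    have hm4 : MemLp (fun r : ℝ => w (((k : ℝ) + 1) * r) * (r : ℂ) ^ α) 2 (radial m R) :=
      memLp_radial_of_continuous (by have := (hwk k).continuous; fun_prop)
    have e1 : ∫ r, u r * (radialOp d (fun s => q s - c * w (((k : ℝ) + 1) * s)) r /
        (r : ℂ) ^ (α + m + 1)) ∂radial m R =
        (∫ r, u r * (radialOp d q r / (r : ℂ) ^ (α + m + 1)) ∂radial m R) -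
        c * (∫ r, u r * (radialOp d (fun s => w (((k : ℝ) + 1) * s)) r /
          (r : ℂ) ^ (α + m + 1)) ∂radial m R) := by
      rw [← integral_const_mul, ← integral_sub (integrable_mul_of_memLp hu hm1)
        ((integrable_mul_of_memLp hu hm2).const_mul c)]
      congr 1
      ext r
      rw [radialOp_sub_smul hq (hwk k)]
      ring
    have e2 : ∫ r, F r * ((q r - c * w (((k : ℝ) + 1) * r)) * (r : ℂ) ^ α) ∂radial m R =
        (∫ r, F r * (q r * (r : ℂ) ^ α) ∂radial m R) -
        c * ∫ r, F r * (w (((k : ℝ) + 1) * r) * (r : ℂ) ^ α) ∂radial m R := by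
      rw [← integral_const_mul, ← integral_sub (integrable_mul_of_memLp hF hm3)
        ((integrable_mul_of_memLp hF hm4).const_mul c)]
      congr 1
      ext r
      ring
    rw [e1, e2] at h3
    linear_combination h3
  have hz := (hlim2.const_mul c).add ((hlim1.const_mul 4).const_mul c)
  simp only [mul_zero, add_zero] at hz
  have := tendsto_nhds_unique (tendsto_const_nhds.congr' hmain) hz
  linear_combination this

end RadialWeak

/-! ### Solution of the radial equation and the basic estimate by duality -/

section RadialBound

variable {m α d : ℕ} {R : ℝ}

/-- Fubini's theorem on the triangle `r < t`. It replaces an integration by parts, so `f` need only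
be integrable. -/
theorem integral_radial_mul_primitive {f ψ : ℝ → ℂ} (hf : Integrable f (radial m R))
    (hψ : Continuous ψ) :
    ∫ r, f r * (∫ t in r..R, ψ t) ∂radial m R =
      ∫ t in Set.Ioo 0 R, ψ t * ∫ r, f r ∂radial m t := by
  have h1 : ∀ r ∈ Set.Ioo 0 R, ∫ t in r..R, ψ t =
      ∫ t in Set.Ioo 0 R, (Set.Ioi r).indicator ψ t := by
    intro r hr
    rw [intervalIntegral.integral_of_le hr.2.le, integral_Ioc_eq_integral_Ioo,
      setIntegral_indicator measurableSet_Ioi]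
    congr 2
    ext t
    simp only [Set.mem_Ioo, Set.mem_inter_iff, Set.mem_Ioi]
    have := hr.1
    constructor
    · exact fun h => ⟨⟨by linarith [h.1], h.2⟩, h.1⟩
    · exact fun h => ⟨h.2, h.1.2⟩
  have h2 : ∀ t ∈ Set.Ioo 0 R, ψ t * ∫ r, f r ∂radial m t =
      ∫ r, f r * (Set.Ioi r).indicator ψ t ∂radial m R := by
    intro t ht
    rw [← radial_restrict ht.2.le, ← integral_indicator measurableSet_Ioo, ← integral_const_mul]
    refine integral_congr_ae ?_
    filter_upwards [ae_radial] with r hr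
    by_cases h : r < t
    · rw [Set.indicator_of_mem (show r ∈ Set.Ioo 0 t from ⟨hr.1, h⟩), Set.indicator_of_mem
        (show t ∈ Set.Ioi r from h), mul_comm]
    · rw [Set.indicator_of_notMem fun h' => h h'.2, Set.indicator_of_notMem (show t ∉ Set.Ioi r from h),
        mul_zero, mul_zero]
  rw [setIntegral_congr_fun measurableSet_Ioo h2, integral_integral_swap]
  · refine integral_congr_ae ?_
    filter_upwards [ae_radial] with r hr
    rw [h1 r hr, integral_const_mul]
  · have hψi : Integrable ψ (volume.restrict (Set.Ioo 0 R)) :=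
      (hψ.integrableOn_Icc (a := 0) (b := R)).mono_set Set.Ioo_subset_Icc_self
    have hs : MeasurableSet {p : ℝ × ℝ | p.2 < p.1} := measurableSet_lt measurable_snd measurable_fst
    refine ((hψi.mul_prod hf).indicator hs).congr (ae_of_all _ fun p => ?_)
    by_cases h : p.2 < p.1
    · simp [Set.indicator, h, mul_comm, Function.uncurry]
    · simp [Set.indicator, h, Function.uncurry]

/-- The integral of `t^(-d-1)` from `r` to `R`, for `r ≥ b`. -/
def tailIntegral (d : ℕ) (b R r : ℝ) : ℂ := ∫ t in r..R, (((max t b : ℝ) : ℂ) ^ (d + 1))⁻¹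

theorem continuous_tailIntegral {b : ℝ} (hb : 0 < b) : Continuous (tailIntegral d b R) := by
  have hc : Continuous fun t : ℝ => (((max t b : ℝ) : ℂ) ^ (d + 1))⁻¹ := by
    refine Continuous.inv₀ (by fun_prop) fun t => pow_ne_zero _ ?_
    exact Complex.ofReal_ne_zero.2 (hb.trans_le (le_max_right _ _)).ne'
  have : tailIntegral d b R = fun r => -∫ t in R..r, (((max t b : ℝ) : ℂ) ^ (d + 1))⁻¹ := by
    ext r
    rw [tailIntegral, intervalIntegral.integral_symm]
  rw [this]
  exact (intervalIntegral.continuous_primitive (fun _ _ => hc.intervalIntegrable _ _) R).neg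

/-- A crude bound: the integrand is largest at the lower end, and the interval has length at most
`1`. -/
theorem norm_tailIntegral_le {b r : ℝ} (hb : 0 < b) (hr : b ≤ r) (hrR : r ≤ R) (hR : R ≤ 1) :
    ‖tailIntegral d b R r‖ ≤ (r ^ (d + 1))⁻¹ := by
  have hr0 : 0 < r := hb.trans_le hr
  refine (intervalIntegral.norm_integral_le_of_norm_le_const (C := (r ^ (d + 1))⁻¹) ?_).trans ?_
  · intro t ht
    rw [Set.uIoc_of_le hrR] at ht
    rw [norm_inv, norm_pow, Complex.norm_real, Real.norm_of_nonneg
      (hb.le.trans (le_max_right _ _))]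
    gcongr
    exact ht.1.le.trans (le_max_left _ _)
  · rw [abs_of_nonneg (by linarith)]
    exact mul_le_of_le_one_right (by positivity) (by linarith)

/-- The error made by cutting off the solution `∫ t^(-d-1)` of the homogeneous equation. -/
def cutoffError (m α d : ℕ) (b R : ℝ) (χ : ℝ → ℂ) (r : ℝ) : ℂ :=
  (2 * deriv χ r - radialOp d χ r * tailIntegral d b R r) / (r : ℂ) ^ (α + m + 1)

theorem boundedMeasurableOn_cutoffError {b : ℝ} (hb : 0 < b) {χ : ℝ → ℂ} (hχ : ContDiff ℝ ∞ χ)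
    (h1 : ∀ r, r ≤ b → χ r = 1) : BoundedMeasurableOn R (cutoffError m α d b R χ) := by
  have hc : Continuous fun r => 2 * deriv χ r - radialOp d χ r * tailIntegral d b R r := by
    have := (contDiff_deriv_of_smooth hχ).continuous
    have := continuous_radialOp (d := d) hχ
    have := continuous_tailIntegral (d := d) (R := R) hb
    fun_prop
  obtain ⟨C, hC⟩ := (isCompact_Icc (a := (0 : ℝ)) (b := R)).exists_bound_of_continuousOn
    hc.continuousOn
  refine ⟨?_, |C| / b ^ (α + m + 1), fun r hr => ?_⟩
  · exact hc.measurable.div (by fun_prop)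
  · by_cases hr' : r < b
    · rw [cutoffError, radialOp_eq_zero_of_le h1 hr', deriv_eq_zero_of_le h1 hr']
      simp
      positivity
    · rw [cutoffError, norm_div, norm_pow, Complex.norm_real, Real.norm_of_nonneg hr.1.le]
      gcongr
      · exact (hC r (Set.Ioo_subset_Icc_self hr)).trans (le_abs_self C)
      · exact not_lt.1 hr'

open Classical in
/-- Zero for the modes of high order; for the others a bound for the constant of integration. -/
def modeConst (m α : ℕ) (R : ℝ) : ℝ :=
  if 3 * m + 2 ≤ 2 * α then 0 else ∫ t in (0 : ℝ)..R, t ^ (-(1 / 2) : ℝ)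

theorem contDiff_primitive {f : ℝ → ℂ} (hf : ContDiff ℝ ∞ f) (a : ℝ) :
    ContDiff ℝ ∞ (fun r => ∫ t in a..r, f t) ∧ deriv (fun r => ∫ t in a..r, f t) = f := by
  have h : ∀ r, HasDerivAt (fun r => ∫ t in a..r, f t) (f r) r := fun r =>
    intervalIntegral.integral_hasDerivAt_right (hf.continuous.intervalIntegrable _ _)
      (hf.continuous.stronglyMeasurableAtFilter _ _) hf.continuous.continuousAt
  have hd : deriv (fun r => ∫ t in a..r, f t) = f := funext fun r => (h r).deriv
  refine ⟨contDiff_infty_iff_deriv.2 ⟨fun r => (h r).differentiableAt, ?_⟩, hd⟩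
  rwa [hd]

/-- The norm of `u` on `(0, a)` is found by testing against `g` supported there. With `Q' =
r^(α+m+1) g` and `q₀' = Q / r^(d+1)`, the function `q = χ (q₀ + k)` satisfies `(r^(d+1) q')' =
r^(α+m+1) g` up to terms produced by `χ`. Beyond `a` the function `Q` is constant, so these terms
are multiples of two fixed functions, and `g` enters only through the numbers `k` and `Q a`. The
weak equation then expresses `∫ u g` by `F` and by two functionals of `u` that do not depend on `g`,
with coefficients bounded by multiples of the norm of `g`. -/
theorem l2norm_radial_le {u F χ : ℝ → ℂ} {a b c : ℝ} (h : WeakRadial m α d R u F)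
    (hR1 : R ≤ 1) (hd : d + m = 2 * α) (hu : MemLp u 2 (radial m R)) (hF : MemLp F 2 (radial m R))
    (ha : 0 < a) (hab : a < b) (hbc : b < c) (hcR : c < R) (hχ : ContDiff ℝ ∞ χ)
    (hχ1 : ∀ r, r ≤ b → χ r = 1) (hχ0 : ∀ r, c ≤ r → χ r = 0) {B : ℝ}
    (hB0 : 0 ≤ B) (hB : ∀ t ∈ Set.Ioo 0 R, powNorm m α t / t ^ (d + 1) *
      ‖∫ r, F r * (χ r * (r : ℂ) ^ α) ∂radial m t‖ ≤ B) :
    l2norm (radial m a) u ≤ 4 * B + modeConst m α R *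
        (4 * ‖∫ r, F r * (χ r * (r : ℂ) ^ α) ∂radial m R‖ +
          ‖∫ r, u r * (radialOp d χ r / (r : ℂ) ^ (α + m + 1)) ∂radial m R‖) +
      powNorm m α a * ‖∫ r, u r * cutoffError m α d b R χ r ∂radial m R‖ := by
  have hR : 0 < R := by linarith
  have hb : 0 < b := by linarith
  have hγ : 0 ≤ modeConst m α R := by
    rw [modeConst]
    split_ifs
    · exact le_rfl
    · exact intervalIntegral.integral_nonneg hR.le fun t ht => Real.rpow_nonneg ht.1 _
  have haR : a ≤ R := by linarith
  rw [← radial_restrict (m := m) haR]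
  refine l2norm_le_of_forall_test isOpen_Ioo (by
    rw [radial_restrict haR]; exact hu.mono_measure (radial_mono haR))
    (by have := powNorm_nonneg (m := m) (α := α) a; positivity) ?_
  intro g hg hgc hgs
  rw [radial_restrict haR]
  have hga : ∀ r, a ≤ r → g r = 0 := fun r hr =>
    image_eq_zero_of_notMem_tsupport fun h' => absurd (hgs h').2 (not_lt.2 hr)
  obtain ⟨δ, hδ, hgδ⟩ : ∃ δ, 0 < δ ∧ ∀ r, r ≤ δ → g r = 0 := by
    by_cases hne : (tsupport g).Nonempty
    · obtain ⟨x, hx, hmin⟩ := hgc.exists_isLeast hne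
      have hx0 := (hgs hx).1
      refine ⟨x / 2, by linarith, fun r hr => image_eq_zero_of_notMem_tsupport fun h' => ?_⟩
      linarith [hmin h']
    · refine ⟨1, one_pos, fun r _ => image_eq_zero_of_notMem_tsupport fun h' => hne ⟨r, h'⟩⟩
  set N := l2norm (radial m R) g with hN
  have hNa : l2norm (radial m a) g = N := by
    rw [hN, l2norm, l2norm, integral_radial_of_support (m := m) haR]
    intro r hr
    simp [hga r hr]
  have hN0 : 0 ≤ N := l2norm_nonneg _ _
  have hgm : MemLp g 2 (radial m R) := memLp_radial_of_continuous hg.continuous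
  -- the solution of the equation with right-hand side `g`
  set φ : ℝ → ℂ := fun t => (t : ℂ) ^ (α + m + 1) * g t with hφ
  have hofReal : ContDiff ℝ ∞ fun t : ℝ => (t : ℂ) := Complex.ofRealCLM.contDiff
  have hφs : ContDiff ℝ ∞ φ := (hofReal.pow _).mul hg
  set Q : ℝ → ℂ := fun r => ∫ t in (0 : ℝ)..r, φ t with hQ
  obtain ⟨hQs, hQd⟩ := contDiff_primitive hφs 0
  have hQδ : ∀ r, r ≤ δ → Q r = 0 := by
    intro r hr
    refine (intervalIntegral.integral_congr (g := fun _ => 0) fun t ht => ?_).trans (by simp)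
    have : t ≤ δ := ht.2.trans (max_le hδ.le hr)
    simp [hφ, hgδ t this]
  have hQa : ∀ r, a ≤ r → Q r = Q a := by
    intro r hr
    have h0 : ∫ t in a..r, φ t = 0 := by
      refine (intervalIntegral.integral_congr (g := fun _ => 0) fun t ht => ?_).trans (by simp)
      rw [Set.uIcc_of_le hr] at ht
      simp [hφ, hga t ht.1]
    have h1 := intervalIntegral.integral_add_adjacent_intervals
      (hφs.continuous.intervalIntegrable (μ := volume) 0 a) (hφs.continuous.intervalIntegrable a r)
    rw [h0, add_zero] at h1
    exact h1.symm
  have hQn : ∀ t ∈ Set.Ioo 0 R, ‖Q t‖ ≤ N * powNorm m α t := by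
    intro t ht
    have e : Q t = ∫ r, g r * (r : ℂ) ^ α ∂radial m t := by
      rw [integral_radial, hQ]
      simp only
      rw [intervalIntegral.integral_of_le ht.1.le, integral_Ioc_eq_integral_Ioo]
      congr 1
      ext r
      simp only [hφ, Complex.real_smul]
      push_cast
      ring
    rw [e]
    refine norm_integral_radial_le ht.2.le hgm (by fun_prop) fun r hr => ?_
    rw [norm_pow, Complex.norm_real, Real.norm_of_nonneg hr.1.le]
  -- `Q` vanishes on `(-∞, δ]`, so the division does not spoil smoothness at the origin.
  set ψ : ℝ → ℂ := fun t => Q t / (t : ℂ) ^ (d + 1) with hψ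
  have hψs : ContDiff ℝ ∞ ψ := by
    rw [contDiff_iff_contDiffAt]
    intro t
    by_cases ht : t = 0
    · have : ψ =ᶠ[𝓝 t] fun _ => 0 := by
        filter_upwards [eventually_lt_nhds (show t < δ by rw [ht]; exact hδ)] with s hs
        simp [hψ, hQδ s hs.le]
      exact contDiffAt_const.congr_of_eventuallyEq this
    · simp only [hψ, div_eq_mul_inv]
      exact hQs.contDiffAt.mul ((hofReal.contDiffAt.pow _).inv
        (pow_ne_zero _ (Complex.ofReal_ne_zero.2 ht)))
  have hψQ : ∀ t : ℝ, (t : ℂ) ^ (d + 1) * ψ t = Q t := by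
    intro t
    by_cases ht : t = 0
    · rw [hQδ t (by rw [ht]; exact hδ.le), ht]
      simp
    · exact mul_div_cancel₀ _ (pow_ne_zero _ (Complex.ofReal_ne_zero.2 ht))
  have hψn : ∀ t ∈ Set.Ioo 0 R, ‖ψ t‖ ≤ N * (powNorm m α t / t ^ (d + 1)) := by
    intro t ht
    rw [hψ]
    simp only
    rw [norm_div, norm_pow, Complex.norm_real, Real.norm_of_nonneg ht.1.le, ← mul_div_assoc]
    have := hQn t ht
    have := ht.1
    gcongr
  set q0 : ℝ → ℂ := fun r => ∫ t in R..r, ψ t with hq0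
  obtain ⟨hq0s, hq0d⟩ := contDiff_primitive hψs R
  have hq0δ : ∀ r, r ≤ δ → q0 r = q0 0 := by
    intro r hr
    have h0 : ∫ t in (0 : ℝ)..r, ψ t = 0 := by
      refine (intervalIntegral.integral_congr (g := fun _ => 0) fun t ht => ?_).trans (by simp)
      have : t ≤ δ := ht.2.trans (max_le hδ.le hr)
      simp [hψ, hQδ t this]
    have h1 := intervalIntegral.integral_add_adjacent_intervals
      (hψs.continuous.intervalIntegrable (μ := volume) R 0) (hψs.continuous.intervalIntegrable 0 r)
    rw [h0, add_zero] at h1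
    exact h1.symm
  have hq0b : ∀ r ∈ Set.Icc b R, q0 r = -(Q a * tailIntegral d b R r) := by
    intro r hr
    simp only [hq0]
    rw [tailIntegral, intervalIntegral.integral_symm,
      ← intervalIntegral.integral_const_mul]
    congr 1
    refine intervalIntegral.integral_congr fun t ht => ?_
    rw [Set.uIcc_of_le hr.2] at ht
    have htb : b ≤ t := hr.1.trans ht.1
    simp only [hψ, max_eq_left htb, hQa t (hab.le.trans htb), div_eq_mul_inv]
  -- the constant of integration
  obtain ⟨k, hkγ, hk⟩ : ∃ k : ℂ, ‖k‖ ≤ N * modeConst m α R ∧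
      (q0 0 + k = 0 ∨ 3 * m + 2 ≤ 2 * α) := by
    by_cases hhigh : 3 * m + 2 ≤ 2 * α
    · exact ⟨0, by rw [norm_zero]; positivity, Or.inr hhigh⟩
    · refine ⟨-q0 0, ?_, Or.inl (by ring)⟩
      rw [modeConst, if_neg hhigh, norm_neg, ← intervalIntegral.integral_const_mul]
      simp only [hq0]
      rw [intervalIntegral.integral_symm, norm_neg]
      refine intervalIntegral.norm_integral_le_of_norm_le hR.le ?_
        ((intervalIntegral.intervalIntegrable_rpow' (by norm_num)).const_mul N)
      have hneR : ∀ᵐ t : ℝ, t ≠ R := Measure.ae_ne _ R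
      filter_upwards [hneR] with t htR ht
      have ht' : t ∈ Set.Ioo 0 R := ⟨ht.1, lt_of_le_of_ne ht.2 htR⟩
      refine (hψn t ht').trans (mul_le_mul_of_nonneg_left ?_ hN0)
      have ht0 := ht.1
      have ht1 : t ≤ 1 := ht.2.trans hR1
      -- After squaring, `powNorm m α t / t^(d+1) ≤ t^(-1/2)` amounts to `2(d + 1) ≤ 2α + m + 3`,
      -- that is `2α ≤ 3m + 1`: exactly the modes excluded from the other case. The exponent `-1/2`
      -- is integrable at the origin.
      rw [Real.rpow_neg ht0.le, ← Real.sqrt_eq_rpow, div_le_iff₀ (by positivity),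
        inv_mul_eq_div, le_div_iff₀ (by positivity)]
      refine le_of_sq_le_sq ?_ (by positivity)
      rw [mul_pow, Real.sq_sqrt ht0.le, powNorm_sq ht0.le, ← pow_mul, div_mul_eq_mul_div,
        div_le_iff₀ (by positivity), ← pow_succ]
      calc t ^ (2 * α + m + 2 + 1) ≤ t ^ ((d + 1) * 2) :=
            pow_le_pow_of_le_one ht0.le ht1 (by omega)
        _ ≤ _ := le_mul_of_one_le_right (by positivity) (by
            have : (0 : ℝ) ≤ 2 * α + m := by positivity
            linarith)
  set q : ℝ → ℂ := fun r => χ r * (q0 r + k) with hq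
  have hqs : ContDiff ℝ ∞ q := hχ.mul (hq0s.add contDiff_const)
  have hmin : 0 < min δ b := lt_min hδ hb
  have key := h.extend hR hR1 hd hu hF hqs (b := c) (δ := min δ b) (c := q0 0 + k) hcR hmin
    (fun r hr => by
      simp only [hq]
      rw [hχ1 r (hr.trans (min_le_right _ _)), hq0δ r (hr.trans (min_le_left _ _)), one_mul])
    (fun r hr => by simp only [hq]; rw [hχ0 r hr, zero_mul]) hk
  -- the operator applied to the test function
  have hop : ∀ r ∈ Set.Ioo 0 R, radialOp d q r / (r : ℂ) ^ (α + m + 1) =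
      g r + k * (radialOp d χ r / (r : ℂ) ^ (α + m + 1)) + Q a * cutoffError m α d b R χ r := by
    intro r hr
    have hχd : HasDerivAt χ (deriv χ r) r :=
      (hχ.differentiable (by simp)).differentiableAt.hasDerivAt
    have hdq : (fun s : ℝ => (s : ℂ) ^ (d + 1) * deriv q s) = fun s : ℝ =>
        (s : ℂ) ^ (d + 1) * deriv χ s * (q0 s + k) + χ s * Q s := by
      ext s
      have h1 : HasDerivAt χ (deriv χ s) s :=
        (hχ.differentiable (by simp)).differentiableAt.hasDerivAt
      have h2 : HasDerivAt q0 (ψ s) s := by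
        have := ((hq0s.differentiable (by simp)).differentiableAt (x := s)).hasDerivAt
        rwa [hq0d] at this
      rw [hq, (h1.fun_mul (h2.add_const k)).deriv, ← hψQ s]
      ring
    have hA : HasDerivAt (fun s : ℝ => (s : ℂ) ^ (d + 1) * deriv χ s) (radialOp d χ r) r := by
      have hsm : ContDiff ℝ ∞ fun s : ℝ => (s : ℂ) ^ (d + 1) * deriv χ s :=
        (hofReal.pow _).mul (contDiff_deriv_of_smooth hχ)
      exact ((hsm.differentiable (by simp)).differentiableAt (x := r)).hasDerivAt
    have h2 : HasDerivAt q0 (ψ r) r := by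
      have := ((hq0s.differentiable (by simp)).differentiableAt (x := r)).hasDerivAt
      rwa [hq0d] at this
    have h3 : HasDerivAt Q (φ r) r := by
      have := ((hQs.differentiable (by simp)).differentiableAt (x := r)).hasDerivAt
      rwa [hQd] at this
    have hop1 : radialOp d q r = radialOp d χ r * (q0 r + k) + 2 * deriv χ r * Q r + χ r * φ r := by
      rw [radialOp, hdq, ((hA.fun_mul (h2.add_const k)).fun_add (hχd.fun_mul h3)).deriv, ← hψQ r]
      ring
    have hr0 : (r : ℂ) ^ (α + m + 1) ≠ 0 := pow_ne_zero _ (Complex.ofReal_ne_zero.2 hr.1.ne')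
    have hop2 : radialOp d q r = φ r + k * radialOp d χ r +
        Q a * (2 * deriv χ r - radialOp d χ r * tailIntegral d b R r) := by
      rw [hop1]
      -- Below `b` the cutoff is `1`. From `b` on, `g` vanishes, `Q = Q a` and `q₀` is `-Q a` times
      -- the tail integral.
      by_cases hrb : r < b
      · rw [radialOp_eq_zero_of_le hχ1 hrb, deriv_eq_zero_of_le hχ1 hrb, hχ1 r hrb.le]
        ring
      · have hbr := not_lt.1 hrb
        have hφ0 : φ r = 0 := by simp [hφ, hga r (hab.le.trans hbr)]
        rw [hφ0, hQa r (hab.le.trans hbr), hq0b r ⟨hbr, hr.2.le⟩]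
        ring
    rw [hop2, cutoffError, hφ]
    field_simp
  have hm1 : MemLp (fun r : ℝ => radialOp d χ r / (r : ℂ) ^ (α + m + 1)) 2 (radial m R) :=
    memLp_radialOp_div hχ hb hχ1 _
  have hm2 : MemLp (cutoffError m α d b R χ) 2 (radial m R) := (boundedMeasurableOn_cutoffError hb hχ hχ1).memLp
  have hm3 : MemLp (fun r : ℝ => χ r * (r : ℂ) ^ α) 2 (radial m R) :=
    memLp_radial_of_continuous (by have := hχ.continuous; fun_prop)
  have hm4 : MemLp (fun r : ℝ => χ r * q0 r * (r : ℂ) ^ α) 2 (radial m R) :=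
    memLp_radial_of_continuous (by have := hχ.continuous; have := hq0s.continuous; fun_prop)
  have e1 : ∫ r, u r * (radialOp d q r / (r : ℂ) ^ (α + m + 1)) ∂radial m R =
      (∫ r, u r * g r ∂radial m R) +
      k * (∫ r, u r * (radialOp d χ r / (r : ℂ) ^ (α + m + 1)) ∂radial m R) +
      Q a * ∫ r, u r * cutoffError m α d b R χ r ∂radial m R := by
    have i1 := integrable_mul_of_memLp hu hgm
    have i2 := (integrable_mul_of_memLp hu hm1).const_mul k
    have i3 := (integrable_mul_of_memLp hu hm2).const_mul (Q a)
    rw [← integral_const_mul, ← integral_const_mul, ← integral_add i1 i2]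
    refine Eq.trans ?_ (integral_add (i1.add i2) i3)
    refine integral_congr_ae ?_
    filter_upwards [ae_radial] with r hr
    rw [hop r hr]
    ring
  -- Exchanging the integrals transfers `ψ`, which is bounded by the norm of `g`, onto the
  -- primitives `∫₀ᵗ F χ r^α` that the hypothesis `hB` controls.
  have e2 : ∫ r, F r * (q r * (r : ℂ) ^ α) ∂radial m R =
      k * (∫ r, F r * (χ r * (r : ℂ) ^ α) ∂radial m R) -
      ∫ t in Set.Ioo 0 R, ψ t * ∫ r, F r * (χ r * (r : ℂ) ^ α) ∂radial m t := by
    have i1 := (integrable_mul_of_memLp hF hm3).const_mul k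
    have i2 := integrable_mul_of_memLp hF hm4
    rw [← integral_radial_mul_primitive (integrable_mul_of_memLp hF hm3) hψs.continuous,
      ← integral_const_mul, sub_eq_add_neg, ← integral_neg]
    rw [← integral_add i1]
    · congr 1
      ext r
      rw [intervalIntegral.integral_symm]
      simp only [hq, hq0]
      ring
    · refine i2.congr (ae_of_all _ fun r => ?_)
      beta_reduce
      rw [intervalIntegral.integral_symm]
      ring
  have hint : ‖∫ t in Set.Ioo 0 R, ψ t * ∫ r, F r * (χ r * (r : ℂ) ^ α) ∂radial m t‖ ≤ N * B := by
    refine (norm_setIntegral_le_of_norm_le_const (C := N * B) (by simp) fun t ht => ?_).trans ?_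
    · rw [norm_mul]
      calc _ ≤ N * (powNorm m α t / t ^ (d + 1)) *
            ‖∫ r, F r * (χ r * (r : ℂ) ^ α) ∂radial m t‖ := by
              gcongr
              exact hψn t ht
        _ = N * (powNorm m α t / t ^ (d + 1) *
            ‖∫ r, F r * (χ r * (r : ℂ) ^ α) ∂radial m t‖) := by ring
        _ ≤ _ := by
            gcongr
            exact hB t ht
    · rw [Measure.real, Real.volume_Ioo, sub_zero, ENNReal.toReal_ofReal hR.le]
      exact mul_le_of_le_one_right (by positivity) hR1
  have hint2 : ∫ r, u r * g r ∂radial m a = ∫ r, u r * g r ∂radial m R :=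
    (integral_radial_of_support haR fun r hr => by rw [hga r hr, mul_zero]).symm
  have hQan : ‖Q a‖ ≤ N * powNorm m α a := hQn a ⟨ha, by linarith⟩
  rw [hNa, hint2]
  have hfin : ∫ r, u r * g r ∂radial m R =
      4 * (∫ t in Set.Ioo 0 R, ψ t * ∫ r, F r * (χ r * (r : ℂ) ^ α) ∂radial m t) -
      k * (4 * (∫ r, F r * (χ r * (r : ℂ) ^ α) ∂radial m R)) -
      k * (∫ r, u r * (radialOp d χ r / (r : ℂ) ^ (α + m + 1)) ∂radial m R) -
      Q a * ∫ r, u r * cutoffError m α d b R χ r ∂radial m R := by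
    rw [e1, e2] at key
    linear_combination key
  rw [hfin]
  refine (norm_sub_le _ _).trans ?_
  refine (add_le_add_left ((norm_sub_le _ _).trans (add_le_add_left (norm_sub_le _ _) _)) _).trans ?_
  simp only [norm_mul, Complex.norm_ofNat]
  set I1 := ‖∫ r, F r * (χ r * (r : ℂ) ^ α) ∂radial m R‖
  set I2 := ‖∫ r, u r * (radialOp d χ r / (r : ℂ) ^ (α + m + 1)) ∂radial m R‖
  set I3 := ‖∫ r, u r * cutoffError m α d b R χ r ∂radial m R‖
  have j1 : ‖k‖ * (4 * I1) ≤ N * modeConst m α R * (4 * I1) := by gcongr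
  have j2 : ‖k‖ * I2 ≤ N * modeConst m α R * I2 := by gcongr
  have j3 : ‖Q a‖ * I3 ≤ N * powNorm m α a * I3 := by gcongr
  linarith

end RadialBound

/-! ### Smallness of the high modes and compactness of each mode -/

section RadialEstimates

variable {m α d : ℕ} {R : ℝ}

/-- Because `2α + m + 2 = (2m + 1) + (d + 1)`, the product equals `t^(2m+1) / (2α + m + 2)`. The
bound by `t` gives smallness near the origin, the bound by `1/(α + 1)` smallness for high modes. -/
theorem powNorm_mul_powNorm_div {t : ℝ} (ht : 0 < t) (ht1 : t ≤ 1) (hd : d + m = 2 * α) :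
    powNorm m α t / t ^ (d + 1) * powNorm m α t ≤ t ∧
      powNorm m α t / t ^ (d + 1) * powNorm m α t ≤ 1 / (α + 1) := by
  have e : powNorm m α t / t ^ (d + 1) * powNorm m α t = t ^ (2 * m + 1) / (2 * α + m + 2) := by
    have e1 : t ^ (2 * α + m + 2) = t ^ (2 * m + 1) * t ^ (d + 1) := by
      rw [← pow_add]
      congr 1
      omega
    rw [div_mul_eq_mul_div, ← sq, powNorm_sq ht.le, e1]
    field_simp
  have h1 : (0 : ℝ) ≤ α := by positivity
  have h2 : (0 : ℝ) ≤ m := by positivity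
  rw [e]
  constructor
  · rw [div_le_iff₀ (by positivity), pow_succ, mul_comm]
    refine mul_le_mul_of_nonneg_left ((pow_le_one₀ ht.le ht1).trans (by linarith)) ht.le
  · rw [div_le_div_iff₀ (by positivity) (by positivity), one_mul]
    refine (mul_le_of_le_one_left (by positivity) (pow_le_one₀ ht.le ht1)).trans (by linarith)

theorem powNorm_le_pow {t : ℝ} (ht : 0 ≤ t) (ht1 : t ≤ 1) : powNorm m α t ≤ t ^ α := by
  refine le_of_sq_le_sq ?_ (by positivity)
  have h1 : (0 : ℝ) ≤ α := by positivity
  have h2 : (0 : ℝ) ≤ m := by positivity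
  rw [powNorm_sq ht, div_le_iff₀ (by positivity), ← pow_mul]
  calc t ^ (2 * α + m + 2) ≤ t ^ (α * 2) := pow_le_pow_of_le_one ht ht1 (by omega)
    _ ≤ _ := le_mul_of_one_le_right (by positivity) (by linarith)

/-- The modes of high order are small in the interior. -/
theorem exists_forall_l2norm_radial_le (m : ℕ) (hR : 0 < R) (hR1 : R ≤ 1) {ε : ℝ} (hε : 0 < ε) :
    ∃ N : ℕ, ∀ α d : ℕ, N ≤ α → d + m = 2 * α → ∀ u F : ℝ → ℂ, MemLp u 2 (radial m R) →
      MemLp F 2 (radial m R) → WeakRadial m α d R u F →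
      l2norm (radial m (R / 4)) u ≤ ε * (l2norm (radial m R) u + l2norm (radial m R) F) := by
  obtain ⟨χ, hχ, hχ1, hχ0, hχn⟩ := exists_cutoff (show R / 2 < 3 * R / 4 by linarith)
  have hb : 0 < R / 2 := by linarith
  obtain ⟨C1, hC1⟩ := (isCompact_Icc (a := (0 : ℝ)) (b := R)).exists_bound_of_continuousOn
    (contDiff_deriv_of_smooth hχ).continuous.continuousOn
  obtain ⟨C2, hC2⟩ := (isCompact_Icc (a := (0 : ℝ)) (b := R)).exists_bound_of_continuousOn
    (contDiff_deriv_of_smooth (contDiff_deriv_of_smooth hχ)).continuous.continuousOn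
  set C := max (max C1 C2) 0 with hC
  have hC0 : 0 ≤ C := le_max_right _ _
  have hC1' : ∀ r ∈ Set.Icc 0 R, ‖deriv χ r‖ ≤ C := fun r hr =>
    (hC1 r hr).trans ((le_max_left _ _).trans (le_max_left _ _))
  have hC2' : ∀ r ∈ Set.Icc 0 R, ‖deriv (deriv χ) r‖ ≤ C := fun r hr =>
    (hC2 r hr).trans ((le_max_right _ _).trans (le_max_left _ _))
  set A : ℝ := (2 * C + C / (R / 2)) / (R / 2) ^ (m + 1) *
    Real.sqrt ((radial m R).real Set.univ) with hA
  have hA0 : 0 ≤ A := by positivity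
  -- `r^α` has norm at most `(R/4)^α` on `(0, R/4)`, whereas the cutoff error lives on `r ≥ R/2` and
  -- is bounded by a multiple of `(2α + 2) / (R/2)^α`. The ratio of the radii gives the factor
  -- `(1/2)^α`, which beats the linear factor.
  have herr : ∀ α d : ℕ, d + m = 2 * α →
      powNorm m α (R / 4) * l2norm (radial m R) (cutoffError m α d (R / 2) R χ) ≤
        A * ((2 * α + 2) * (1 / 2) ^ α) := by
    intro α d hd
    have hdα : (d : ℝ) ≤ 2 * α := by exact_mod_cast (by omega : d ≤ 2 * α)
    have h1 : ∀ r ∈ Set.Ioo 0 R, ‖cutoffError m α d (R / 2) R χ r‖ ≤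
        (2 * C + C / (R / 2)) * (2 * α + 2) / (R / 2) ^ (α + m + 1) := by
      intro r hr
      by_cases hr' : r < R / 2
      · rw [cutoffError, radialOp_eq_zero_of_le hχ1 hr', deriv_eq_zero_of_le hχ1 hr']
        simp
        positivity
      · rw [not_lt] at hr'
        have hr0 := hr.1
        have hr1 : r ≤ 1 := hr.2.le.trans hR1
        have hrI := Set.Ioo_subset_Icc_self hr
        rw [cutoffError, norm_div, norm_pow, Complex.norm_real, Real.norm_of_nonneg hr0.le]
        have h2 : ‖radialOp d χ r‖ ≤ (d + 2) * C * r ^ d := by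
          rw [radialOp_eq hχ]
          refine (norm_add_le _ _).trans ?_
          rw [norm_mul, norm_mul, norm_mul, norm_pow, norm_pow, Complex.norm_real,
            Real.norm_of_nonneg hr0.le]
          have h3 : ‖(d + 1 : ℂ)‖ = d + 1 := by exact_mod_cast Complex.norm_natCast (d + 1)
          have h4 : r ^ (d + 1) ≤ r ^ d := pow_le_pow_of_le_one hr0.le hr1 (by omega)
          have h5 := hC1' r hrI
          have h6 := hC2' r hrI
          rw [h3]
          calc _ ≤ ((d : ℝ) + 1) * r ^ d * C + r ^ d * C := by gcongr
            _ = _ := by ring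
        have h3 : ‖2 * deriv χ r - radialOp d χ r * tailIntegral d (R / 2) R r‖ ≤
            (2 * C + C / (R / 2)) * (2 * α + 2) := by
          refine (norm_sub_le _ _).trans ?_
          rw [norm_mul, norm_mul, Complex.norm_ofNat]
          have h4 := norm_tailIntegral_le (d := d) hb hr' hr.2.le hR1
          calc _ ≤ 2 * C + (d + 2) * C * r ^ d * (r ^ (d + 1))⁻¹ := by
                gcongr
                exact hC1' r hrI
            _ = 2 * C + (d + 2) * (C / r) := by
                rw [pow_succ]
                field_simp
            _ ≤ 2 * C * (2 * α + 2) + (2 * α + 2) * (C / (R / 2)) := by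
                have h1 : (0 : ℝ) ≤ α := by positivity
                refine add_le_add (le_mul_of_one_le_right (by positivity) (by linarith)) ?_
                gcongr
            _ = _ := by ring
        gcongr
    have h2 := l2norm_le_of_bound (μ := radial m R) (by positivity) (ae_radial.mono h1)
    calc _ ≤ (R / 4) ^ α * ((2 * C + C / (R / 2)) * (2 * α + 2) / (R / 2) ^ (α + m + 1) *
          Real.sqrt ((radial m R).real Set.univ)) := by
          refine mul_le_mul (powNorm_le_pow (by linarith) (by linarith)) h2 (l2norm_nonneg _ _)
            (by positivity)
      _ = _ := by
          have e1 : (R / 4) ^ α = (1 / 2) ^ α * (R / 2) ^ α := by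
            rw [← mul_pow]
            congr 1
            ring
          have e2 : (R / 2) ^ (α + m + 1) = (R / 2) ^ α * (R / 2) ^ (m + 1) := by
            rw [← pow_add]
            rfl
          rw [hA, e1, e2]
          field_simp
  have hlim : Tendsto (fun α : ℕ => A * ((2 * (α : ℝ) + 2) * (1 / 2) ^ α)) atTop (𝓝 0) := by
    have h1 := tendsto_self_mul_const_pow_of_lt_one (r := (1 / 2 : ℝ)) (by norm_num) (by norm_num)
    have h2 := tendsto_pow_atTop_nhds_zero_of_lt_one (r := (1 / 2 : ℝ)) (by norm_num) (by norm_num)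
    have h3 := ((h1.const_mul 2).add (h2.const_mul 2)).const_mul A
    simp only [mul_zero, add_zero] at h3
    refine h3.congr fun α => ?_
    ring
  have hlim2 : Tendsto (fun α : ℕ => 4 * (1 / ((α : ℝ) + 1))) atTop (𝓝 0) := by
    simpa using (tendsto_one_div_add_atTop_nhds_zero_nat (𝕜 := ℝ)).const_mul 4
  obtain ⟨N, hN⟩ := eventually_atTop.1 ((hlim.eventually_le_const hε).and
    (hlim2.eventually_le_const hε))
  -- The second entry guarantees `3m + 2 ≤ 2α`, so that `modeConst` vanishes.
  refine ⟨max N (3 * m + 2), fun α d hα hd u F hu hF hw => ?_⟩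
  obtain ⟨hN1, hN2⟩ := hN α (le_of_max_le_left hα)
  have hhigh : 3 * m + 2 ≤ 2 * α := by have := le_of_max_le_right hα; omega
  have hB : ∀ t ∈ Set.Ioo 0 R, powNorm m α t / t ^ (d + 1) *
      ‖∫ r, F r * (χ r * (r : ℂ) ^ α) ∂radial m t‖ ≤ l2norm (radial m R) F * (1 / (α + 1)) := by
    intro t ht
    have h1 := norm_integral_radial_le (α := α) ht.2.le hF (k := fun r => χ r * (r : ℂ) ^ α)
      (hχ.continuous.measurable.mul (by fun_prop)) fun r hr => by
        rw [norm_mul, norm_pow, Complex.norm_real, Real.norm_of_nonneg hr.1.le]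
        exact mul_le_of_le_one_left (pow_nonneg hr.1.le _) (hχn _)
    have h2 := (powNorm_mul_powNorm_div ht.1 (ht.2.le.trans hR1) hd).2
    have h3 : 0 ≤ powNorm m α t / t ^ (d + 1) :=
      div_nonneg (powNorm_nonneg t) (pow_nonneg ht.1.le _)
    calc _ ≤ powNorm m α t / t ^ (d + 1) * (l2norm (radial m R) F * powNorm m α t) := by gcongr
      _ = l2norm (radial m R) F * (powNorm m α t / t ^ (d + 1) * powNorm m α t) := by ring
      _ ≤ _ := mul_le_mul_of_nonneg_left h2 (l2norm_nonneg _ _)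
  have hF0 := l2norm_nonneg (radial m R) F
  have hu0 := l2norm_nonneg (radial m R) u
  have h1 := l2norm_radial_le hw hR1 hd hu hF (a := R / 4) (by linarith) (by linarith) (by linarith)
    (by linarith) hχ hχ1 hχ0 (by positivity) hB
  rw [modeConst, if_pos hhigh, zero_mul, add_zero] at h1
  refine h1.trans ?_
  have h2 : powNorm m α (R / 4) * ‖∫ r, u r * cutoffError m α d (R / 2) R χ r ∂radial m R‖ ≤
      ε * l2norm (radial m R) u := by
    calc _ ≤ powNorm m α (R / 4) * (l2norm (radial m R) u *
          l2norm (radial m R) (cutoffError m α d (R / 2) R χ)) := by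
          refine mul_le_mul_of_nonneg_left (norm_integral_mul_le hu
            (boundedMeasurableOn_cutoffError hb hχ hχ1).memLp) (powNorm_nonneg _)
      _ = (powNorm m α (R / 4) * l2norm (radial m R) (cutoffError m α d (R / 2) R χ)) *
          l2norm (radial m R) u := by ring
      _ ≤ _ := mul_le_mul_of_nonneg_right ((herr α d hd).trans hN1) hu0
  have h3 : 4 * (l2norm (radial m R) F * (1 / (α + 1))) ≤ ε * l2norm (radial m R) F := by
    calc _ = (4 * (1 / ((α : ℝ) + 1))) * l2norm (radial m R) F := by ring
      _ ≤ _ := mul_le_mul_of_nonneg_right hN2 hF0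
  linarith

/-- Every mode depends compactly on the graph norm. -/
theorem exists_l2norm_radial_le (hd : d + m = 2 * α) (hR : 0 < R) (hR1 : R ≤ 1) {ε : ℝ}
    (hε : 0 < ε) : ∃ (k : ℕ) (K : Fin k ⊕ Fin 3 → ℝ → ℂ), (∀ i, BoundedMeasurableOn R (K i)) ∧
      ∀ u F : ℝ → ℂ, MemLp u 2 (radial m R) → MemLp F 2 (radial m R) → WeakRadial m α d R u F →
      l2norm (radial m (R / 4)) u ≤ ε * l2norm (radial m R) F +
        ∑ i, (‖∫ r, u r * K i r ∂radial m R‖ + ‖∫ r, F r * K i r ∂radial m R‖) := by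
  obtain ⟨χ, hχ, hχ1, hχ0, hχn⟩ := exists_cutoff (show R / 2 < 3 * R / 4 by linarith)
  have hb : 0 < R / 2 := by linarith
  -- The basic estimate has the factor `4`, and below the constant `B` contains `2η` times the norm
  -- of `F`.
  set η : ℝ := ε / 8 with hη
  have hη0 : 0 < η := by positivity
  have hlim : Tendsto (fun k : ℕ => (η ^ (d + 1))⁻¹ * Real.sqrt (1 / ((k : ℝ) + 1))) atTop
      (𝓝 0) := by
    have := ((Real.continuous_sqrt.tendsto 0).comp
      (tendsto_one_div_add_atTop_nhds_zero_nat (𝕜 := ℝ))).const_mul (η ^ (d + 1))⁻¹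
    simpa [Function.comp_def] using this
  obtain ⟨k, hk⟩ := (hlim.eventually_le_const hη0).exists
  have hk1 : (0 : ℝ) < (k : ℝ) + 1 := by positivity
  set κ : ℝ → ℂ := fun r => χ r * (r : ℂ) ^ α with hκ
  have hκc : Continuous κ := by have := hχ.continuous; fun_prop
  have hκn : ∀ r, 0 < r → ‖κ r‖ ≤ r ^ α := fun r hr => by
    rw [hκ]
    simp only
    rw [norm_mul, norm_pow, Complex.norm_real, Real.norm_of_nonneg hr.le]
    exact mul_le_of_le_one_left (pow_nonneg hr.le _) (hχn _)
  let t : Fin (k + 1) → ℝ := fun j => (j : ℝ) * R / ((k : ℝ) + 1)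
  have htR : ∀ j, t j ≤ R := fun j => by
    have : (j : ℝ) ≤ (k : ℝ) + 1 := by exact_mod_cast j.2.le
    rw [div_le_iff₀ hk1, mul_comm]
    gcongr
  have hγ : 0 ≤ modeConst m α R := by
    rw [modeConst]
    split_ifs
    · exact le_rfl
    · exact intervalIntegral.integral_nonneg hR.le fun t ht => Real.rpow_nonneg ht.1 _
  -- The first family evaluates the primitive of `F κ` at the grid points `t j`; the other three are
  -- the functionals of `l2norm_radial_le`. Their coefficients are built into the kernels.
  let K : Fin (k + 1) ⊕ Fin 3 → ℝ → ℂ := Sum.elim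
    (fun j r => ((4 * (η ^ (d + 1))⁻¹ : ℝ) : ℂ) * (Set.Ioo 0 (t j)).indicator κ r)
    ![fun r => ((modeConst m α R * 4 : ℝ) : ℂ) * κ r,
      fun r => (modeConst m α R : ℂ) * (radialOp d χ r / (r : ℂ) ^ (α + m + 1)),
      fun r => (powNorm m α (R / 4) : ℂ) * cutoffError m α d (R / 2) R χ r]
  refine ⟨k + 1, K, ?_, fun u F hu hF hw => ?_⟩
  · rintro (j | j)
    · exact ((Continuous.boundedMeasurableOn hκc).indicator measurableSet_Ioo).const_mul _
    · fin_cases j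
      · exact (Continuous.boundedMeasurableOn hκc).const_mul _
      · exact (boundedMeasurableOn_radialOp_div hχ hb hχ1 _).const_mul _
      · exact (boundedMeasurableOn_cutoffError hb hχ hχ1).const_mul _
  have hF0 := l2norm_nonneg (radial m R) F
  set G : ℝ → ℂ := fun s => ∫ r, F r * κ r ∂radial m s with hG
  have hGind : ∀ s, s ≤ R → G s = ∫ r, F r * (Set.Ioo 0 s).indicator κ r ∂radial m R := by
    intro s hs
    rw [hG]
    simp only
    rw [← radial_restrict hs, ← integral_indicator measurableSet_Ioo]
    congr 1
    ext r
    by_cases h : r ∈ Set.Ioo 0 s <;> simp [h]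
  -- By Cauchy–Schwarz `G` is Hölder continuous of exponent `1/2`. So its values at the grid points,
  -- of spacing at most `1/(k+1)`, control all its values up to a small multiple of the norm of `F`.
  have hstep : ∀ s ∈ Set.Ioo 0 R, ‖G s‖ ≤
      l2norm (radial m R) F * Real.sqrt (1 / ((k : ℝ) + 1)) + ∑ j, ‖G (t j)‖ := by
    intro s hs
    have hx0 : 0 ≤ s * ((k : ℝ) + 1) / R := by have := hs.1; positivity
    have hfl : ⌊s * ((k : ℝ) + 1) / R⌋₊ < k + 1 := by
      rw [Nat.floor_lt hx0, div_lt_iff₀ hR]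
      push_cast
      rw [mul_comm]
      exact mul_lt_mul_of_pos_left hs.2 hk1
    let j : Fin (k + 1) := ⟨_, hfl⟩
    have hj1 : t j ≤ s := by
      have := Nat.floor_le hx0
      rw [le_div_iff₀ hR] at this
      rw [div_le_iff₀ hk1]
      exact this
    have hj2 : s - t j ≤ 1 / ((k : ℝ) + 1) := by
      have := (Nat.lt_floor_add_one (s * ((k : ℝ) + 1) / R)).le
      rw [div_le_iff₀ hR] at this
      rw [sub_le_iff_le_add]
      change s ≤ 1 / ((k : ℝ) + 1) + (j : ℝ) * R / ((k : ℝ) + 1)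
      rw [← add_div, le_div_iff₀ hk1]
      have e : ((j : ℕ) : ℝ) = (⌊s * ((k : ℝ) + 1) / R⌋₊ : ℝ) := rfl
      rw [e]
      linarith
    have htj : 0 ≤ t j := by positivity
    have hdiff : G s - G (t j) = ∫ r, F r * (Set.Ico (t j) s).indicator κ r ∂radial m R := by
      rw [hGind s hs.2.le, hGind _ (htR j), ← integral_sub
        (integrable_mul_of_memLp hF ((Continuous.boundedMeasurableOn hκc).indicator
          measurableSet_Ioo).memLp) (integrable_mul_of_memLp hF
            ((Continuous.boundedMeasurableOn hκc).indicator measurableSet_Ioo).memLp)]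
      refine integral_congr_ae ?_
      filter_upwards [ae_radial] with r hr
      have hr0 := hr.1
      by_cases h1 : r < t j
      · have h2 : r < s := h1.trans_le hj1
        simp [h1, h2, hr0]
      · by_cases h2 : r < s
        · simp [h1, h2, hr0, not_lt.1 h1]
        · simp [h1, h2]
    have h1 : ‖G s - G (t j)‖ ≤ l2norm (radial m R) F * Real.sqrt (1 / ((k : ℝ) + 1)) := by
      rw [hdiff]
      refine (norm_integral_mul_le hF ((Continuous.boundedMeasurableOn hκc).indicator
        measurableSet_Ico).memLp).trans (mul_le_mul_of_nonneg_left (Real.sqrt_le_sqrt ?_) hF0)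
      refine le_trans ?_ hj2
      rw [integral_radial]
      have hvol : ∫ r in Set.Ioo 0 R, (Set.Ico (t j) s).indicator (fun _ => (1 : ℝ)) r ≤ s - t j := by
        rw [setIntegral_indicator measurableSet_Ico, setIntegral_const, smul_eq_mul, mul_one]
        refine (measureReal_mono Set.inter_subset_right (by simp)).trans ?_
        rw [Measure.real, Real.volume_Ico, ENNReal.toReal_ofReal (by linarith)]
      refine le_trans (integral_mono_of_nonneg ?_ ?_ ?_) hvol
      · filter_upwards [ae_restrict_mem measurableSet_Ioo] with r hr
        have := hr.1
        simp only [Pi.zero_apply, smul_eq_mul]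
        positivity
      · exact (integrable_const (1 : ℝ)).indicator measurableSet_Ico
      · filter_upwards [ae_restrict_mem measurableSet_Ioo] with r hr
        have hr0 := hr.1
        by_cases h : r ∈ Set.Ico (t j) s
        · have h2 : r ≤ 1 := hr.2.le.trans hR1
          have h3 : ‖κ r‖ ≤ 1 := (hκn r hr0).trans (pow_le_one₀ hr0.le h2)
          simp only [Set.indicator_of_mem h, smul_eq_mul]
          exact mul_le_one₀ (pow_le_one₀ hr0.le h2) (by positivity)
            (pow_le_one₀ (norm_nonneg _) h3)
        · simp [Set.indicator_of_notMem h]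
    calc ‖G s‖ = ‖(G s - G (t j)) + G (t j)‖ := by rw [sub_add_cancel]
      _ ≤ _ := norm_add_le _ _
      _ ≤ _ := add_le_add h1 (Finset.single_le_sum (f := fun j => ‖G (t j)‖)
          (fun _ _ => norm_nonneg _) (Finset.mem_univ j))
  set S := ∑ j, ‖G (t j)‖ with hS
  have hS0 : 0 ≤ S := Finset.sum_nonneg fun _ _ => norm_nonneg _
  have hB : ∀ s ∈ Set.Ioo 0 R, powNorm m α s / s ^ (d + 1) *
      ‖∫ r, F r * (χ r * (r : ℂ) ^ α) ∂radial m s‖ ≤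
        2 * η * l2norm (radial m R) F + (η ^ (d + 1))⁻¹ * S := by
    intro s hs
    have hs0 := hs.1
    have hs1 : s ≤ 1 := hs.2.le.trans hR1
    have h0 : 0 ≤ powNorm m α s / s ^ (d + 1) := div_nonneg (powNorm_nonneg s) (pow_nonneg hs0.le _)
    -- Near the origin the weight in front of `G s` is singular, but the product is at most `s`
    -- times the norm of `F`. Away from it the weight is at most `η^(-d-1)`, and `k` was chosen so
    -- that this constant times the grid error is at most `η`.
    by_cases hsη : s ≤ η
    · have h1 := norm_integral_radial_le (α := α) hs.2.le hF (k := κ) hκc.measurable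
        fun r hr => hκn r hr.1
      have h2 := (powNorm_mul_powNorm_div hs0 hs1 hd).1
      calc _ ≤ powNorm m α s / s ^ (d + 1) * (l2norm (radial m R) F * powNorm m α s) := by gcongr
        _ = l2norm (radial m R) F * (powNorm m α s / s ^ (d + 1) * powNorm m α s) := by ring
        _ ≤ l2norm (radial m R) F * η := by gcongr; exact h2.trans hsη
        _ ≤ _ := by
          have : 0 ≤ (η ^ (d + 1))⁻¹ * S := by positivity
          nlinarith
    · have h1 : powNorm m α s / s ^ (d + 1) ≤ (η ^ (d + 1))⁻¹ := by
        rw [div_eq_mul_inv]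
        refine (mul_le_of_le_one_left (by positivity)
          ((powNorm_le_pow hs0.le hs1).trans (pow_le_one₀ hs0.le hs1))).trans ?_
        gcongr
        exact (not_le.1 hsη).le
      calc _ ≤ (η ^ (d + 1))⁻¹ *
            (l2norm (radial m R) F * Real.sqrt (1 / ((k : ℝ) + 1)) + S) := by
            gcongr
            exact hstep s hs
        _ = ((η ^ (d + 1))⁻¹ * Real.sqrt (1 / ((k : ℝ) + 1))) * l2norm (radial m R) F +
            (η ^ (d + 1))⁻¹ * S := by ring
        _ ≤ 2 * η * l2norm (radial m R) F + (η ^ (d + 1))⁻¹ * S := by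
            refine add_le_add (mul_le_mul_of_nonneg_right ?_ hF0) le_rfl
            linarith
  have h1 := l2norm_radial_le hw hR1 hd hu hF (a := R / 4) (by linarith) (by linarith) (by linarith)
    (by linarith) hχ hχ1 hχ0 (by positivity) hB
  refine h1.trans ?_
  have hfun : ∀ (f k : ℝ → ℂ) (c : ℝ), 0 ≤ c → ‖∫ r, f r * ((c : ℂ) * k r) ∂radial m R‖ =
      c * ‖∫ r, f r * k r ∂radial m R‖ := by
    intro f k c hc
    have e : ∀ r, f r * ((c : ℂ) * k r) = (c : ℂ) * (f r * k r) := fun r => by ring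
    simp only [e]
    rw [integral_const_mul, norm_mul, Complex.norm_real, Real.norm_of_nonneg hc]
  -- Every kernel is paired with both `u` and `F`; the superfluous pairings only enlarge the right
  -- side.
  have hsum1 : 4 * ((η ^ (d + 1))⁻¹ * S) ≤ ∑ j : Fin (k + 1),
      (‖∫ r, u r * K (Sum.inl j) r ∂radial m R‖ + ‖∫ r, F r * K (Sum.inl j) r ∂radial m R‖) := by
    rw [← mul_assoc, hS, Finset.mul_sum]
    refine Finset.sum_le_sum fun j _ => ?_
    rw [hGind _ (htR j), ← hfun _ _ _ (by positivity)]
    exact le_add_of_nonneg_left (norm_nonneg _)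
  have hsum2 : modeConst m α R * (4 * ‖∫ r, F r * κ r ∂radial m R‖ +
      ‖∫ r, u r * (radialOp d χ r / (r : ℂ) ^ (α + m + 1)) ∂radial m R‖) +
      powNorm m α (R / 4) * ‖∫ r, u r * cutoffError m α d (R / 2) R χ r ∂radial m R‖ ≤
      ∑ j : Fin 3, (‖∫ r, u r * K (Sum.inr j) r ∂radial m R‖ +
        ‖∫ r, F r * K (Sum.inr j) r ∂radial m R‖) := by
    rw [Fin.sum_univ_three]
    have j0 : ‖∫ r, F r * K (Sum.inr 0) r ∂radial m R‖ =
      modeConst m α R * 4 * ‖∫ r, F r * κ r ∂radial m R‖ := hfun _ _ _ (by positivity)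
    have j1 : ‖∫ r, u r * K (Sum.inr 1) r ∂radial m R‖ = modeConst m α R *
      ‖∫ r, u r * (radialOp d χ r / (r : ℂ) ^ (α + m + 1)) ∂radial m R‖ := hfun _ _ _ hγ
    have j2 : ‖∫ r, u r * K (Sum.inr 2) r ∂radial m R‖ = powNorm m α (R / 4) *
      ‖∫ r, u r * cutoffError m α d (R / 2) R χ r ∂radial m R‖ := hfun _ _ _ (powNorm_nonneg _)
    rw [j0, j1, j2]
    have n0 := norm_nonneg (∫ r, u r * K (Sum.inr 0) r ∂radial m R)
    have n1 := norm_nonneg (∫ r, F r * K (Sum.inr 1) r ∂radial m R)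
    have n2 := norm_nonneg (∫ r, F r * K (Sum.inr 2) r ∂radial m R)
    linarith
  rw [Fintype.sum_sum_type]
  have hεη : ε = 8 * η := by rw [hη]; ring
  rw [hεη]
  linarith

end RadialEstimates

/-! ### Wirtinger derivatives -/

section Wirtinger

/-- The real linear map `v ↦ a v + b v̄`. -/
def wirtingerCLM (a b : ℂ) : ℂ →L[ℝ] ℂ :=
  a • ContinuousLinearMap.id ℝ ℂ + b • (Complex.conjCLE : ℂ →L[ℝ] ℂ)

theorem wirtingerCLM_apply (a b v : ℂ) : wirtingerCLM a b v = a * v + b * conj v := by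
  simp [wirtingerCLM]

/-- The function `f` is real differentiable at `z`, with `∂f/∂z = a` and `∂f/∂z̄ = b`. -/
def HasWirtingerDerivAt (f : ℂ → ℂ) (a b z : ℂ) : Prop :=
  HasFDerivAt f (wirtingerCLM a b) z

variable {f g : ℂ → ℂ} {a b c d z : ℂ}

theorem HasWirtingerDerivAt.dz_eq (h : HasWirtingerDerivAt f a b z) : dz f z = a := by
  rw [dz, HasFDerivAt.fderiv h, wirtingerCLM_apply, wirtingerCLM_apply, map_one, Complex.conj_I]
  linear_combination (-(1 / 2) * a + 1 / 2 * b) * Complex.I_mul_I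

theorem HasWirtingerDerivAt.dzbar_eq (h : HasWirtingerDerivAt f a b z) : dzbar f z = b := by
  rw [dzbar, HasFDerivAt.fderiv h, wirtingerCLM_apply, wirtingerCLM_apply, map_one, Complex.conj_I]
  linear_combination (1 / 2 * a - 1 / 2 * b) * Complex.I_mul_I

theorem _root_.DifferentiableAt.hasWirtingerDerivAt (h : DifferentiableAt ℝ f z) :
    HasWirtingerDerivAt f (dz f z) (dzbar f z) z := by
  have e : fderiv ℝ f z = wirtingerCLM (dz f z) (dzbar f z) := by
    ext v
    have hv : v = v.re • (1 : ℂ) + v.im • Complex.I := by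
      simp [Complex.re_add_im]
    have hc : conj v = v.re - v.im * Complex.I := by
      apply Complex.ext <;> simp
    rw [wirtingerCLM_apply, hc]
    conv_lhs => rw [hv, map_add, map_smul, map_smul]
    conv_rhs => rw [← Complex.re_add_im v]
    simp only [dz, dzbar, Complex.real_smul]
    simp only [Complex.add_re, Complex.add_im, Complex.ofReal_re, Complex.ofReal_im, Complex.mul_re,
      Complex.mul_im, Complex.I_re, Complex.I_im]
    push_cast
    linear_combination (v.im * fderiv ℝ f z Complex.I) * Complex.I_mul_I
  unfold HasWirtingerDerivAt
  rw [← e]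
  exact h.hasFDerivAt

theorem HasWirtingerDerivAt.mul (hf : HasWirtingerDerivAt f a b z)
    (hg : HasWirtingerDerivAt g c d z) :
    HasWirtingerDerivAt (fun w => f w * g w) (a * g z + f z * c) (b * g z + f z * d) z := by
  refine (HasFDerivAt.fun_mul hf hg).congr_fderiv ?_
  ext v
  simp only [wirtingerCLM_apply, add_apply, smul_apply,
    smul_eq_mul]
  ring

theorem HasWirtingerDerivAt.conj (hf : HasWirtingerDerivAt f a b z) :
    HasWirtingerDerivAt (fun w => conj (f w)) (conj b) (conj a) z := by
  refine ((Complex.conjCLE : ℂ →L[ℝ] ℂ).hasFDerivAt.comp z hf).congr_fderiv ?_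
  ext v
  simp [wirtingerCLM_apply]
  ring

theorem _root_.HasDerivAt.hasWirtingerDerivAt (h : HasDerivAt f a z) :
    HasWirtingerDerivAt f a 0 z := by
  refine (h.hasFDerivAt.restrictScalars ℝ).congr_fderiv ?_
  ext v
  simp [wirtingerCLM_apply, mul_comm]

theorem HasWirtingerDerivAt.comp_holomorphic {ψ : ℂ → ℂ} (hf : HasWirtingerDerivAt f a b (ψ z))
    (hψ : HasDerivAt ψ c z) :
    HasWirtingerDerivAt (fun w => f (ψ w)) (a * c) (b * conj c) z := by
  refine (HasFDerivAt.comp z hf hψ.hasWirtingerDerivAt).congr_fderiv ?_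
  ext v
  simp [wirtingerCLM_apply]
  ring

theorem HasWirtingerDerivAt.congr_of_eventuallyEq (hf : HasWirtingerDerivAt f a b z)
    (h : g =ᶠ[𝓝 z] f) : HasWirtingerDerivAt g a b z :=
  HasFDerivAt.congr_of_eventuallyEq hf h

/-- The derivatives of `|z|` are `z̄/(2|z|)` and `z/(2|z|)`, obtained here by differentiating the
square root of `|z|²`. -/
theorem hasWirtingerDerivAt_comp_norm {p : ℝ → ℂ} {p' : ℂ} (hz : z ≠ 0)
    (hp : HasDerivAt p p' ‖z‖) :
    HasWirtingerDerivAt (fun w => p ‖w‖) (p' * conj z / (2 * ‖z‖)) (p' * z / (2 * ‖z‖)) z := by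
  have h1 : HasFDerivAt (fun w : ℂ => ‖w‖) (‖z‖⁻¹ • innerSL ℝ z) z := by
    have h2 := (hasStrictFDerivAt_norm_sq z).hasFDerivAt.sqrt (by
      simpa using hz)
    refine (h2.congr_of_eventuallyEq (Eventually.of_forall fun w => ?_)).congr_fderiv ?_
    · simp [Real.sqrt_sq (norm_nonneg w)]
    · ext v
      simp [Real.sqrt_sq (norm_nonneg z)]
      ring
  have h2 := hp.hasFDerivAt.comp z h1
  refine h2.congr_fderiv ?_
  ext v
  have hz' : (‖z‖ : ℂ) ≠ 0 := by simpa using hz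
  have hin : ((inner ℝ z v : ℝ) : ℂ) = (conj z * v + z * conj v) / 2 := by
    apply Complex.ext
    · simp [Complex.inner]
      ring
    · simp
      ring
  simp only [wirtingerCLM_apply, ContinuousLinearMap.comp_apply, smul_apply,
    innerSL_apply_apply, ContinuousLinearMap.toSpanSingleton_apply, smul_eq_mul, Complex.real_smul]
  push_cast
  rw [hin]
  field_simp

end Wirtinger

/-! ### Test functions with one Fourier mode -/

section Modes

variable {m α d : ℕ} {n : ℤ} {R : ℝ}

/-- The function `(ζ/|ζ|)ⁿ`. -/
def angular (n : ℤ) (z : ℂ) : ℂ := (z / ‖z‖) ^ n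

/-- The function `(ζ/|ζ|)ⁿ |ζ|^α q(|ζ|)`. -/
def modeFun (n : ℤ) (α : ℕ) (q : ℝ → ℂ) (z : ℂ) : ℂ :=
  angular n z * ((‖z‖ : ℂ) ^ α * q ‖z‖)

/-- The operator `∂(|ζ|⁻ᵐ ∂̄)`. -/
def conicalOp (m : ℕ) (Φ : ℂ → ℂ) (z : ℂ) : ℂ :=
  dz (fun w => ((‖w‖ : ℂ) ^ m)⁻¹ * dzbar Φ w) z

theorem hasDerivAt_ofReal_zpow (k : ℤ) {s : ℝ} (hs : s ≠ 0) :
    HasDerivAt (fun s : ℝ => (s : ℂ) ^ k) (k * ((s : ℂ) ^ k / s)) s := by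
  have hs' : (s : ℂ) ≠ 0 := Complex.ofReal_ne_zero.2 hs
  have h := (hasDerivAt_zpow k (s : ℂ) (Or.inl hs')).comp_ofReal
  rwa [zpow_sub_one₀ hs', ← div_eq_mul_inv] at h

/-- The two admissible values of `n` are those for which constant `q` gives a homogeneous solution.
For `n = α` the function is `ζ^α`, killed by `∂̄`. For `n = m - α` one finds `|ζ|⁻ᵐ ∂̄(…)` to be a
multiple of `ζ̄^(α-m-1)`, killed by `∂`. So no term of order zero in `q` remains, and the other two
terms combine to `(r^(d+1) q')'`. -/
theorem conicalOp_modeFun {q : ℝ → ℂ} (hq : ContDiff ℝ ∞ q) (hd : d + m = 2 * α)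
    (hn : n = α ∨ n = (m : ℤ) - α) {z : ℂ} (hz : z ≠ 0) :
    conicalOp m (modeFun n α q) z =
      angular n z * (1 / 4 * (radialOp d q ‖z‖ / (‖z‖ : ℂ) ^ (α + 1))) := by
  have hq1 := contDiff_deriv_of_smooth hq
  have hdq : ∀ s, HasDerivAt q (deriv q s) s := fun s =>
    (hq.differentiable (by simp)).differentiableAt.hasDerivAt
  have hdq1 : ∀ s, HasDerivAt (deriv q) (deriv (deriv q) s) s := fun s =>
    (hq1.differentiable (by simp)).differentiableAt.hasDerivAt
  -- the radial factor of `modeFun` with respect to `zⁿ`, and its derivative divided by `2 s^(m+1)`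
  set S : ℝ → ℂ := fun s => (s : ℂ) ^ ((α : ℤ) - n) * q s with hS
  set S' : ℝ → ℂ := fun s => (s : ℂ) ^ ((α : ℤ) - n) * (deriv q s + ((α : ℤ) - n : ℤ) * (q s / s))
    with hS'
  have hSd : ∀ s : ℝ, s ≠ 0 → HasDerivAt S (S' s) s := by
    intro s hs
    refine ((hasDerivAt_ofReal_zpow _ hs).fun_mul (hdq s)).congr_deriv ?_
    simp only [hS']
    ring
  -- Splitting off the holomorphic factor `wⁿ` leaves `∂̄` to act on a radial function only.
  have hmode : ∀ w : ℂ, w ≠ 0 → modeFun n α q w = w ^ n * S ‖w‖ := by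
    intro w hw
    have hw' : (‖w‖ : ℂ) ≠ 0 := by simpa using hw
    rw [modeFun, angular, div_zpow, hS]
    simp only
    rw [zpow_sub₀ hw', zpow_natCast]
    field_simp
  have hzp : ∀ (k : ℤ) (w : ℂ), w ≠ 0 → HasWirtingerDerivAt (fun w => w ^ k) (k * (w ^ k / w)) 0 w := by
    intro k w hw
    have h := hasDerivAt_zpow k w (Or.inl hw)
    rw [zpow_sub_one₀ hw, ← div_eq_mul_inv] at h
    exact h.hasWirtingerDerivAt
  have hdzbar : ∀ w : ℂ, w ≠ 0 → dzbar (modeFun n α q) w = w ^ (n + 1) * (S' ‖w‖ / (2 * ‖w‖)) := by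
    intro w hw
    have h1 := (hzp n w hw).mul (hasWirtingerDerivAt_comp_norm hw (hSd ‖w‖ (by simpa using hw)))
    have h2 := h1.congr_of_eventuallyEq (g := modeFun n α q) (by
      filter_upwards [isOpen_ne.mem_nhds hw] with v hv using hmode v hv)
    rw [h2.dzbar_eq, zpow_add_one₀ hw]
    ring
  set W : ℝ → ℂ := fun s => ((s : ℂ) ^ (m + 1))⁻¹ * (S' s / 2) with hW
  have hr : ‖z‖ ≠ 0 := by simpa using hz
  have hr' : (‖z‖ : ℂ) ≠ 0 := by simpa using hz
  set r : ℝ := ‖z‖ with hrdef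
  set e : ℤ := (α : ℤ) - n with he
  have hid : HasDerivAt (fun s : ℝ => (s : ℂ)) 1 r := (hasDerivAt_id r).ofReal_comp
  have hS'd : HasDerivAt S' ((r : ℂ) ^ e * (deriv (deriv q) r + (2 * e + 0) * (deriv q r / r) +
      (e * (e - 1)) * (q r / r ^ 2))) r := by
    refine ((hasDerivAt_ofReal_zpow e hr).fun_mul ((hdq1 r).fun_add
      (((hdq r).fun_div hid hr').const_mul (e : ℂ)))).congr_deriv ?_
    field_simp
    ring
  have hWd : HasDerivAt W (((r : ℂ) ^ (m + 1))⁻¹ * ((r : ℂ) ^ e * (deriv (deriv q) r +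
      (2 * e - (m + 1)) * (deriv q r / r) + (e * (e - 1) - (m + 1) * e) * (q r / r ^ 2))) / 2) r := by
    have h1 : HasDerivAt (fun s : ℝ => ((s : ℂ) ^ (m + 1))⁻¹)
        (-((m + 1) * (r : ℂ) ^ m) / ((r : ℂ) ^ (m + 1)) ^ 2) r := by
      have := (hid.fun_pow (m + 1)).fun_inv (pow_ne_zero _ hr')
      simpa using this
    refine (h1.fun_mul (hS'd.div_const 2)).congr_deriv ?_
    simp only [hS']
    field_simp
    ring
  have hfun : (fun w => ((‖w‖ : ℂ) ^ m)⁻¹ * dzbar (modeFun n α q) w) =ᶠ[𝓝 z]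
      fun w => w ^ (n + 1) * W ‖w‖ := by
    filter_upwards [isOpen_ne.mem_nhds hz] with w hw
    have hw' : (‖w‖ : ℂ) ≠ 0 := by simpa using hw
    rw [hdzbar w hw, hW]
    simp only
    field_simp
    ring
  have hfin := ((hzp (n + 1) z hz).mul (hasWirtingerDerivAt_comp_norm hz hWd)).congr_of_eventuallyEq
    hfun
  rw [conicalOp, hfin.dz_eq, radialOp_eq hq, angular, div_zpow, zpow_add_one₀ hz, hW]
  simp only [hS', ← hrdef]
  have hzz : conj z = (r : ℂ) ^ 2 / z := by
    rw [eq_div_iff hz, mul_comm, Complex.mul_conj', hrdef]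
  rw [hzz]
  have hre : (r : ℂ) ^ e = (r : ℂ) ^ α / (r : ℂ) ^ n := by
    rw [he, zpow_sub₀ hr', zpow_natCast]
  have hrd : (r : ℂ) ^ d * (r : ℂ) ^ m = ((r : ℂ) ^ α) ^ 2 := by
    rw [← pow_add, hd, ← pow_mul, mul_comm]
  have hrd' : (r : ℂ) ^ d = ((r : ℂ) ^ α) ^ 2 / (r : ℂ) ^ m := by
    rw [← hrd]
    field_simp
  have hrn : (r : ℂ) ^ n ≠ 0 := zpow_ne_zero _ hr'
  have hdc : (d : ℂ) = 2 * α - m := by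
    have : ((d + m : ℕ) : ℂ) = ((2 * α : ℕ) : ℂ) := by rw [hd]
    push_cast at this
    linear_combination this
  have hec : (e : ℂ) = α - n := by rw [he]; push_cast; ring
  rw [hre, pow_succ (r : ℂ) d, hrd', hdc, hec]
  -- The coefficient of `q` itself in the computed expression is proportional to this product.
  have hnn : ((n : ℂ) - α) * (n - (m - α)) = 0 := by
    rcases hn with hn | hn
    · rw [hn]
      push_cast
      ring
    · rw [hn]
      push_cast
      ring
  push_cast
  field_simp
  linear_combination (-4 * r * r ^ m * r ^ α * q r) * hnn

theorem norm_angular {z : ℂ} (hz : z ≠ 0) : ‖angular n z‖ = 1 := by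
  rw [angular, norm_zpow, norm_div, Complex.norm_real, norm_norm,
    div_self (norm_ne_zero_iff.2 hz), one_zpow]

theorem contDiff_modeFun {q : ℝ → ℂ} (hq : ContDiff ℝ ∞ q) {δ : ℝ} (hδ : 0 < δ)
    (h0 : ∀ r, r ≤ δ → q r = 0) : ContDiff ℝ ∞ (modeFun n α q) := by
  rw [contDiff_iff_contDiffAt]
  intro z
  by_cases hz : z = 0
  · have : modeFun n α q =ᶠ[𝓝 z] fun _ => 0 := by
      rw [hz]
      filter_upwards [Metric.ball_mem_nhds (0 : ℂ) hδ] with w hw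
      rw [modeFun, h0 _ (by simpa using (mem_ball_zero_iff.1 hw).le)]
      simp
    exact contDiffAt_const.congr_of_eventuallyEq this
  · have hz' : (‖z‖ : ℂ) ≠ 0 := by simpa using hz
    have h1 : ContDiffAt ℝ ∞ (fun w : ℂ => ‖w‖) z := contDiffAt_norm ℝ hz
    have h2 : ContDiffAt ℝ ∞ (fun w : ℂ => (‖w‖ : ℂ)) z :=
      Complex.ofRealCLM.contDiff.contDiffAt.comp z h1
    have h3 : ContDiffAt ℝ ∞ (fun w : ℂ => w / ‖w‖) z := by
      simp only [div_eq_mul_inv]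
      exact contDiffAt_id.mul (h2.inv hz')
    have h4 : ContDiffAt ℝ ∞ (angular n) z := by
      unfold angular
      cases n with
      | ofNat k =>
        simp only [Int.ofNat_eq_natCast, zpow_natCast]
        exact h3.pow k
      | negSucc k =>
        simp only [zpow_negSucc]
        exact (h3.pow _).inv (pow_ne_zero _ (div_ne_zero hz hz'))
    exact h4.mul ((h2.pow α).mul (hq.contDiffAt.comp z h1))

end Modes

/-! ### Polar coordinates and Fourier coefficients -/

section Disc

variable {m : ℕ} {R : ℝ}

/-- The measure `|ζ|ᵐ dx dy` on the disc of radius `R`. -/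
def disc (m : ℕ) (R : ℝ) : Measure ℂ :=
  (volume.restrict (Metric.ball 0 R)).withDensity fun z => ENNReal.ofReal (‖z‖ ^ m)

/-- Polar coordinates. -/
def polarMap (p : ℝ × ℝ) : ℂ := p.1 * Complex.exp (p.2 * Complex.I)

theorem continuous_polarMap : Continuous polarMap := by
  unfold polarMap
  fun_prop

theorem norm_polarMap {p : ℝ × ℝ} (hp : 0 < p.1) : ‖polarMap p‖ = p.1 := by
  rw [polarMap, norm_mul, Complex.norm_exp_ofReal_mul_I, mul_one, Complex.norm_real,
    Real.norm_of_nonneg hp.le]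

theorem angular_polarMap {n : ℤ} {p : ℝ × ℝ} (hp : 0 < p.1) :
    angular n (polarMap p) = Complex.exp (p.2 * Complex.I) ^ n := by
  have : (p.1 : ℂ) ≠ 0 := Complex.ofReal_ne_zero.2 hp.ne'
  rw [angular, norm_polarMap hp, polarMap, mul_div_cancel_left₀ _ this]

/-- The measure `dθ` on `(-π, π]`. -/
def angle : Measure ℝ := volume.restrict (Set.Ioc (-Real.pi) Real.pi)

instance : IsFiniteMeasure angle := by
  unfold angle
  infer_instance

/-- The Jacobian `r` of polar coordinates turns the density `|ζ|ᵐ` into `r^(m+1)`. -/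
theorem disc_eq_map : disc m R = ((radial m R).prod angle).map polarMap := by
  refine Measure.ext_of_lintegral _ fun f hf => ?_
  have hang : angle = volume.restrict (Set.Ioo (-Real.pi) Real.pi) :=
    Measure.restrict_congr_set Ioo_ae_eq_Ioc.symm
  have hm : Measurable fun z : ℂ => ENNReal.ofReal (‖z‖ ^ m) := by fun_prop
  have hm' : Measurable fun p : ℝ × ℝ => ENNReal.ofReal (p.1 ^ (m + 1)) := by fun_prop
  rw [lintegral_map hf continuous_polarMap.measurable, disc, radial, hang,
    prod_withDensity_left (by fun_prop), Measure.prod_restrict,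
    lintegral_withDensity_eq_lintegral_mul _ hm hf,
    lintegral_withDensity_eq_lintegral_mul _ hm' (g := fun p => f (polarMap p))
      (hf.comp continuous_polarMap.measurable),
    ← lintegral_indicator Metric.isOpen_ball.measurableSet,
    ← Complex.lintegral_comp_polarCoord_symm,
    ← lintegral_indicator (measurableSet_Ioo.prod measurableSet_Ioo),
    ← lintegral_indicator polarCoord.open_target.measurableSet]
  refine lintegral_congr fun p => ?_
  have hpol : Complex.polarCoord.symm p = polarMap p := by
    rw [Complex.polarCoord_symm_apply, polarMap, Complex.exp_mul_I, Complex.ofReal_cos,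
      Complex.ofReal_sin]
  by_cases hp : p ∈ polarCoord.target
  · rw [polarCoord_target] at hp
    have hp1 : 0 < p.1 := hp.1
    rw [Set.indicator_of_mem (by rwa [polarCoord_target])]
    by_cases hR : p.1 < R
    · rw [Set.indicator_of_mem (show p ∈ Set.Ioo 0 R ×ˢ Set.Ioo (-Real.pi) Real.pi from
        ⟨⟨hp1, hR⟩, hp.2⟩), hpol, Set.indicator_of_mem (by
          rw [mem_ball_zero_iff, norm_polarMap hp1]; exact hR)]
      simp only [Pi.mul_apply, norm_polarMap hp1, smul_eq_mul]
      rw [← mul_assoc, ← ENNReal.ofReal_mul hp1.le, ← pow_succ']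
    · rw [hpol, Set.indicator_of_notMem (by
        rw [mem_ball_zero_iff, norm_polarMap hp1]; exact hR), smul_zero,
        Set.indicator_of_notMem (fun h => hR h.1.2)]
  · rw [Set.indicator_of_notMem hp, Set.indicator_of_notMem]
    intro h
    exact hp (by rw [polarCoord_target]; exact ⟨h.1.1, h.2⟩)

instance : IsFiniteMeasure (disc m R) := by
  rw [disc_eq_map]
  exact Measure.isFiniteMeasure_map _ _

theorem disc_restrict {t : ℝ} (ht : t ≤ R) :
    (disc m R).restrict (Metric.ball 0 t) = disc m t := by
  have hb := (Metric.isOpen_ball (x := (0 : ℂ)) (ε := t)).measurableSet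
  rw [disc, restrict_withDensity hb, Measure.restrict_restrict hb,
    Set.inter_eq_self_of_subset_left (Metric.ball_subset_ball ht), disc]

theorem disc_mono {t : ℝ} (ht : t ≤ R) : disc m t ≤ disc m R := by
  rw [← disc_restrict ht]
  exact Measure.restrict_le_self

theorem ae_disc : ∀ᵐ z ∂disc m R, z ∈ Metric.ball (0 : ℂ) R :=
  (withDensity_absolutelyContinuous _ _).ae_le (ae_restrict_mem Metric.isOpen_ball.measurableSet)

theorem MemLp.comp_polarMap {u : ℂ → ℂ} (hu : MemLp u 2 (disc m R)) :
    MemLp (u ∘ polarMap) 2 ((radial m R).prod angle) := by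
  rw [disc_eq_map] at hu
  exact (memLp_map_measure_iff hu.1 continuous_polarMap.aemeasurable).1 hu

theorem integral_disc {E : Type*} [NormedAddCommGroup E] [NormedSpace ℝ E] {f : ℂ → E}
    (hf : AEStronglyMeasurable f (disc m R)) :
    ∫ z, f z ∂disc m R = ∫ p, f (polarMap p) ∂(radial m R).prod angle := by
  rw [disc_eq_map] at hf ⊢
  exact integral_map continuous_polarMap.aemeasurable hf

/-- The `n`-th Fourier coefficient of `u` on the circle of radius `r`. -/
def angularCoeff (n : ℤ) (u : ℂ → ℂ) (r : ℝ) : ℂ :=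
  (2 * Real.pi : ℂ)⁻¹ * ∫ θ, conj (Complex.exp (θ * Complex.I) ^ n) * u (polarMap (r, θ)) ∂angle

theorem angularCoeff_eq (n : ℤ) (u : ℂ → ℂ) (r : ℝ) :
    angularCoeff n u r = fourierCoeffOn (neg_lt_self Real.pi_pos) (fun θ => u (polarMap (r, θ))) n := by
  rw [fourierCoeffOn_eq_integral, angularCoeff, angle,
    intervalIntegral.integral_of_le (neg_lt_self Real.pi_pos).le, Complex.real_smul]
  congr 1
  · push_cast
    ring
  · refine setIntegral_congr_fun measurableSet_Ioc fun θ _ => ?_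
    simp only [fourier_coe_apply, smul_eq_mul]
    congr 1
    rw [← Complex.exp_int_mul, ← Complex.exp_conj]
    congr 1
    have : (Real.pi : ℂ) ≠ 0 := Complex.ofReal_ne_zero.2 Real.pi_ne_zero
    simp
    field_simp
    ring

theorem continuous_exp_zpow (n : ℤ) :
    Continuous fun θ : ℝ => conj (Complex.exp (θ * Complex.I) ^ n) := by
  refine Complex.continuous_conj.comp ?_
  simp only [← Complex.exp_int_mul]
  fun_prop

theorem aestronglyMeasurable_angularCoeff {u : ℂ → ℂ} (hu : MemLp u 2 (disc m R)) (n : ℤ) :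
    AEStronglyMeasurable (angularCoeff n u) (radial m R) := by
  have h1 : AEStronglyMeasurable (fun p : ℝ × ℝ =>
      conj (Complex.exp (p.2 * Complex.I) ^ n) * u (polarMap p)) ((radial m R).prod angle) :=
    ((continuous_exp_zpow n).comp continuous_snd).aestronglyMeasurable.mul
      (MemLp.comp_polarMap hu).1
  exact h1.integral_prod_right'.const_mul _

theorem integrable_sq_polarMap {u : ℂ → ℂ} (hu : MemLp u 2 (disc m R)) :
    Integrable (fun p => ‖u (polarMap p)‖ ^ 2) ((radial m R).prod angle) := by
  have := (MemLp.comp_polarMap hu).integrable_norm_rpow (by norm_num) (by norm_num)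
  simpa using this

/-- By Fubini `u` is square integrable on almost every circle, and Parseval's identity applies
there. -/
theorem ae_hasSum_angularCoeff {u : ℂ → ℂ} (hu : MemLp u 2 (disc m R)) :
    ∀ᵐ r ∂radial m R, HasSum (fun n => ‖angularCoeff n u r‖ ^ 2)
      ((2 * Real.pi)⁻¹ * ∫ θ, ‖u (polarMap (r, θ))‖ ^ 2 ∂angle) := by
  filter_upwards [(integrable_sq_polarMap hu).prod_right_ae,
    (MemLp.comp_polarMap hu).1.prodMk_left] with r hr hr'
  have hL : MemLp (fun θ => u (polarMap (r, θ))) 2 angle :=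
    (memLp_two_iff_integrable_sq_norm hr').2 hr
  have h := hasSum_sq_fourierCoeffOn (neg_lt_self Real.pi_pos) hL
  rw [intervalIntegral.integral_of_le (neg_lt_self Real.pi_pos).le] at h
  simp only [angularCoeff_eq]
  convert h using 1
  rw [smul_eq_mul, angle]
  ring_nf

theorem l2norm_disc_sq {u : ℂ → ℂ} (hu : MemLp u 2 (disc m R)) : l2norm (disc m R) u ^ 2 =
    ∫ r, ∫ θ, ‖u (polarMap (r, θ))‖ ^ 2 ∂angle ∂radial m R := by
  have hm : AEStronglyMeasurable (fun z => ‖u z‖ ^ 2) (disc m R) :=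
    (continuous_pow 2).comp_aestronglyMeasurable hu.1.norm
  rw [l2norm_sq, integral_disc hm]
  exact integral_prod _ (integrable_sq_polarMap hu)

theorem memLp_angularCoeff {u : ℂ → ℂ} (hu : MemLp u 2 (disc m R)) (n : ℤ) :
    MemLp (angularCoeff n u) 2 (radial m R) := by
  refine (memLp_two_iff_integrable_sq_norm (aestronglyMeasurable_angularCoeff hu n)).2 ?_
  refine Integrable.mono' ((integrable_sq_polarMap hu).integral_prod_left.const_mul
    (2 * Real.pi)⁻¹) ((aestronglyMeasurable_angularCoeff hu n).norm.pow 2) ?_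
  filter_upwards [ae_hasSum_angularCoeff hu] with r hr
  rw [Real.norm_of_nonneg (by positivity)]
  exact le_hasSum hr n fun _ _ => by positivity

/-- Parseval's identity on the disc. -/
theorem hasSum_l2norm_angularCoeff {u : ℂ → ℂ} (hu : MemLp u 2 (disc m R)) :
    HasSum (fun n : ℤ => l2norm (radial m R) (angularCoeff n u) ^ 2)
      ((2 * Real.pi)⁻¹ * l2norm (disc m R) u ^ 2) := by
  have hs := ae_hasSum_angularCoeff hu
  have hi := (integrable_sq_polarMap hu).integral_prod_left.const_mul (2 * Real.pi)⁻¹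
  have hm : ∀ n : ℤ, AEStronglyMeasurable (fun r => ‖angularCoeff n u r‖ ^ 2) (radial m R) :=
    fun n => (aestronglyMeasurable_angularCoeff hu n).norm.pow 2
  have hb : ∀ n : ℤ, ∀ᵐ r ∂radial m R, ‖‖angularCoeff n u r‖ ^ 2‖ ≤ ‖angularCoeff n u r‖ ^ 2 :=
    fun n => ae_of_all _ fun r => by rw [Real.norm_of_nonneg (by positivity)]
  have hsum : ∀ᵐ r ∂radial m R, Summable fun n : ℤ => ‖angularCoeff n u r‖ ^ 2 :=
    hs.mono fun r hr => hr.summable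
  have hint : Integrable (fun r => ∑' n : ℤ, ‖angularCoeff n u r‖ ^ 2) (radial m R) :=
    hi.congr (hs.mono fun r hr => hr.tsum_eq.symm)
  -- Each term dominates itself, and the sum of the dominating functions is integrable because it
  -- equals the mean of `|u|²` over the circle.
  have h := hasSum_integral_of_dominated_convergence _ hm hb hsum hint hs
  rw [integral_const_mul, ← l2norm_disc_sq hu] at h
  simpa only [l2norm_sq] using h

/-- Turns a functional of one Fourier coefficient into a functional of `u` on the disc, which is how
the radial kernels become kernels in two variables. -/
theorem integral_angularCoeff_mul {u : ℂ → ℂ} (hu : MemLp u 2 (disc m R)) (n : ℤ) {g : ℝ → ℂ}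
    (hg : BoundedMeasurableOn R g) :
    ∫ r, angularCoeff n u r * g r ∂radial m R =
      (2 * Real.pi : ℂ)⁻¹ * ∫ z, u z * (conj (angular n z) * g ‖z‖) ∂disc m R := by
  obtain ⟨C, hC⟩ := hg.2
  have hma : Measurable fun z : ℂ => conj (angular n z) := by
    unfold angular
    fun_prop
  have hmg : Measurable fun z : ℂ => g ‖z‖ := hg.1.comp measurable_norm
  have haep : ∀ᵐ p ∂(radial m R).prod angle, p.1 ∈ Set.Ioo 0 R :=
    Measure.quasiMeasurePreserving_fst.ae ae_radial
  rw [integral_disc (f := fun z => u z * (conj (angular n z) * g ‖z‖)) (hu.1.mul (hma.mul hmg).aestronglyMeasurable), ← integral_const_mul,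
    integral_prod]
  · refine integral_congr_ae ?_
    filter_upwards [ae_radial] with r hr
    rw [angularCoeff, integral_const_mul, mul_assoc, ← integral_mul_const]
    congr 1
    refine integral_congr_ae (ae_of_all _ fun θ => ?_)
    simp only [angular_polarMap (p := (r, θ)) hr.1, norm_polarMap (p := (r, θ)) hr.1]
    ring
  · have h2 : MemLp (fun p : ℝ × ℝ => conj (angular n (polarMap p)) * g ‖polarMap p‖) 2
        ((radial m R).prod angle) := by
      refine MemLp.of_bound ((hma.mul hmg).comp
        continuous_polarMap.measurable).aestronglyMeasurable C ?_
      filter_upwards [haep] with p hp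
      have hp0 : polarMap p ≠ 0 := by
        rw [← norm_ne_zero_iff, norm_polarMap hp.1]
        exact hp.1.ne'
      rw [norm_mul, RCLike.norm_conj, norm_angular hp0, one_mul, norm_polarMap hp.1]
      exact hC _ hp
    exact (integrable_mul_of_memLp (MemLp.comp_polarMap hu) h2).const_mul _

end Disc

/-! ### The estimate on the disc -/

section DiscEstimate

variable {m α d : ℕ} {n : ℤ} {R : ℝ}

/-- The weak form of the equation `∂(|ζ|⁻ᵐ ∂̄u) = -|ζ|ᵐ F` on the punctured disc. -/
def WeakLaplace (m : ℕ) (R : ℝ) (u F : ℂ → ℂ) : Prop :=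
  ∀ Φ : ℂ → ℂ, ContDiff ℝ ∞ Φ → HasCompactSupport Φ → tsupport Φ ⊆ Metric.ball 0 R \ {0} →
    ∫ z, u z * (conj (conicalOp m Φ z) / (‖z‖ : ℂ) ^ m) ∂disc m R =
      -∫ z, F z * conj (Φ z) ∂disc m R

theorem ae_disc_ne_zero : ∀ᵐ z ∂disc m R, z ≠ 0 :=
  (withDensity_absolutelyContinuous _ _).ae_le (ae_restrict_of_ae (by simp [ae_iff]))

theorem measurable_angular : Measurable (angular n) := by
  unfold angular
  fun_prop

theorem memLp_angular_mul {g : ℝ → ℂ} (hg : BoundedMeasurableOn R g) :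
    MemLp (fun z => conj (angular n z) * g ‖z‖) 2 (disc m R) := by
  obtain ⟨C, hC⟩ := hg.2
  have hm : Measurable fun z : ℂ => conj (angular n z) * g ‖z‖ :=
    (Complex.continuous_conj.measurable.comp measurable_angular).mul (hg.1.comp measurable_norm)
  refine MemLp.of_bound hm.aestronglyMeasurable C ?_
  filter_upwards [ae_disc, ae_disc_ne_zero] with z hz hz0
  rw [norm_mul, RCLike.norm_conj, norm_angular hz0, one_mul]
  exact hC _ ⟨norm_pos_iff.2 hz0, mem_ball_zero_iff.1 hz⟩

theorem exists_eq_zero_of_tsupport_subset (hR : 0 < R) {q : ℝ → ℂ} (hq : HasCompactSupport q)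
    (hqs : tsupport q ⊆ Set.Ioo 0 R) :
    ∃ a b : ℝ, 0 < a ∧ b < R ∧ (∀ r, r ≤ a → q r = 0) ∧ ∀ r, b ≤ r → q r = 0 := by
  by_cases hne : (tsupport q).Nonempty
  · obtain ⟨a, ha, hamin⟩ := hq.isCompact.exists_isLeast hne
    obtain ⟨b, hb, hbmax⟩ := hq.isCompact.exists_isGreatest hne
    have ha' := hqs ha
    have hb' := hqs hb
    refine ⟨a / 2, (b + R) / 2, half_pos ha'.1, by linarith [hb'.2], fun r hr => ?_, fun r hr => ?_⟩
    · refine image_eq_zero_of_notMem_tsupport fun h => ?_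
      linarith [hamin h, ha'.1]
    · refine image_eq_zero_of_notMem_tsupport fun h => ?_
      linarith [hbmax h, hb'.2]
  · have h0 : ∀ r, q r = 0 := fun r =>
      image_eq_zero_of_notMem_tsupport fun h => hne ⟨r, h⟩
    exact ⟨R / 2, R / 2, half_pos hR, half_lt_self hR, fun r _ => h0 r, fun r _ => h0 r⟩

theorem radialOp_conj (q : ℝ → ℂ) (r : ℝ) :
    radialOp d (fun s => conj (q s)) r = conj (radialOp d q r) := by
  have h1 : deriv (fun s => conj (q s)) = fun s => conj (deriv q s) :=
    funext fun s => deriv.star (f := q)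
  have h2 : (fun s : ℝ => (s : ℂ) ^ (d + 1) * conj (deriv q s)) =
      fun s : ℝ => star ((s : ℂ) ^ (d + 1) * deriv q s) := by
    ext s
    simp
  rw [radialOp, h1, h2, deriv.star]
  rfl

/-- The Fourier coefficients of a solution satisfy the radial equation. -/
theorem WeakLaplace.weakRadial {u F : ℂ → ℂ} (h : WeakLaplace m R u F) (hR : 0 < R)
    (hu : MemLp u 2 (disc m R)) (hF : MemLp F 2 (disc m R)) (hd : d + m = 2 * α)
    (hn : n = α ∨ n = (m : ℤ) - α) :
    WeakRadial m α d R (angularCoeff n u) (angularCoeff n F) := by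
  intro q hq hqc hqs
  obtain ⟨a, b, ha, hb, hqa, hqb⟩ := exists_eq_zero_of_tsupport_subset hR hqc hqs
  -- The weak equation pairs with the conjugate of the test function, so `q` is conjugated
  -- beforehand.
  have hq' : ContDiff ℝ ∞ fun s => conj (q s) := Complex.conjCLE.contDiff.comp hq
  set Φ := modeFun n α fun s => conj (q s) with hΦ
  have hzero : ∀ z : ℂ, ‖z‖ ≤ a ∨ b ≤ ‖z‖ → Φ z = 0 := by
    intro z hz
    have : q ‖z‖ = 0 := hz.elim (hqa _) (hqb _)
    simp [hΦ, modeFun, this]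
  have hsub : tsupport Φ ⊆ {z : ℂ | a ≤ ‖z‖ ∧ ‖z‖ ≤ b} := by
    refine closure_minimal (fun z hz => ?_) ((isClosed_le continuous_const continuous_norm).inter
      (isClosed_le continuous_norm continuous_const))
    by_contra hcon
    rw [Set.mem_ofPred_eq, not_and_or, not_le, not_le] at hcon
    exact hz (hzero z (hcon.imp le_of_lt le_of_lt))
  have hcs : HasCompactSupport Φ := by
    refine (isCompact_closedBall (0 : ℂ) b).of_isClosed_subset (isClosed_tsupport _) fun z hz => ?_
    rw [mem_closedBall_zero_iff]
    exact (hsub hz).2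
  have hsd : ContDiff ℝ ∞ Φ := contDiff_modeFun hq' ha fun r hr => by rw [hqa r hr, map_zero]
  have key := h Φ hsd hcs fun z hz => ⟨by
    rw [mem_ball_zero_iff]
    exact (hsub hz).2.trans_lt hb, fun h0 => by
    have h0' : z = 0 := h0
    have := (hsub hz).1
    rw [h0', norm_zero] at this
    linarith⟩
  rw [integral_angularCoeff_mul hu n (boundedMeasurableOn_radialOp_div hq ha hqa _),
    integral_angularCoeff_mul hF n (Continuous.boundedMeasurableOn
      (by have := hq.continuous; fun_prop))]
  have e1 : ∫ z, u z * (conj (angular n z) * (radialOp d q ‖z‖ / (‖z‖ : ℂ) ^ (α + m + 1))) ∂disc m R =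
      4 * ∫ z, u z * (conj (conicalOp m Φ z) / (‖z‖ : ℂ) ^ m) ∂disc m R := by
    rw [← integral_const_mul]
    refine integral_congr_ae ?_
    filter_upwards [ae_disc_ne_zero] with z hz
    have hz' : (‖z‖ : ℂ) ≠ 0 := by simpa using hz
    rw [hΦ, conicalOp_modeFun hq' hd hn hz, radialOp_conj]
    simp only [map_mul, map_div₀, map_pow, Complex.conj_conj, Complex.conj_ofReal, map_one,
      map_ofNat]
    field_simp
    ring
  have e2 : ∫ z, F z * (conj (angular n z) * (q ‖z‖ * (‖z‖ : ℂ) ^ α)) ∂disc m R =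
      ∫ z, F z * conj (Φ z) ∂disc m R := by
    refine integral_congr_ae (ae_of_all _ fun z => ?_)
    simp only [hΦ, modeFun, map_mul, map_pow, Complex.conj_conj, Complex.conj_ofReal]
    ring
  rw [e1, e2, key]
  ring

/-- `α` is the larger of `n` and `m - n`, which makes `d = 2α - m` nonnegative. The bound on `|n|`
shows that only finitely many modes have `α` below a given number. -/
theorem exists_mode (m : ℕ) (n : ℤ) : ∃ α d : ℕ, d + m = 2 * α ∧ (n = α ∨ n = (m : ℤ) - α) ∧
    |n| ≤ α + m := by
  by_cases h : (m : ℤ) ≤ 2 * n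
  · exact ⟨n.toNat, (2 * n - m).toNat, by omega, by omega, by rw [abs_le]; omega⟩
  · exact ⟨(m - n).toNat, (m - 2 * n).toNat, by omega, by omega, by rw [abs_le]; omega⟩

theorem sq_le_of_le_add_sum {ι : Type*} [Fintype ι] {a c ε : ℝ} {x y : ι → ℝ} (ha : 0 ≤ a)
    (h : a ≤ ε * c + ∑ i, (x i + y i)) :
    a ^ 2 ≤ 2 * ε ^ 2 * c ^ 2 + 4 * Fintype.card ι * ∑ i, (x i ^ 2 + y i ^ 2) := by
  have h1 : (∑ i, (x i + y i)) ^ 2 ≤ Fintype.card ι * ∑ i, (x i + y i) ^ 2 := by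
    simpa using sq_sum_le_card_mul_sum_sq (s := (Finset.univ : Finset ι)) (f := fun i => x i + y i)
  have h2 : ∑ i, (x i + y i) ^ 2 ≤ 2 * ∑ i, (x i ^ 2 + y i ^ 2) := by
    rw [Finset.mul_sum]
    exact Finset.sum_le_sum fun i _ => by nlinarith [sq_nonneg (x i - y i)]
  have h3 := pow_le_pow_left₀ ha h 2
  have h4 := mul_le_mul_of_nonneg_left h2 (Nat.cast_nonneg (α := ℝ) (Fintype.card ι))
  nlinarith [sq_nonneg (ε * c - ∑ i, (x i + y i))]

/-- Solutions of the equation on the punctured disc are controlled, up to small errors, by finitely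
many functionals. -/
theorem exists_l2norm_disc_le (m : ℕ) (hR : 0 < R) (hR1 : R ≤ 1) {ε : ℝ} (hε : 0 < ε) :
    ∃ (ι : Type) (_ : Fintype ι) (k : ι → ℂ → ℂ), (∀ i, MemLp (k i) 2 (disc m R)) ∧
      ∀ u F : ℂ → ℂ, MemLp u 2 (disc m R) → MemLp F 2 (disc m R) → WeakLaplace m R u F →
        l2norm (disc m (R / 4)) u ^ 2 ≤
          ε * (l2norm (disc m R) u ^ 2 + l2norm (disc m R) F ^ 2) +
          ∑ i, (‖∫ z, u z * k i z ∂disc m R‖ ^ 2 + ‖∫ z, F z * k i z ∂disc m R‖ ^ 2) := by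
  -- Squaring a sum of two terms costs a factor `2`, and `2ε'² = ε/2 ≤ ε`.
  set ε' := Real.sqrt (ε / 4) with hε'
  have hε'0 : 0 < ε' := Real.sqrt_pos.2 (by positivity)
  have hε'2 : ε' ^ 2 = ε / 4 := Real.sq_sqrt (by positivity)
  obtain ⟨N, hN⟩ := exists_forall_l2norm_radial_le m hR hR1 hε'0
  choose α d hd hn hα using exists_mode m
  choose k K hK hKle using fun n => exists_l2norm_radial_le (hd n) hR hR1 hε'0
  -- Outside `T` one has `|n| > N + m`, hence `α n ≥ N`: these are the uniformly small modes, and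
  -- only those in `T` contribute functionals.
  let T : Finset ℤ := Finset.Icc (-(N + m)) (N + m)
  let c : ℤ → ℝ := fun n => 4 * Fintype.card (Fin (k n) ⊕ Fin 3)
  have hπ := Real.pi_pos
  -- The normalisation makes the squared functional on the disc equal to `2π c` times the squared
  -- radial one: `c` comes from squaring a sum of several terms, `2π` from Parseval's identity, and
  -- `(2π)⁻¹` is undone by the definition of the Fourier coefficient.
  refine ⟨Σ n : T, Fin (k n) ⊕ Fin 3, inferInstance, fun i z =>
    (Real.sqrt (2 * Real.pi * c i.1) : ℂ) * (2 * Real.pi : ℂ)⁻¹ *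
      (conj (angular i.1 z) * K i.1 i.2 ‖z‖), fun i => (memLp_angular_mul (hK _ _)).const_mul _, ?_⟩
  intro u F hu hF huF
  have hwr := fun n => huF.weakRadial hR hu hF (hd n) (hn n)
  have hcoef : ∀ f : ℂ → ℂ, MemLp f 2 (disc m R) → ∀ (n : ℤ) (i : Fin (k n) ⊕ Fin 3),
      ‖∫ z, f z * ((Real.sqrt (2 * Real.pi * c n) : ℂ) * (2 * Real.pi : ℂ)⁻¹ *
        (conj (angular n z) * K n i ‖z‖)) ∂disc m R‖ ^ 2 =
      2 * Real.pi * (c n * ‖∫ r, angularCoeff n f r * K n i r ∂radial m R‖ ^ 2) := by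
    intro f hf n i
    rw [integral_angularCoeff_mul hf n (hK n i)]
    have e : ∀ z, f z * ((Real.sqrt (2 * Real.pi * c n) : ℂ) * (2 * Real.pi : ℂ)⁻¹ *
        (conj (angular n z) * K n i ‖z‖)) = (Real.sqrt (2 * Real.pi * c n) : ℂ) *
        ((2 * Real.pi : ℂ)⁻¹ * (f z * (conj (angular n z) * K n i ‖z‖))) := fun z => by ring
    simp only [e]
    rw [integral_const_mul, integral_const_mul, norm_mul, mul_pow, Complex.norm_real,
      Real.norm_of_nonneg (Real.sqrt_nonneg _), Real.sq_sqrt (by positivity), mul_assoc]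
  have hu4 := hu.mono_measure (disc_mono (m := m) (show R / 4 ≤ R by linarith))
  have ha := hasSum_l2norm_angularCoeff hu4
  have hb := hasSum_l2norm_angularCoeff hu
  have hc := hasSum_l2norm_angularCoeff hF
  let s : ℤ → ℝ := fun n => if n ∈ T then c n * ∑ i, (‖∫ r, angularCoeff n u r * K n i r ∂radial m R‖ ^ 2 +
    ‖∫ r, angularCoeff n F r * K n i r ∂radial m R‖ ^ 2) else 0
  have hs : HasSum s (∑ n ∈ T, s n) := hasSum_sum_of_ne_finset_zero fun n hn => if_neg hn
  have hle : ∀ n, l2norm (radial m (R / 4)) (angularCoeff n u) ^ 2 ≤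
      ε * (l2norm (radial m R) (angularCoeff n u) ^ 2 +
        l2norm (radial m R) (angularCoeff n F) ^ 2) + s n := by
    intro n
    have hun := memLp_angularCoeff hu n
    have hFn := memLp_angularCoeff hF n
    have hA := l2norm_nonneg (radial m (R / 4)) (angularCoeff n u)
    by_cases hnT : n ∈ T
    · have h1 := sq_le_of_le_add_sum hA (hKle n _ _ hun hFn (hwr n))
      have h2 : s n = c n * ∑ i, (‖∫ r, angularCoeff n u r * K n i r ∂radial m R‖ ^ 2 +
        ‖∫ r, angularCoeff n F r * K n i r ∂radial m R‖ ^ 2) := if_pos hnT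
      rw [h2]
      refine h1.trans (add_le_add ?_ le_rfl)
      rw [hε'2]
      nlinarith [sq_nonneg (l2norm (radial m R) (angularCoeff n u)),
        sq_nonneg (l2norm (radial m R) (angularCoeff n F))]
    · have h2 : s n = 0 := if_neg hnT
      have hNα : N ≤ α n := by
        have h3 := hα n
        rw [Finset.mem_Icc, ← abs_le] at hnT
        omega
      have h1 := pow_le_pow_left₀ hA (hN _ _ hNα (hd n) _ _ hun hFn (hwr n)) 2
      rw [h2, add_zero]
      refine h1.trans ?_
      rw [mul_pow, hε'2]
      nlinarith [sq_nonneg (l2norm (radial m R) (angularCoeff n u) -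
        l2norm (radial m R) (angularCoeff n F)), sq_nonneg (l2norm (radial m R) (angularCoeff n u)),
        sq_nonneg (l2norm (radial m R) (angularCoeff n F))]
  have htot := hasSum_le hle ha (((hb.add hc).mul_left ε).add hs)
  have hfin : ∑ i : Σ n : T, Fin (k n) ⊕ Fin 3, (‖∫ z, u z * ((Real.sqrt (2 * Real.pi * c i.1) : ℂ) *
      (2 * Real.pi : ℂ)⁻¹ * (conj (angular i.1 z) * K i.1 i.2 ‖z‖)) ∂disc m R‖ ^ 2 +
      ‖∫ z, F z * ((Real.sqrt (2 * Real.pi * c i.1) : ℂ) *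
      (2 * Real.pi : ℂ)⁻¹ * (conj (angular i.1 z) * K i.1 i.2 ‖z‖)) ∂disc m R‖ ^ 2) =
      2 * Real.pi * ∑ n ∈ T, s n := by
    rw [Fintype.sum_sigma, ← Finset.sum_coe_sort T, Finset.mul_sum]
    refine Finset.sum_congr rfl fun n _ => ?_
    have h2 : s n = c n * ∑ i, (‖∫ r, angularCoeff n u r * K n i r ∂radial m R‖ ^ 2 +
        ‖∫ r, angularCoeff n F r * K n i r ∂radial m R‖ ^ 2) := if_pos n.2
    rw [h2, Finset.mul_sum, Finset.mul_sum]
    refine Finset.sum_congr rfl fun i _ => ?_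
    rw [hcoef u hu, hcoef F hF]
    ring
  rw [hfin]
  have h5 := mul_le_mul_of_nonneg_left htot (show 0 ≤ 2 * Real.pi by positivity)
  have h6 : ∀ x : ℝ, 2 * Real.pi * ((2 * Real.pi)⁻¹ * x) = x := fun x =>
    mul_inv_cancel_left₀ (by positivity) x
  rw [h6] at h5
  refine h5.trans (le_of_eq ?_)
  rw [mul_add, ← mul_add (2 * Real.pi)⁻¹, mul_left_comm (2 * Real.pi) ε, h6]

end DiscEstimate

/-! ### Change of coordinates -/

section Transition

variable {X : Type*} [TopologicalSpace X] [ChartedSpace ℂ X] [IsManifold 𝓘(ℂ) ω X]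

theorem contMDiffAt_chart {e : OpenPartialHomeomorph X ℂ} (he : e ∈ atlas ℂ X) {x : X}
    (hx : x ∈ e.source) : ContMDiffAt 𝓘(ℂ) 𝓘(ℂ) ω e x :=
  contMDiffAt_of_mem_maximalAtlas (IsManifold.subset_maximalAtlas he) hx

theorem contMDiffAt_chart_symm {e : OpenPartialHomeomorph X ℂ} (he : e ∈ atlas ℂ X) {z : ℂ}
    (hz : z ∈ e.target) : ContMDiffAt 𝓘(ℂ) 𝓘(ℂ) ω e.symm z :=
  contMDiffAt_symm_of_mem_maximalAtlas (IsManifold.subset_maximalAtlas he) hz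

theorem analyticAt_comp_symm {e : OpenPartialHomeomorph X ℂ} (he : e ∈ atlas ℂ X) {f : X → ℂ}
    {z : ℂ} (hz : z ∈ e.target) (hf : ContMDiffAt 𝓘(ℂ) 𝓘(ℂ) ω f (e.symm z)) :
    AnalyticAt ℂ (fun w => f (e.symm w)) z := by
  have h : ContMDiffAt 𝓘(ℂ) 𝓘(ℂ) ω (fun w => f (e.symm w)) z :=
    hf.comp z (contMDiffAt_chart_symm he hz)
  exact h.contDiffAt.analyticAt

theorem analyticAt_transition {e e' : OpenPartialHomeomorph X ℂ} (he : e ∈ atlas ℂ X)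
    (he' : e' ∈ atlas ℂ X) {z : ℂ} (hz : z ∈ e'.target) (hz' : e'.symm z ∈ e.source) :
    AnalyticAt ℂ (fun w => e (e'.symm w)) z :=
  analyticAt_comp_symm he' hz (contMDiffAt_chart he hz')

/-- The chain rule for the coefficient of a covector under a change of chart. -/
theorem coeffIn_transition {e e' : OpenPartialHomeomorph X ℂ} (he : e ∈ atlas ℂ X)
    (he' : e' ∈ atlas ℂ X) {z : ℂ} (hz : z ∈ e'.target) (hz' : e'.symm z ∈ e.source)
    (ξ : ∀ x : X, TangentSpace 𝓘(ℂ) x →L[ℂ] ℂ) :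
    coeffIn e' ξ z = deriv (fun w => e (e'.symm w)) z * coeffIn e ξ (e (e'.symm z)) := by
  have hψ := (analyticAt_transition he he' hz hz').differentiableAt
  have hev : (e'.symm : ℂ → X) =ᶠ[𝓝 z] e.symm ∘ fun w => e (e'.symm w) := by
    have : ∀ᶠ w in 𝓝 z, e'.symm w ∈ e.source :=
      (e'.symm.continuousAt hz).eventually_mem (e.open_source.mem_nhds hz')
    filter_upwards [this] with w hw
    simp [e.left_inv hw]
  have h1 : MDifferentiableAt 𝓘(ℂ) 𝓘(ℂ) e.symm (e (e'.symm z)) :=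
    (contMDiffAt_chart_symm he (e.map_source hz')).mdifferentiableAt (by simp)
  have h2 : mfderiv 𝓘(ℂ) 𝓘(ℂ) e'.symm z (tangentOne z) =
      mfderiv 𝓘(ℂ) 𝓘(ℂ) e.symm (e (e'.symm z))
        (deriv (fun w => e (e'.symm w)) z • tangentOne (e (e'.symm z))) := by
    rw [hev.mfderiv_eq, mfderiv_comp z h1 hψ.mdifferentiableAt, mfderiv_eq_fderiv]
    change mfderiv 𝓘(ℂ) 𝓘(ℂ) e.symm (e (e'.symm z)) (fderiv ℂ (fun w => e (e'.symm w)) z 1) = _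
    congr 1
    rw [fderiv_eq_deriv_mul, mul_one]
    exact (mul_one (M := ℂ) _).symm
  -- The points `e.symm (e (e'.symm z))` and `e'.symm z` are equal but not by definition, so the
  -- covectors at the two points are compared as functions on `ℂ`.
  have h3 : ∀ (y : X) (hy : y = e'.symm z) (v : ℂ),
      (ξ (e'.symm z) : ℂ → ℂ) v = (ξ y : ℂ → ℂ) v := by
    rintro y rfl v
    rfl
  rw [coeffIn, h2, map_smul, coeffIn]
  refine (h3 _ (e.left_inv hz') _).trans ?_
  exact map_smul (ξ (e.symm (e (e'.symm z)))) _ _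

/-- The determinant of multiplication by `c` on `ℂ` over `ℝ` is the field norm of `c`. It is the
real Jacobian in the change of variables between charts. -/
theorem det_mul_eq_norm_sq (c : ℂ) :
    |((ContinuousLinearMap.toSpanSingleton ℂ c).restrictScalars ℝ).det| = ‖c‖ ^ 2 := by
  have h : (((ContinuousLinearMap.toSpanSingleton ℂ c).restrictScalars ℝ : ℂ →L[ℝ] ℂ) : ℂ →ₗ[ℝ] ℂ) =
      LinearMap.mulLeft ℝ c := by
    ext
    simp [mul_comm]
  rw [ContinuousLinearMap.det, h]
  have := Algebra.norm_complex_apply c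
  rw [Algebra.norm_apply] at this
  have h2 : LinearMap.mulLeft ℝ c = Algebra.lmul ℝ ℂ c := rfl
  rw [h2]
  change |LinearMap.det ((Algebra.lmul ℝ ℂ) c)| = _
  rw [this, Complex.normSq_eq_norm_sq, abs_of_nonneg (by positivity)]

variable [MeasurableSpace X] [BorelSpace X] (η : HolomorphicOneForm X)

theorem measurableSet_target_inter (e : OpenPartialHomeomorph X ℂ) {A : Set X}
    (hA : MeasurableSet A) : MeasurableSet (e.target ∩ e.symm ⁻¹' A) := by
  have h : Measurable (e.target.domRestrict e.symm) :=
    (continuousOn_iff_continuous_domRestrict.1 e.continuousOn_symm).measurable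
  have := e.open_target.measurableSet.subtype_image (h hA)
  convert this using 1
  ext z
  simp [Set.domRestrict, and_comm]

theorem aemeasurable_symm_localArea (e : OpenPartialHomeomorph X ℂ) :
    AEMeasurable e.symm ((volume.restrict e.target).withDensity
      fun z => ENNReal.ofReal (‖coeffIn e η.toFun z‖ ^ 2)) :=
  (e.continuousOn_symm.aemeasurable e.open_target.measurableSet).mono_ac
    (withDensity_absolutelyContinuous _ _)

theorem localArea_apply (e : OpenPartialHomeomorph X ℂ) {A : Set X} (hA : MeasurableSet A) :
    localArea η e A =
      ∫⁻ z in e.target ∩ e.symm ⁻¹' A, ENNReal.ofReal (‖coeffIn e η.toFun z‖ ^ 2) := by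
  rw [localArea, Measure.map_apply_of_aemeasurable (aemeasurable_symm_localArea η e) hA,
    withDensity_apply', Measure.restrict_restrict₀, Set.inter_comm]
  exact (e.continuousOn_symm.aemeasurable e.open_target.measurableSet).nullMeasurable hA

/-- The density `|η(z)|²` transforms by `|ψ'|²`, the real Jacobian of the transition map `ψ`, so the
two charts measure the same area. Only an inequality holds because `e'` need not cover `A`. -/
theorem localArea_le {e e' : OpenPartialHomeomorph X ℂ} (he : e ∈ atlas ℂ X)
    (he' : e' ∈ atlas ℂ X) {A : Set X} (hA : MeasurableSet A) (hAe : A ⊆ e.source) :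
    localArea η e' A ≤ localArea η e A := by
  rw [localArea_apply η e hA, localArea_apply η e' hA]
  have hm := measurableSet_target_inter e' hA
  have hd : ∀ z ∈ e'.target ∩ e'.symm ⁻¹' A, HasFDerivWithinAt (fun w => e (e'.symm w))
      ((ContinuousLinearMap.toSpanSingleton ℂ
        (deriv (fun w => e (e'.symm w)) z)).restrictScalars ℝ) (e'.target ∩ e'.symm ⁻¹' A) z := by
    intro z hz
    have h := (analyticAt_transition he he' hz.1 (hAe hz.2)).differentiableAt.hasDerivAt
    exact (h.hasFDerivAt.restrictScalars ℝ).hasFDerivWithinAt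
  have hinj : Set.InjOn (fun w => e (e'.symm w)) (e'.target ∩ e'.symm ⁻¹' A) :=
    fun z hz w hw h => e'.symm.injOn hz.1 hw.1 (e.injOn (hAe hz.2) (hAe hw.2) h)
  calc _ = ∫⁻ z in e'.target ∩ e'.symm ⁻¹' A, ENNReal.ofReal
        |((ContinuousLinearMap.toSpanSingleton ℂ
          (deriv (fun w => e (e'.symm w)) z)).restrictScalars ℝ).det| *
        ENNReal.ofReal (‖coeffIn e η.toFun (e (e'.symm z))‖ ^ 2) := by
        refine setLIntegral_congr_fun hm fun z hz => ?_
        rw [coeffIn_transition he he' hz.1 (hAe hz.2), det_mul_eq_norm_sq,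
          ← ENNReal.ofReal_mul (by positivity), norm_mul, mul_pow]
    _ = ∫⁻ z in (fun w => e (e'.symm w)) '' (e'.target ∩ e'.symm ⁻¹' A),
        ENNReal.ofReal (‖coeffIn e η.toFun z‖ ^ 2) :=
        (lintegral_image_eq_lintegral_abs_det_fderiv_mul volume hm hd hinj
          fun z => ENNReal.ofReal (‖coeffIn e η.toFun z‖ ^ 2)).symm
    _ ≤ _ := by
        refine lintegral_mono_set ?_
        rintro _ ⟨z, hz, rfl⟩
        refine ⟨e.map_source (hAe hz.2), ?_⟩
        change e.symm (e (e'.symm z)) ∈ A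
        rw [e.left_inv (hAe hz.2)]
        exact hz.2

/-- In the domain of a chart, the area measure is the area measure of the chart. -/
theorem areaMeasure_restrict {e : OpenPartialHomeomorph X ℂ} (he : e ∈ atlas ℂ X) {U : Set X}
    (hU : MeasurableSet U) (hUe : U ⊆ e.source) :
    (areaMeasure η).restrict U = (localArea η e).restrict U := by
  refine le_antisymm ?_ (Measure.restrict_mono_measure
    (le_iSup₂ (f := fun e _ => localArea η e) e he) _)
  -- A supremum of measures is hard to evaluate on a set, so an explicit upper bound for all members
  -- of the family is used: the chart's own measure on `U`, the supremum itself off `U`.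
  have hle : areaMeasure η ≤ (localArea η e).restrict U + (areaMeasure η).restrict Uᶜ := by
    refine iSup₂_le fun e' he' => Measure.le_iff.2 fun A hA => ?_
    rw [Measure.add_apply, Measure.restrict_apply hA, Measure.restrict_apply hA,
      ← measure_inter_add_sdiff A hU]
    refine add_le_add (localArea_le η he he' (hA.inter hU) (Set.inter_subset_right.trans hUe)) ?_
    exact (le_iSup₂ (f := fun e _ => localArea η e) e' he' : localArea η e' ≤ areaMeasure η) _
  have := Measure.restrict_mono_measure hle U
  rwa [Measure.restrict_add, Measure.restrict_restrict hU, Measure.restrict_restrict hU,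
    Set.inter_self, Set.inter_compl_self, Measure.restrict_empty, add_zero] at this

end Transition

/-! ### Change of coordinate and frame -/

section Conformal

variable {u u' h h' ψ g : ℂ → ℂ} {z : ℂ}

theorem differentiableAt_dzbar (hu : ContDiffAt ℝ ∞ u z) : DifferentiableAt ℝ (dzbar u) z := by
  have h1 : DifferentiableAt ℝ (fderiv ℝ u) z :=
    (hu.fderiv_right (m := ∞) (by simp)).differentiableAt (by simp)
  have h2 : ∀ v : ℂ, DifferentiableAt ℝ (fun w => fderiv ℝ u w v) z := fun v =>
    h1.clm_apply (differentiableAt_const v)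
  have h3 := h2 1
  have h4 := h2 Complex.I
  unfold dzbar
  fun_prop

/-- The operator `∂(h ∂̄u)` under a holomorphic change of coordinate and frame. -/
theorem dz_mul_dzbar_comp (hψ : AnalyticAt ℂ ψ z) (hg : AnalyticAt ℂ g z) (hg0 : g z ≠ 0)
    (hu : ContDiffAt ℝ ∞ u (ψ z)) (hh : DifferentiableAt ℝ h (ψ z))
    (hu' : u' =ᶠ[𝓝 z] fun w => g w * u (ψ w))
    (hh' : h' =ᶠ[𝓝 z] fun w => h (ψ w) * (g w * conj (g w))⁻¹) :
    dz (fun w => h' w * dzbar u' w) z =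
      conj (deriv ψ z * (g z)⁻¹) * deriv ψ z * dz (fun w => h w * dzbar u w) (ψ z) := by
  have hdiff : ∀ᶠ w in 𝓝 z, DifferentiableAt ℝ u (ψ w) := by
    have h1 : ∀ᶠ w in 𝓝 (ψ z), ContDiffAt ℝ 1 u w :=
      (hu.of_le (m := 1) (by exact_mod_cast le_top)).eventually (by simp)
    exact (hψ.continuousAt.eventually h1).mono fun w hw => hw.differentiableAt (by simp)
  -- Holomorphy of `g` and `ψ` gives `∂̄u' = g · conj ψ' · (∂̄u ∘ ψ)`, and the factor `g` cancels
  -- against `h'`. What remains in front is antiholomorphic, so `∂` passes through it.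
  have hev : (fun w => h' w * dzbar u' w) =ᶠ[𝓝 z]
      fun w => conj (deriv ψ w * (g w)⁻¹) * (h (ψ w) * dzbar u (ψ w)) := by
    filter_upwards [hdiff, hu'.eventuallyEq_nhds, hh', hψ.eventually_analyticAt,
      hg.eventually_analyticAt, hg.continuousAt.eventually_ne hg0] with w h1 h2 h3 h4 h5 h6
    have h7 := (h5.differentiableAt.hasDerivAt.hasWirtingerDerivAt.mul
      (h1.hasWirtingerDerivAt.comp_holomorphic
        h4.differentiableAt.hasDerivAt)).congr_of_eventuallyEq h2
    have h8 : conj (g w) ≠ 0 := by simpa using h6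
    rw [h7.dzbar_eq, h3, map_mul, map_inv₀]
    field_simp
    ring
  have hA : AnalyticAt ℂ (fun w => deriv ψ w * (g w)⁻¹) z := hψ.deriv.mul (hg.inv hg0)
  have h1 := (hA.differentiableAt.hasDerivAt.hasWirtingerDerivAt.conj.mul
    ((hh.mul (differentiableAt_dzbar hu)).hasWirtingerDerivAt.comp_holomorphic
      hψ.differentiableAt.hasDerivAt)).congr_of_eventuallyEq hev
  rw [h1.dz_eq, map_zero]
  simp only [Pi.mul_def]
  ring

/-- `b / b z` is near `1`, where the principal root is analytic; a square root of the constant `b z`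
supplies the rest. -/
theorem exists_analyticAt_sq_eq {b : ℂ → ℂ} (hb : AnalyticAt ℂ b z) (hb0 : b z ≠ 0) :
    ∃ c : ℂ → ℂ, AnalyticAt ℂ c z ∧ c z ≠ 0 ∧ ∀ w, c w ^ 2 = b w := by
  obtain ⟨d, hd⟩ := IsAlgClosed.exists_pow_nat_eq (b z) (n := 2) (by norm_num)
  have hd0 : d ≠ 0 := by
    rintro rfl
    exact hb0 (by rw [← hd]; ring)
  refine ⟨fun w => d * (b w / b z) ^ ((2 : ℕ) : ℂ)⁻¹, ?_, ?_, fun w => ?_⟩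
  · refine analyticAt_const.mul ((hb.div_const).cpow analyticAt_const ?_)
    rw [div_self hb0]
    exact Complex.one_mem_slitPlane
  · simp [div_self hb0, hd0]
  · rw [mul_pow, Complex.cpow_nat_inv_pow _ (by norm_num), hd]
    field_simp

end Conformal

/-! ### Adapted coordinates -/

section Adapted

variable {X : Type*} [TopologicalSpace X] [ChartedSpace ℂ X]
  {C : X → Type*} [∀ x, AddCommGroup (C x)] [∀ x, Module ℂ (C x)] [∀ x, TopologicalSpace (C x)]
  [TopologicalSpace (TotalSpace ℂ C)] [FiberBundle ℂ C]

/-- A disc `{|ζ| < R}` around `p` in which `η = ζᵐ q dζ`, and a holomorphic function `c` such that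
`c⁻¹` times the preferred frame of `C` has square `q dζ`. -/
structure AdaptedChart (η : HolomorphicOneForm X) (S : SpinStructure C) (p : X) where
  m : ℕ
  R : ℝ
  K : ℝ
  c : ℂ → ℂ
  q : ℂ → ℂ
  R_pos : 0 < R
  R_le : R ≤ 1
  K_pos : 0 < K
  mem_target : ∀ ζ ∈ Metric.ball 0 R, chartAt ℂ p p + ζ ∈ (chartAt ℂ p).target
  mem_baseSet : ∀ ζ ∈ Metric.ball 0 R,
    (chartAt ℂ p).symm (chartAt ℂ p p + ζ) ∈ (trivializationAt ℂ C p).baseSet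
  analytic_c : ∀ ζ ∈ Metric.ball 0 R, AnalyticAt ℂ c ζ
  analytic_q : ∀ ζ ∈ Metric.ball 0 R, AnalyticAt ℂ q ζ
  c_ne_zero : ∀ ζ ∈ Metric.ball 0 R, c ζ ≠ 0
  q_le : ∀ ζ ∈ Metric.ball 0 R, ‖q ζ‖ ^ 2 ≤ K
  le_q : ∀ ζ ∈ Metric.ball 0 R, 1 ≤ K * ‖q ζ‖ ^ 2
  coeff_form : ∀ ζ ∈ Metric.ball 0 R,
    coeffIn (chartAt ℂ p) η.toFun (chartAt ℂ p p + ζ) = ζ ^ m * q ζ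
  coeff_spin : ∀ ζ ∈ Metric.ball 0 R, coeffIn (chartAt ℂ p)
    (fun x => S.iso x ((trivializationAt ℂ C p).symm x 1 ⊗ₜ (trivializationAt ℂ C p).symm x 1))
    (chartAt ℂ p p + ζ) = c ζ ^ 2 * q ζ

/-- `η` does not vanish identically near `p`, since at a simple zero the derivative is non-zero;
hence its coefficient is `ζᵐ q` with `q` non-vanishing. The square of the preferred frame has a
non-vanishing coefficient `s`, and `c` is a local square root of `s / q`. -/
theorem exists_adaptedChart [IsManifold 𝓘(ℂ) ω X] [VectorBundle ℂ ℂ C]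
    (η : HolomorphicOneForm X) (hη : η.HasSimpleZeros) (S : SpinStructure C) (p : X) :
    Nonempty (AdaptedChart η S p) := by
  set e := chartAt ℂ p with he
  set τ := trivializationAt ℂ C p with hτ
  have heA : e ∈ atlas ℂ X := chart_mem_atlas ℂ p
  set a := e p with ha
  have hps : p ∈ e.source := mem_chart_source ℂ p
  have hat : a ∈ e.target := mem_chart_target ℂ p
  have hsa : e.symm a = p := e.left_inv hps
  have hpb : p ∈ τ.baseSet := FiberBundle.mem_baseSet_trivializationAt' p
  have hshift : AnalyticAt ℂ (fun ζ : ℂ => a + ζ) 0 := by fun_prop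
  have hopen : IsOpen (e.target ∩ e.symm ⁻¹' τ.baseSet) :=
    e.isOpen_inter_preimage_symm τ.open_baseSet
  have hain : a ∈ e.target ∩ e.symm ⁻¹' τ.baseSet := ⟨hat, by
    rw [Set.mem_preimage, hsa]
    exact hpb⟩
  have hf0 : AnalyticAt ℂ (coeffIn e η.toFun) a :=
    (η.holomorphic e heA).analyticAt (e.open_target.mem_nhds hat)
  have hs0 : AnalyticAt ℂ (coeffIn e fun x => S.iso x (τ.symm x 1 ⊗ₜ τ.symm x 1)) a :=
    (S.holomorphic e heA τ inferInstance).analyticAt (hopen.mem_nhds hain)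
  have hf : AnalyticAt ℂ (fun ζ => coeffIn e η.toFun (a + ζ)) 0 :=
    AnalyticAt.fun_comp (by simpa using hf0) hshift
  have hs : AnalyticAt ℂ (fun ζ => coeffIn e (fun x => S.iso x (τ.symm x 1 ⊗ₜ τ.symm x 1)) (a + ζ))
      0 := AnalyticAt.fun_comp (by simpa using hs0) hshift
  obtain ⟨k, hk0, hk⟩ := coeffIn_eq heA hat
  have hne : ¬∀ᶠ ζ in 𝓝 (0 : ℂ), coeffIn e η.toFun (a + ζ) = 0 := by
    intro hev
    have h0 : coeffIn e η.toFun a = 0 := by simpa using hev.self_of_nhds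
    have hp0 : η.toFun p = 0 := by
      rw [hk, mul_eq_zero, or_iff_right hk0] at h0
      have := covector_eq_zero h0
      rwa [hsa] at this
    refine hη p hp0 ?_
    have hev' : coeffIn e η.toFun =ᶠ[𝓝 a] fun _ => 0 := by
      have ht : Tendsto (fun z => z - a) (𝓝 a) (𝓝 0) := by
        have : Continuous fun z : ℂ => z - a := by fun_prop
        simpa using this.tendsto a
      filter_upwards [ht.eventually hev] with z hz
      simpa using hz
    rw [hev'.deriv_eq, deriv_const]
  obtain ⟨m, q, hq, hq0, hfq⟩ := hf.exists_eventuallyEq_pow_smul_nonzero_iff.2 hne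
  have hsne : coeffIn e (fun x => S.iso x (τ.symm x 1 ⊗ₜ τ.symm x 1)) (a + 0) ≠ 0 := by
    rw [add_zero, hk]
    refine mul_ne_zero hk0 ?_
    rw [hsa]
    exact spin_ne_zero S τ hpb
  obtain ⟨c, hc, hc0, hcb⟩ := exists_analyticAt_sq_eq (hs.div hq hq0) (div_ne_zero hsne hq0)
  -- On a small disc `|q|²` lies between `|q 0|²/2` and `2|q 0|²`; this `K` bounds both `|q|²` and
  -- its inverse.
  set K := 2 * ‖q 0‖ ^ 2 + 2 / ‖q 0‖ ^ 2 with hK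
  have hqp : 0 < ‖q 0‖ ^ 2 := by positivity
  have hqc : ContinuousAt (fun ζ => ‖q ζ‖ ^ 2) 0 := hq.continuousAt.norm.pow 2
  have hev : ∀ᶠ ζ in 𝓝 (0 : ℂ), a + ζ ∈ e.target ∩ e.symm ⁻¹' τ.baseSet ∧ AnalyticAt ℂ c ζ ∧
      AnalyticAt ℂ q ζ ∧ c ζ ≠ 0 ∧ q ζ ≠ 0 ∧ ‖q ζ‖ ^ 2 < 2 * ‖q 0‖ ^ 2 ∧
      ‖q 0‖ ^ 2 / 2 < ‖q ζ‖ ^ 2 ∧ coeffIn e η.toFun (a + ζ) = (ζ - 0) ^ m • q ζ := by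
    filter_upwards [hshift.continuousAt.eventually_mem (hopen.mem_nhds (by simpa using hain)),
      hc.eventually_analyticAt, hq.eventually_analyticAt, hc.continuousAt.eventually_ne hc0,
      hq.continuousAt.eventually_ne hq0, hqc.eventually_lt_const (show _ < 2 * ‖q 0‖ ^ 2 by linarith),
      hqc.eventually_const_lt (show ‖q 0‖ ^ 2 / 2 < _ by linarith), hfq] with ζ h1 h2 h3 h4 h5 h6 h7 h8
    exact ⟨h1, h2, h3, h4, h5, h6, h7, h8⟩
  obtain ⟨r, hr, hball⟩ := Metric.eventually_nhds_iff_ball.1 hev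
  replace hball := fun ζ (hζ : ζ ∈ Metric.ball 0 (min r 1)) =>
    hball ζ (Metric.ball_subset_ball (min_le_left _ _) hζ)
  refine ⟨⟨m, min r 1, K, c, q, lt_min hr one_pos, min_le_right _ _, by positivity,
    fun ζ hζ => (hball ζ hζ).1.1, fun ζ hζ => (hball ζ hζ).1.2, fun ζ hζ => (hball ζ hζ).2.1,
    fun ζ hζ => (hball ζ hζ).2.2.1, fun ζ hζ => (hball ζ hζ).2.2.2.1, fun ζ hζ => ?_, fun ζ hζ => ?_,
    fun ζ hζ => ?_, fun ζ hζ => ?_⟩⟩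
  · have := (hball ζ hζ).2.2.2.2.2.1
    have h2 : 0 < 2 / ‖q 0‖ ^ 2 := by positivity
    rw [hK]
    linarith
  · have h1 := (hball ζ hζ).2.2.2.2.2.2.1
    have h2 : 2 / ‖q 0‖ ^ 2 * (‖q 0‖ ^ 2 / 2) = 1 := by field_simp
    have h3 : 2 / ‖q 0‖ ^ 2 ≤ K := by
      rw [hK]
      linarith
    rw [← h2]
    exact mul_le_mul h3 h1.le (by positivity) (by positivity)
  · have := (hball ζ hζ).2.2.2.2.2.2.2
    simpa using this
  · have h1 := (hball ζ hζ).2.2.2.2.1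
    rw [hcb]
    simp only [Pi.div_apply]
    field_simp
    rfl

end Adapted

/-! ### Square integrable sections in adapted coordinates -/

namespace AdaptedChart

variable {X : Type*} [TopologicalSpace X] [ChartedSpace ℂ X] [IsManifold 𝓘(ℂ) ω X]
  {C : X → Type*} [∀ x, AddCommGroup (C x)] [∀ x, Module ℂ (C x)] [∀ x, TopologicalSpace (C x)]
  [TopologicalSpace (TotalSpace ℂ C)] [FiberBundle ℂ C] [VectorBundle ℂ ℂ C]
  {η : HolomorphicOneForm X} {S : SpinStructure C} {p : X} (D : AdaptedChart η S p)

/-- The parametrization of a neighborhood of `p` by the disc. -/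
def param (_ : AdaptedChart η S p) (ζ : ℂ) : X := (chartAt ℂ p).symm (chartAt ℂ p p + ζ)

/-- The coordinate that vanishes at `p`. -/
def coordinate (_ : AdaptedChart η S p) (x : X) : ℂ := chartAt ℂ p x - chartAt ℂ p p

/-- The neighborhood `{|ζ| < t}` of `p`. -/
def nbhd (t : ℝ) : Set X := (chartAt ℂ p).source ∩ {x | D.coordinate x ∈ Metric.ball 0 t}

/-- The frame of `C` with square `q dζ`. -/
def frame (x : X) : C x := (trivializationAt ℂ C p).symm x (D.c (D.coordinate x))⁻¹

/-- The coefficient of a vector with respect to `frame`. -/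
def coeff (x : X) (v : C x) : ℂ := D.c (D.coordinate x) * (trivializationAt ℂ C p ⟨x, v⟩).2

/-- The coefficient of a section with respect to `frame`, as a function on the disc. -/
def pull (u : ∀ x, C x) (ζ : ℂ) : ℂ := D.coeff (D.param ζ) (u (D.param ζ))

open scoped Classical in
/-- The section with a given coefficient, extended by zero. -/
def push (k : ℂ → ℂ) (x : X) : C x :=
  if x ∈ D.nbhd D.R then k (D.coordinate x) • D.frame x else 0

variable {D} {t : ℝ}

theorem nbhd_mono {s : ℝ} (h : s ≤ t) : D.nbhd s ⊆ D.nbhd t :=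
  Set.inter_subset_inter_right _ fun _ hx => Metric.ball_subset_ball h hx

theorem coordinate_mem {x : X} (hx : x ∈ D.nbhd t) : D.coordinate x ∈ Metric.ball 0 t := hx.2

theorem param_coordinate {x : X} (hx : x ∈ D.nbhd t) : D.param (D.coordinate x) = x := by
  rw [param, coordinate, add_sub_cancel, (chartAt ℂ p).left_inv hx.1]

theorem coordinate_param {ζ : ℂ} (hζ : ζ ∈ Metric.ball 0 D.R) : D.coordinate (D.param ζ) = ζ := by
  rw [param, coordinate, (chartAt ℂ p).right_inv (D.mem_target ζ hζ), add_sub_cancel_left]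

theorem param_mem (ht : t ≤ D.R) {ζ : ℂ} (hζ : ζ ∈ Metric.ball 0 t) : D.param ζ ∈ D.nbhd t := by
  have hζ' := Metric.ball_subset_ball ht hζ
  refine ⟨(chartAt ℂ p).map_target (D.mem_target ζ hζ'), ?_⟩
  change D.coordinate (D.param ζ) ∈ Metric.ball 0 t
  rwa [coordinate_param hζ']

theorem mem_nbhd (ht : 0 < t) : p ∈ D.nbhd t :=
  ⟨mem_chart_source ℂ p, by
    change D.coordinate p ∈ Metric.ball 0 t
    simpa [coordinate] using ht⟩

theorem isOpen_nbhd : IsOpen (D.nbhd t) := by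
  refine (chartAt ℂ p).isOpen_inter_preimage (s := {z | z - chartAt ℂ p p ∈ Metric.ball 0 t}) ?_
  exact Metric.isOpen_ball.preimage (by fun_prop)

theorem continuousOn_coordinate : ContinuousOn D.coordinate (D.nbhd t) :=
  ((chartAt ℂ p).continuousOn.mono Set.inter_subset_left).sub continuousOn_const

theorem continuousOn_param : ContinuousOn D.param (Metric.ball 0 D.R) :=
  (chartAt ℂ p).continuousOn_symm.comp (by fun_prop) D.mem_target

theorem nbhd_subset_baseSet : D.nbhd D.R ⊆ (trivializationAt ℂ C p).baseSet := by
  intro x hx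
  have := D.mem_baseSet _ (coordinate_mem hx)
  rwa [coordinate, add_sub_cancel, (chartAt ℂ p).left_inv hx.1] at this

theorem c_ne {x : X} (hx : x ∈ D.nbhd D.R) : D.c (D.coordinate x) ≠ 0 :=
  D.c_ne_zero _ (coordinate_mem hx)

theorem coeff_smul_frame {x : X} (hx : x ∈ D.nbhd D.R) (k : ℂ) : D.coeff x (k • D.frame x) = k := by
  have hb := nbhd_subset_baseSet hx
  have h1 := ((trivializationAt ℂ C p).linear ℂ hb).map_smul k (D.frame x)
  rw [coeff, h1, frame, (trivializationAt ℂ C p).apply_mk_symm hb, smul_eq_mul]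
  have := c_ne hx
  field_simp

theorem coeff_zero {x : X} (hx : x ∈ D.nbhd D.R) : D.coeff x 0 = 0 := by
  have := coeff_smul_frame hx 0
  rwa [zero_smul] at this

theorem coeff_push {x : X} (hx : x ∈ D.nbhd D.R) (k : ℂ → ℂ) :
    D.coeff x (D.push k x) = k (D.coordinate x) := by
  rw [push, if_pos hx, coeff_smul_frame hx]

theorem push_of_notMem {x : X} (hx : x ∉ D.nbhd D.R) (k : ℂ → ℂ) : D.push k x = 0 := if_neg hx

theorem pull_push {ζ : ℂ} (hζ : ζ ∈ Metric.ball 0 D.R) (k : ℂ → ℂ) : D.pull (D.push k) ζ = k ζ := by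
  rw [pull, coeff_push (param_mem le_rfl hζ), coordinate_param hζ]

theorem form_eq {x : X} (hx : x ∈ D.nbhd D.R) :
    coeffIn (chartAt ℂ p) η.toFun (chartAt ℂ p x) =
      D.coordinate x ^ D.m * D.q (D.coordinate x) := by
  have := D.coeff_form _ (coordinate_mem hx)
  rwa [coordinate, add_sub_cancel] at this

theorem q_ne_zero {ζ : ℂ} (hζ : ζ ∈ Metric.ball 0 D.R) : D.q ζ ≠ 0 := by
  intro h
  have := D.le_q ζ hζ
  rw [h] at this
  norm_num at this

/-- The factor `q` of `η` cancels against the factor `q` in the square of the adapted frame. This is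
why the frame squares to `q dζ` and not to `dζ`. -/
theorem weight_coordinate {x : X} (hx : x ∈ D.nbhd D.R) :
    weight η S (trivializationAt ℂ C p) x =
      ‖D.c (D.coordinate x)‖ ^ 2 / ‖D.coordinate x‖ ^ D.m := by
  rw [weight_eq η S (chart_mem_atlas ℂ p) _ hx.1, form_eq hx]
  have h := D.coeff_spin _ (coordinate_mem hx)
  have h2 : chartAt ℂ p p + D.coordinate x = chartAt ℂ p x := add_sub_cancel _ _
  rw [h2] at h
  have hq := norm_ne_zero_iff.2 (q_ne_zero (coordinate_mem hx))
  rw [h, norm_mul, norm_mul, norm_pow, norm_pow, mul_div_mul_right _ _ hq]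

theorem herm_eq_coeff {x : X} (hx : x ∈ D.nbhd D.R) (a b : C x) :
    herm η S x a b = ((‖D.coordinate x‖ : ℂ) ^ D.m)⁻¹ * (D.coeff x a * conj (D.coeff x b)) := by
  rw [herm_eq η S (trivializationAt ℂ C p) (nbhd_subset_baseSet hx), weight_coordinate hx, coeff,
    coeff, map_mul]
  push_cast
  rw [← Complex.mul_conj']
  ring

theorem herm_param {ζ : ℂ} (hζ : ζ ∈ Metric.ball 0 D.R) (u v : ∀ x, C x) :
    herm η S (D.param ζ) (u (D.param ζ)) (v (D.param ζ)) =
      ((‖ζ‖ : ℂ) ^ D.m)⁻¹ * (D.pull u ζ * conj (D.pull v ζ)) := by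
  rw [herm_eq_coeff (param_mem le_rfl hζ), coordinate_param hζ, pull, pull]

variable (D) in
/-- The density of the area measure with respect to `|ζ|ᵐ dx dy`. -/
def density (ζ : ℂ) : ℝ := ‖ζ‖ ^ D.m * ‖D.q ζ‖ ^ 2

theorem density_nonneg (ζ : ℂ) : 0 ≤ D.density ζ := by
  unfold density
  positivity

theorem continuousOn_q : ContinuousOn D.q (Metric.ball 0 D.R) := fun ζ hζ =>
  (D.analytic_q ζ hζ).continuousAt.continuousWithinAt

theorem disc_absolutelyContinuous {m : ℕ} :
    disc m t ≪ volume.restrict (Metric.ball 0 t) := withDensity_absolutelyContinuous _ _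

theorem aemeasurable_disc_of_continuousOn {β : Type*} [TopologicalSpace β] [MeasurableSpace β]
    [BorelSpace β] {m : ℕ} {f : ℂ → β} (ht : t ≤ D.R) (hf : ContinuousOn f (Metric.ball 0 D.R)) :
    AEMeasurable f (disc m t) :=
  ((hf.mono (Metric.ball_subset_ball ht)).aemeasurable
    Metric.isOpen_ball.measurableSet).mono_ac disc_absolutelyContinuous

theorem aemeasurable_density (ht : t ≤ D.R) {m : ℕ} : AEMeasurable D.density (disc m t) :=
  aemeasurable_disc_of_continuousOn ht
    ((continuous_norm.continuousOn.pow _).mul (continuousOn_q.norm.pow 2))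

theorem withDensity_disc (ht : t ≤ D.R) :
    (disc D.m t).withDensity (fun ζ => ENNReal.ofReal (D.density ζ)) =
      (volume.restrict (Metric.ball 0 t)).withDensity fun ζ =>
        ENNReal.ofReal (‖coeffIn (chartAt ℂ p) η.toFun (chartAt ℂ p p + ζ)‖ ^ 2) := by
  have hd : AEMeasurable (fun ζ => ENNReal.ofReal (D.density ζ))
      (volume.restrict (Metric.ball 0 t)) := by
    refine ENNReal.measurable_ofReal.comp_aemeasurable ?_
    refine ContinuousOn.aemeasurable ?_ Metric.isOpen_ball.measurableSet
    exact (continuous_norm.continuousOn.pow _).mul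
      ((continuousOn_q.mono (Metric.ball_subset_ball ht)).norm.pow 2)
  rw [disc, ← withDensity_mul₀ (by fun_prop) hd]
  refine withDensity_congr_ae ?_
  filter_upwards [ae_restrict_mem Metric.isOpen_ball.measurableSet] with ζ hζ
  rw [D.coeff_form ζ (Metric.ball_subset_ball ht hζ), Pi.mul_apply,
    ← ENNReal.ofReal_mul (by positivity), density]
  congr 1
  rw [norm_mul, norm_pow]
  ring

variable [MeasurableSpace X] [BorelSpace X]

theorem aemeasurable_param (ht : t ≤ D.R) {m : ℕ} : AEMeasurable D.param (disc m t) :=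
  aemeasurable_disc_of_continuousOn ht continuousOn_param

/-- The density `|ζ|^(2m) |q|²` of the area is split into the factor `|ζ|ᵐ` of `disc` and `density`;
translation invariance of Lebesgue measure moves the centre of the disc to the origin. -/
theorem restrict_nbhd (ht : t ≤ D.R) : (areaMeasure η).restrict (D.nbhd t) =
    ((disc D.m t).withDensity fun ζ => ENNReal.ofReal (D.density ζ)).map D.param := by
  have hV : MeasurableSet (D.nbhd t) := isOpen_nbhd.measurableSet
  have hb : MeasurableSet (Metric.ball (0 : ℂ) t) := Metric.isOpen_ball.measurableSet
  have hp : AEMeasurable D.param (volume.restrict (Metric.ball 0 t)) :=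
    (continuousOn_param.mono (Metric.ball_subset_ball ht)).aemeasurable hb
  ext A hA
  rw [areaMeasure_restrict η (chart_mem_atlas ℂ p) hV Set.inter_subset_left,
    Measure.restrict_apply hA, localArea_apply η _ (hA.inter hV), withDensity_disc ht,
    Measure.map_apply_of_aemeasurable (hp.mono_ac (withDensity_absolutelyContinuous _ _)) hA,
    withDensity_apply', Measure.restrict_restrict₀ (hp.nullMeasurable hA),
    ← (measurePreserving_add_left volume (chartAt ℂ p p)).setLIntegral_comp_preimage_emb
      (measurableEmbedding_addLeft _)]
  congr 2
  ext ζ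
  constructor
  · rintro ⟨h1, h2, h3⟩
    have h4 : D.coordinate (D.param ζ) ∈ Metric.ball 0 t := h3.2
    have h5 : D.coordinate (D.param ζ) = ζ := by
      rw [param, coordinate, (chartAt ℂ p).right_inv h1, add_sub_cancel_left]
    rw [h5] at h4
    exact ⟨h2, h4⟩
  · rintro ⟨h1, h2⟩
    exact ⟨D.mem_target ζ (Metric.ball_subset_ball ht h2), h1, param_mem ht h2⟩

theorem ae_density_ne_zero (ht : t ≤ D.R) {m : ℕ} :
    ∀ᵐ ζ ∂disc m t, ENNReal.ofReal (D.density ζ) ≠ 0 := by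
  filter_upwards [ae_disc_ne_zero, ae_disc] with ζ h0 hζ
  have := norm_pos_iff.2 (q_ne_zero (Metric.ball_subset_ball ht hζ))
  have := norm_pos_iff.2 h0
  rw [Ne, ENNReal.ofReal_eq_zero, not_le, density]
  positivity

/-- The density vanishes only on a null set, so passing to `disc` creates no new sets of positive
measure. -/
theorem aestronglyMeasurable_comp_param (ht : t ≤ D.R) {G : X → ℂ}
    (hG : AEMeasurable G ((areaMeasure η).restrict (D.nbhd t))) :
    AEStronglyMeasurable (fun ζ => G (D.param ζ)) (disc D.m t) := by
  rw [restrict_nbhd ht] at hG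
  have hac : disc D.m t ≪ (disc D.m t).withDensity fun ζ => ENNReal.ofReal (D.density ζ) :=
    withDensity_absolutelyContinuous' (aemeasurable_density ht).ennreal_ofReal
      (ae_density_ne_zero ht)
  exact ((hG.comp_aemeasurable ((aemeasurable_param ht).mono_ac
    (withDensity_absolutelyContinuous _ _))).mono_ac hac).aestronglyMeasurable

theorem setIntegral_nbhd (ht : t ≤ D.R) {G : X → ℂ} (hG : AEStronglyMeasurable G (areaMeasure η)) :
    ∫ x in D.nbhd t, G x ∂areaMeasure η = ∫ ζ, (D.density ζ : ℂ) * G (D.param ζ) ∂disc D.m t := by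
  have hG' := hG.mono_measure (Measure.restrict_le_self (s := D.nbhd t))
  rw [restrict_nbhd ht] at hG' ⊢
  rw [integral_map ((aemeasurable_param ht).mono_ac (withDensity_absolutelyContinuous _ _)) hG',
    integral_withDensity_eq_integral_toReal_smul₀ (aemeasurable_density ht).ennreal_ofReal
      (by simp)]
  simp only [ENNReal.toReal_ofReal (density_nonneg _), Complex.real_smul]

theorem integrable_comp_param (ht : t ≤ D.R) {G : X → ℂ} (hG : Integrable G (areaMeasure η)) :
    Integrable (fun ζ => (D.density ζ : ℂ) * G (D.param ζ)) (disc D.m t) := by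
  have hG' := hG.mono_measure (Measure.restrict_le_self (s := D.nbhd t))
  rw [restrict_nbhd ht] at hG'
  have h1 := hG'.comp_aemeasurable ((aemeasurable_param ht).mono_ac
    (withDensity_absolutelyContinuous _ _))
  rw [integrable_withDensity_iff_integrable_smul₀' (aemeasurable_density ht).ennreal_ofReal
    (by simp)] at h1
  simpa only [ENNReal.toReal_ofReal (density_nonneg _), Complex.real_smul, Function.comp] using h1

end AdaptedChart

/-! ### Transfer of square integrable sections to the disc -/

section Transfer

variable {X : Type*} [TopologicalSpace X] [ChartedSpace ℂ X] [IsManifold 𝓘(ℂ) ω X]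
  [CompactSpace X] [ConnectedSpace X] [MeasurableSpace X] [BorelSpace X]
  {C : X → Type*} [∀ x, AddCommGroup (C x)] [∀ x, Module ℂ (C x)] [∀ x, TopologicalSpace (C x)]
  [TopologicalSpace (TotalSpace ℂ C)] [FiberBundle ℂ C] [VectorBundle ℂ ℂ C]
  {η : HolomorphicOneForm X} {S : SpinStructure C} {p : X} {D : AdaptedChart η S p}

theorem integrable_herm {u v : ∀ x, C x} (hu : IsSquareIntegrable η S u)
    (hv : IsSquareIntegrable η S v) :
    Integrable (fun x => herm η S x (u x) (v x)) (areaMeasure η) := by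
  obtain ⟨Φ, h1, h2, -, -⟩ := exists_unitary_coordinate η S
  have hu' := ((isSquareIntegrable_iff η S h1 h2 u).1 hu).2
  have hv' := ((isSquareIntegrable_iff η S h1 h2 v).1 hv).2
  simp only [h1]
  exact integrable_mul_of_memLp hu' hv'.star

theorem herm_self (x : X) (a : C x) : herm η S x a a = (‖herm η S x a a‖ : ℝ) := by
  obtain ⟨Φ, h1, -, -, -⟩ := exists_unitary_coordinate η S
  rw [h1, Complex.mul_conj', norm_pow, Complex.norm_real, norm_norm]
  norm_cast

theorem norm_mk_sq {u : ∀ x, C x} (hu : IsSquareIntegrable η S u) :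
    ‖L2.mk u hu‖ ^ 2 = ∫ x, ‖herm η S x (u x) (u x)‖ ∂areaMeasure η := by
  have h1 := L2.inner_mk η S u u hu hu
  rw [inner_self_eq_norm_sq_to_K] at h1
  rw [integral_congr_ae (ae_of_all _ fun x => herm_self (η := η) (S := S) x (u x)),
    integral_complex_ofReal] at h1
  refine Complex.ofReal_injective ?_
  rw [← h1]
  simp

namespace AdaptedChart

variable {t : ℝ}

theorem aestronglyMeasurable_pull (ht : t ≤ D.R) {u : ∀ x, C x} (hu : AEMeasurableSection η u) :
    AEStronglyMeasurable (D.pull u) (disc D.m t) := by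
  have h1 := aestronglyMeasurable_comp_param ht ((hu p).mono_measure
    (Measure.restrict_mono ((nbhd_mono ht).trans nbhd_subset_baseSet) le_rfl))
  have hc : AEStronglyMeasurable D.c (disc D.m t) := (aemeasurable_disc_of_continuousOn ht
    fun ζ hζ => (D.analytic_c ζ hζ).continuousAt.continuousWithinAt).aestronglyMeasurable
  refine (hc.mul h1).congr ?_
  filter_upwards [ae_disc] with ζ hζ
  rw [pull, coeff, coordinate_param (Metric.ball_subset_ball ht hζ)]
  rfl

/-- The factor `|ζ|ᵐ` of the density cancels the weight `|ζ|⁻ᵐ` of the metric on `C`. Up to `|q|²`,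
which is bounded above and below, the norm of `L₂(X; C)` is therefore that of `disc`. -/
theorem ae_density_mul_herm (ht : t ≤ D.R) (u v : ∀ x, C x) : ∀ᵐ ζ ∂disc D.m t,
    (D.density ζ : ℂ) * herm η S (D.param ζ) (u (D.param ζ)) (v (D.param ζ)) =
      (‖D.q ζ‖ ^ 2 : ℝ) * (D.pull u ζ * conj (D.pull v ζ)) := by
  filter_upwards [ae_disc, ae_disc_ne_zero] with ζ hζ h0
  have h0' : (‖ζ‖ : ℂ) ≠ 0 := by simpa using h0
  rw [herm_param (Metric.ball_subset_ball ht hζ), density]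
  push_cast
  field_simp

theorem setIntegral_herm (ht : t ≤ D.R) {u v : ∀ x, C x} (hu : IsSquareIntegrable η S u)
    (hv : IsSquareIntegrable η S v) :
    ∫ x in D.nbhd t, herm η S x (u x) (v x) ∂areaMeasure η =
      ∫ ζ, (‖D.q ζ‖ ^ 2 : ℝ) * (D.pull u ζ * conj (D.pull v ζ)) ∂disc D.m t := by
  rw [setIntegral_nbhd ht (integrable_herm hu hv).1]
  exact integral_congr_ae (ae_density_mul_herm ht u v)

theorem integrable_pull (ht : t ≤ D.R) {u v : ∀ x, C x} (hu : IsSquareIntegrable η S u)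
    (hv : IsSquareIntegrable η S v) :
    Integrable (fun ζ => ((‖D.q ζ‖ ^ 2 : ℝ) : ℂ) * (D.pull u ζ * conj (D.pull v ζ)))
      (disc D.m t) :=
  (integrable_comp_param ht (integrable_herm hu hv)).congr (ae_density_mul_herm ht u v)

theorem integrable_sq_pull (ht : t ≤ D.R) {u : ∀ x, C x} (hu : IsSquareIntegrable η S u) :
    Integrable (fun ζ => ‖D.q ζ‖ ^ 2 * ‖D.pull u ζ‖ ^ 2) (disc D.m t) := by
  refine (integrable_pull ht hu hu).norm.congr (ae_of_all _ fun ζ => ?_)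
  simp only
  rw [norm_mul, norm_mul, RCLike.norm_conj, Complex.norm_real, Real.norm_of_nonneg (by positivity)]
  ring

theorem setIntegral_norm_herm (ht : t ≤ D.R) {u : ∀ x, C x} (hu : IsSquareIntegrable η S u) :
    ∫ x in D.nbhd t, ‖herm η S x (u x) (u x)‖ ∂areaMeasure η =
      ∫ ζ, ‖D.q ζ‖ ^ 2 * ‖D.pull u ζ‖ ^ 2 ∂disc D.m t := by
  have h := setIntegral_herm (D := D) ht hu hu
  rw [integral_congr_ae (ae_of_all _ fun x => herm_self (η := η) (S := S) x (u x)),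
    integral_complex_ofReal] at h
  simp only [Complex.mul_conj'] at h
  have h2 : ∀ ζ, ((‖D.q ζ‖ ^ 2 : ℝ) : ℂ) * (‖D.pull u ζ‖ : ℂ) ^ 2 =
      ((‖D.q ζ‖ ^ 2 * ‖D.pull u ζ‖ ^ 2 : ℝ) : ℂ) := fun ζ => by push_cast; ring
  simp only [h2] at h
  rw [integral_complex_ofReal] at h
  exact_mod_cast h

theorem integral_sq_pull_le (ht : t ≤ D.R) {u : ∀ x, C x} (hu : IsSquareIntegrable η S u) :
    ∫ ζ, ‖D.q ζ‖ ^ 2 * ‖D.pull u ζ‖ ^ 2 ∂disc D.m t ≤ ‖L2.mk u hu‖ ^ 2 := by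
  rw [norm_mk_sq, ← setIntegral_norm_herm ht hu]
  exact setIntegral_le_integral (integrable_herm hu hu).norm (ae_of_all _ fun _ => norm_nonneg _)

theorem memLp_pull (ht : t ≤ D.R) {u : ∀ x, C x} (hu : IsSquareIntegrable η S u) :
    MemLp (D.pull u) 2 (disc D.m t) := by
  have hm := aestronglyMeasurable_pull (D := D) ht hu.1
  refine (memLp_two_iff_integrable_sq_norm hm).2 ?_
  refine ((integrable_sq_pull ht hu).const_mul D.K).mono' (hm.norm.pow 2) ?_
  filter_upwards [ae_disc] with ζ hζ
  have := D.le_q ζ (Metric.ball_subset_ball ht hζ)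
  rw [Real.norm_of_nonneg (by positivity)]
  nlinarith [sq_nonneg ‖D.pull u ζ‖]

theorem memLp_q_mul_pull {u : ∀ x, C x} (hu : IsSquareIntegrable η S u) :
    MemLp (fun ζ => ((‖D.q ζ‖ ^ 2 : ℝ) : ℂ) * D.pull u ζ) 2 (disc D.m D.R) := by
  have hq : AEStronglyMeasurable (fun ζ => ((‖D.q ζ‖ ^ 2 : ℝ) : ℂ)) (disc D.m D.R) :=
    (aemeasurable_disc_of_continuousOn le_rfl (Complex.continuous_ofReal.comp_continuousOn
      (continuousOn_q.norm.pow 2))).aestronglyMeasurable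
  have hm := memLp_pull (D := D) le_rfl hu
  refine MemLp.of_le_mul (c := D.K) hm (hq.mul hm.1) ?_
  filter_upwards [ae_disc] with ζ hζ
  rw [norm_mul, Complex.norm_real, Real.norm_of_nonneg (by positivity)]
  exact mul_le_mul_of_nonneg_right (D.q_le ζ hζ) (norm_nonneg _)

theorem l2norm_pull_sq_le {u : ∀ x, C x} (hu : IsSquareIntegrable η S u) :
    l2norm (disc D.m D.R) (D.pull u) ^ 2 ≤ D.K * ‖L2.mk u hu‖ ^ 2 := by
  refine le_trans ?_ (mul_le_mul_of_nonneg_left (integral_sq_pull_le (D := D) le_rfl hu) D.K_pos.le)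
  rw [l2norm_sq, ← integral_const_mul]
  refine integral_mono_of_nonneg (ae_of_all _ fun _ => by positivity)
    ((integrable_sq_pull le_rfl hu).const_mul _) ?_
  filter_upwards [ae_disc] with ζ hζ
  have := D.le_q ζ hζ
  nlinarith [sq_nonneg ‖D.pull u ζ‖]

theorem l2norm_q_mul_pull_sq_le {u : ∀ x, C x} (hu : IsSquareIntegrable η S u) :
    l2norm (disc D.m D.R) (fun ζ => ((‖D.q ζ‖ ^ 2 : ℝ) : ℂ) * D.pull u ζ) ^ 2 ≤
      D.K * ‖L2.mk u hu‖ ^ 2 := by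
  refine le_trans ?_ (mul_le_mul_of_nonneg_left (integral_sq_pull_le (D := D) le_rfl hu) D.K_pos.le)
  rw [l2norm_sq, ← integral_const_mul]
  refine integral_mono_of_nonneg (ae_of_all _ fun _ => by positivity)
    ((integrable_sq_pull le_rfl hu).const_mul _) ?_
  filter_upwards [ae_disc] with ζ hζ
  have := D.q_le ζ hζ
  rw [norm_mul, Complex.norm_real, Real.norm_of_nonneg (by positivity), mul_pow]
  have h2 := mul_le_mul_of_nonneg_right this
    (show 0 ≤ ‖D.q ζ‖ ^ 2 * ‖D.pull u ζ‖ ^ 2 by positivity)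
  nlinarith

theorem setIntegral_norm_herm_le (ht : t ≤ D.R) {u : ∀ x, C x} (hu : IsSquareIntegrable η S u) :
    ∫ x in D.nbhd t, ‖herm η S x (u x) (u x)‖ ∂areaMeasure η ≤
      D.K * l2norm (disc D.m t) (D.pull u) ^ 2 := by
  rw [setIntegral_norm_herm ht hu, l2norm_sq, ← integral_const_mul]
  have hi := (memLp_two_iff_integrable_sq_norm (memLp_pull (D := D) ht hu).1).1 (memLp_pull ht hu)
  refine integral_mono_of_nonneg (ae_of_all _ fun _ => by positivity) (hi.const_mul _) ?_
  filter_upwards [ae_disc] with ζ hζ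
  exact mul_le_mul_of_nonneg_right (D.q_le ζ (Metric.ball_subset_ball ht hζ)) (sq_nonneg _)

variable [ContMDiffVectorBundle ω ℂ C 𝓘(ℂ)]

theorem contMDiffAt_coordinate {x : X} (hx : x ∈ D.nbhd D.R) :
    ContMDiffAt 𝓘(ℂ) 𝓘(ℂ) ω D.coordinate x :=
  (contMDiffAt_chart (chart_mem_atlas ℂ p) hx.1).sub contMDiffAt_const

theorem contMDiffAt_frame {x : X} (hx : x ∈ D.nbhd D.R) :
    ContMDiffAt 𝓘(ℂ) (𝓘(ℂ).prod 𝓘(ℂ)) ω (fun x => TotalSpace.mk' ℂ x (D.frame x)) x := by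
  refine ((trivializationAt ℂ C p).contMDiffAt_section_iff (nbhd_subset_baseSet hx)).2 ?_
  have h1 : AnalyticAt ℂ (fun ζ => (D.c ζ)⁻¹) (D.coordinate x) :=
    (D.analytic_c _ (coordinate_mem hx)).inv (c_ne hx)
  have h2 : ContMDiffAt 𝓘(ℂ) 𝓘(ℂ) ω (fun x => (D.c (D.coordinate x))⁻¹) x :=
    ContMDiffAt.comp (g := fun ζ => (D.c ζ)⁻¹) x h1.contDiffAt.contMDiffAt
      (contMDiffAt_coordinate hx)
  refine h2.congr_of_eventuallyEq ?_
  filter_upwards [isOpen_nbhd.mem_nhds hx] with y hy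
  rw [frame, (trivializationAt ℂ C p).apply_mk_symm (nbhd_subset_baseSet hy)]

theorem contMDiffAt_frame_coeff (τ : Trivialization ℂ (π ℂ C)) [MemTrivializationAtlas τ] {x : X}
    (hx : x ∈ D.nbhd D.R) (hxτ : x ∈ τ.baseSet) :
    ContMDiffAt 𝓘(ℂ) 𝓘(ℂ) ω (fun x => (τ ⟨x, D.frame x⟩).2) x :=
  (τ.contMDiffAt_section_iff hxτ).1 (contMDiffAt_frame hx)

theorem trivialization_push (τ : Trivialization ℂ (π ℂ C)) [MemTrivializationAtlas τ] {x : X}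
    (hx : x ∈ D.nbhd D.R) (hxτ : x ∈ τ.baseSet) (k : ℂ → ℂ) :
    (τ ⟨x, D.push k x⟩).2 = k (D.coordinate x) * (τ ⟨x, D.frame x⟩).2 := by
  rw [push, if_pos hx]
  exact (τ.linear ℂ hxτ).map_smul _ _

theorem aemeasurableSection_push {k : ℂ → ℂ} (hk : Measurable k) :
    AEMeasurableSection η (D.push k) := by
  classical
  intro p'
  set τ := trivializationAt ℂ C p'
  have hms : MeasurableSet (D.nbhd D.R ∩ τ.baseSet) :=
    (isOpen_nbhd.inter τ.open_baseSet).measurableSet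
  have h1 : AEMeasurable (fun x => k (D.coordinate x) * (τ ⟨x, D.frame x⟩).2)
      ((areaMeasure η).restrict (D.nbhd D.R ∩ τ.baseSet)) := by
    refine (hk.comp_aemeasurable ((continuousOn_coordinate.mono
      Set.inter_subset_left).aemeasurable hms)).mul (ContinuousOn.aemeasurable (fun x hx => ?_) hms)
    exact (contMDiffAt_frame_coeff τ hx.1 hx.2).continuousAt.continuousWithinAt
  have h2 := ((aemeasurable_indicator_iff hms).2 h1).mono_measure
    (Measure.restrict_le_self (s := τ.baseSet))
  refine h2.congr ?_
  filter_upwards [ae_restrict_mem τ.open_baseSet.measurableSet] with x hx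
  by_cases hxD : x ∈ D.nbhd D.R
  · rw [Set.indicator_of_mem (show x ∈ D.nbhd D.R ∩ τ.baseSet from ⟨hxD, hx⟩), trivialization_push τ hxD hx]
  · rw [Set.indicator_of_notMem fun h => hxD h.1, push_of_notMem hxD]
    exact ((τ.linear ℂ hx).map_zero).symm

theorem isSquareIntegrable_push {k : ℂ → ℂ} (hk : Measurable k)
    (hk2 : MemLp k 2 (disc D.m D.R)) : IsSquareIntegrable η S (D.push k) := by
  refine ⟨aemeasurableSection_push hk, ?_⟩
  set f : X → ENNReal := fun x => ENNReal.ofReal (herm η S x (D.push k x) (D.push k x)).re with hf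
  have h0 : ∫⁻ x, f x ∂areaMeasure η = ∫⁻ x in D.nbhd D.R, f x ∂areaMeasure η := by
    rw [← lintegral_indicator isOpen_nbhd.measurableSet]
    refine lintegral_congr fun x => ?_
    by_cases hx : x ∈ D.nbhd D.R
    · rw [Set.indicator_of_mem hx]
    · obtain ⟨Φ, h1, -, -, -⟩ := exists_unitary_coordinate η S
      rw [Set.indicator_of_notMem hx, hf]
      simp [push_of_notMem hx, h1]
  have hint : Integrable (fun ζ => D.K * ‖k ζ‖ ^ 2) (disc D.m D.R) :=
    ((memLp_two_iff_integrable_sq_norm hk2.1).1 hk2).const_mul _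
  rw [h0, restrict_nbhd le_rfl]
  -- Only an upper bound is needed, so measurability of `f` can be avoided.
  refine (lintegral_map_le _ _).trans_lt ?_
  rw [lintegral_withDensity_eq_lintegral_mul_non_measurable₀ _
    (aemeasurable_density le_rfl).ennreal_ofReal (ae_of_all _ fun _ => ENNReal.ofReal_lt_top)]
  refine lt_of_le_of_lt (lintegral_mono_ae ?_) hint.lintegral_lt_top
  filter_upwards [ae_disc, ae_density_mul_herm le_rfl (D.push k) (D.push k)] with ζ hζ h1
  rw [Pi.mul_apply, hf, ← ENNReal.ofReal_mul (density_nonneg _)]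
  refine ENNReal.ofReal_le_ofReal ?_
  have h2 := congrArg Complex.re h1
  rw [Complex.re_ofReal_mul, pull_push hζ, Complex.mul_conj'] at h2
  rw [h2]
  have h3 : (((‖D.q ζ‖ ^ 2 : ℝ) : ℂ) * (‖k ζ‖ : ℂ) ^ 2).re = ‖D.q ζ‖ ^ 2 * ‖k ζ‖ ^ 2 := by
    norm_cast
  rw [h3]
  exact mul_le_mul_of_nonneg_right (D.q_le ζ hζ) (sq_nonneg _)

theorem inner_mk_push {k : ℂ → ℂ} (hk : IsSquareIntegrable η S (D.push k)) {u : ∀ x, C x}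
    (hu : IsSquareIntegrable η S u) : inner ℂ (L2.mk (D.push k) hk) (L2.mk u hu) =
      ∫ ζ, (‖D.q ζ‖ ^ 2 : ℝ) * (D.pull u ζ * conj (k ζ)) ∂disc D.m D.R := by
  rw [L2.inner_mk, ← setIntegral_eq_integral_of_forall_compl_eq_zero (s := D.nbhd D.R),
    setIntegral_herm le_rfl hu hk]
  · refine integral_congr_ae ?_
    filter_upwards [ae_disc] with ζ hζ
    rw [pull_push hζ]
  · intro x hx
    obtain ⟨Φ, h1, -, -, -⟩ := exists_unitary_coordinate η S
    simp [push_of_notMem hx, h1]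

end AdaptedChart

end Transfer

/-! ### Test sections supported in an adapted chart -/

section TestFunctions

variable {u Φ : ℂ → ℂ} {z : ℂ} {m : ℕ}

theorem contDiffAt_dz (hu : ContDiffAt ℝ ∞ u z) : ContDiffAt ℝ ∞ (dz u) z := by
  have h1 : ContDiffAt ℝ ∞ (fderiv ℝ u) z := hu.fderiv_right (m := ∞) (by simp)
  have h2 : ∀ v : ℂ, ContDiffAt ℝ ∞ (fun w => fderiv ℝ u w v) z := fun v =>
    h1.clm_apply contDiffAt_const
  have h3 := h2 1
  have h4 := h2 Complex.I
  unfold dz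
  fun_prop

theorem contDiffAt_dzbar (hu : ContDiffAt ℝ ∞ u z) : ContDiffAt ℝ ∞ (dzbar u) z := by
  have h1 : ContDiffAt ℝ ∞ (fderiv ℝ u) z := hu.fderiv_right (m := ∞) (by simp)
  have h2 : ∀ v : ℂ, ContDiffAt ℝ ∞ (fun w => fderiv ℝ u w v) z := fun v =>
    h1.clm_apply contDiffAt_const
  have h3 := h2 1
  have h4 := h2 Complex.I
  unfold dzbar
  fun_prop

theorem contDiffAt_norm_pow_inv (hz : z ≠ 0) :
    ContDiffAt ℝ ∞ (fun w : ℂ => ((‖w‖ : ℂ) ^ m)⁻¹) z := by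
  have hz' : (‖z‖ : ℂ) ≠ 0 := by simpa using hz
  exact ((Complex.ofRealCLM.contDiff.contDiffAt.comp z (contDiffAt_norm ℝ hz)).pow m).inv
    (pow_ne_zero _ hz')

theorem continuousAt_conicalOp (hΦ : ContDiff ℝ ∞ Φ) (hz : z ≠ 0) :
    ContinuousAt (conicalOp m Φ) z :=
  (contDiffAt_dz ((contDiffAt_norm_pow_inv hz).mul (contDiffAt_dzbar hΦ.contDiffAt))).continuousAt

theorem dzbar_eq_zero_of_eventually (h : u =ᶠ[𝓝 z] fun _ => 0) : dzbar u z = 0 := by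
  rw [dzbar, h.fderiv_eq]
  simp

theorem dz_mul_dzbar_eq_zero {f : ℂ → ℂ} (h : u =ᶠ[𝓝 z] fun _ => 0) :
    dz (fun w => f w * dzbar u w) z = 0 := by
  have h1 : (fun w => f w * dzbar u w) =ᶠ[𝓝 z] fun _ => 0 := by
    filter_upwards [h.eventuallyEq_nhds] with w hw
    rw [dzbar_eq_zero_of_eventually hw, mul_zero]
  rw [dz, h1.fderiv_eq]
  simp

theorem conicalOp_eq_zero (h : z ∉ tsupport Φ) : conicalOp m Φ z = 0 :=
  dz_mul_dzbar_eq_zero (notMem_tsupport_iff_eventuallyEq.1 h)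

end TestFunctions

section RealSmooth

variable {X : Type*} [TopologicalSpace X] [ChartedSpace ℂ X]

theorem ContMDiffAt.real_of_complex {f : X → ℂ} {x : X}
    (h : ContMDiffAt 𝓘(ℂ) 𝓘(ℂ) ω f x) : ContMDiffAt 𝓘(ℝ, ℂ) 𝓘(ℝ, ℂ) ∞ f x := by
  rw [contMDiffAt_iff] at h ⊢
  exact ⟨h.1, (h.2.restrict_scalars ℝ).of_le le_top⟩

end RealSmooth

/-! ### Test functions on the punctured disc as test sections of `C` -/

namespace AdaptedChart

variable {X : Type*} [TopologicalSpace X] [T2Space X] [CompactSpace X] [ConnectedSpace X]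
  [ChartedSpace ℂ X] [IsManifold 𝓘(ℂ) ω X] [MeasurableSpace X] [BorelSpace X]
  {C : X → Type*} [∀ x, AddCommGroup (C x)] [∀ x, Module ℂ (C x)] [∀ x, TopologicalSpace (C x)]
  [TopologicalSpace (TotalSpace ℂ C)] [FiberBundle ℂ C] [VectorBundle ℂ ℂ C]
  [ContMDiffVectorBundle ω ℂ C 𝓘(ℂ)]
  {η : HolomorphicOneForm X} {S : SpinStructure C} {p : X} {D : AdaptedChart η S p} {Φ : ℂ → ℂ}

theorem isClosed_image_tsupport (hc : HasCompactSupport Φ)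
    (hs : tsupport Φ ⊆ Metric.ball 0 D.R \ {0}) : IsClosed (D.param '' tsupport Φ) :=
  (hc.isCompact.image_of_continuousOn
    (continuousOn_param.mono fun _ h => (hs h).1)).isClosed

/-- The image of the support is compact, hence closed in the Hausdorff space `X`; this is what makes
extension by zero smooth. -/
theorem push_eventually_eq_zero (hc : HasCompactSupport Φ)
    (hs : tsupport Φ ⊆ Metric.ball 0 D.R \ {0}) {x : X} (hx : x ∉ D.param '' tsupport Φ) :
    ∀ᶠ y in 𝓝 x, D.push Φ y = 0 := by
  filter_upwards [(isClosed_image_tsupport hc hs).isOpen_compl.mem_nhds hx] with y hy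
  by_cases hyD : y ∈ D.nbhd D.R
  · have : Φ (D.coordinate y) = 0 := by
      refine image_eq_zero_of_notMem_tsupport fun h => hy ⟨_, h, param_coordinate hyD⟩
    rw [push, if_pos hyD, this, zero_smul]
  · exact push_of_notMem hyD _

theorem mem_of_mem_image (hs : tsupport Φ ⊆ Metric.ball 0 D.R \ {0}) {x : X}
    (hx : x ∈ D.param '' tsupport Φ) : x ∈ D.nbhd D.R ∧ D.coordinate x ≠ 0 := by
  obtain ⟨ζ, hζ, rfl⟩ := hx
  refine ⟨param_mem le_rfl (hs hζ).1, ?_⟩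
  rw [coordinate_param (hs hζ).1]
  exact (hs hζ).2

theorem form_ne_zero {x : X} (hx : x ∈ D.nbhd D.R) (h0 : D.coordinate x ≠ 0) :
    η.toFun x ≠ 0 := by
  intro h
  obtain ⟨k, -, hk⟩ := coeffIn_eq (chart_mem_atlas ℂ p) ((chartAt ℂ p).map_source hx.1)
  have h1 := hk η.toFun
  rw [form_eq hx, (chartAt ℂ p).left_inv hx.1, h] at h1
  have h2 : D.coordinate x ^ D.m * D.q (D.coordinate x) = 0 := h1.trans (mul_zero k)
  exact mul_ne_zero (pow_ne_zero _ h0) (q_ne_zero (coordinate_mem hx)) h2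

theorem isTestSection_push (hΦ : ContDiff ℝ ∞ Φ) (hc : HasCompactSupport Φ)
    (hs : tsupport Φ ⊆ Metric.ball 0 D.R \ {0}) : IsTestSection η (D.push Φ) := by
  refine ⟨fun x => ?_, ?_⟩
  · rw [contMDiffAt_section]
    set τ := trivializationAt ℂ C x
    have hxτ : x ∈ τ.baseSet := FiberBundle.mem_baseSet_trivializationAt' x
    have hτev := τ.open_baseSet.mem_nhds hxτ
    by_cases hx : x ∈ D.param '' tsupport Φ
    · have hxD := (mem_of_mem_image hs hx).1
      have h1 := ContMDiffAt.real_of_complex (contMDiffAt_coordinate hxD)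
      have h2 := ContMDiffAt.real_of_complex (contMDiffAt_frame_coeff τ hxD hxτ)
      have h3 : ContMDiffAt 𝓘(ℝ, ℂ) 𝓘(ℝ, ℂ) ∞ (fun y => Φ (D.coordinate y)) x :=
        hΦ.contMDiff.contMDiffAt.comp x h1
      have h4 : ContMDiffAt 𝓘(ℝ, ℂ) 𝓘(ℝ, ℂ) ∞
          (fun y => Φ (D.coordinate y) * (τ ⟨y, D.frame y⟩).2) x :=
        ContMDiffAt.comp (g := fun a : ℂ × ℂ => a.1 * a.2) x
          (contDiff_fst.mul contDiff_snd).contMDiff.contMDiffAt (h3.prodMk_space h2)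
      refine h4.congr_of_eventuallyEq ?_
      filter_upwards [isOpen_nbhd.mem_nhds hxD, hτev] with y hy hyτ
      exact trivialization_push τ hy hyτ Φ
    · refine (contMDiffAt_const (c := (0 : ℂ))).congr_of_eventuallyEq ?_
      filter_upwards [push_eventually_eq_zero hc hs hx, hτev] with y hy hyτ
      rw [hy]
      exact (τ.linear ℂ hyτ).map_zero
  · refine (closure_minimal (fun x hx => ?_) (isClosed_image_tsupport hc hs)).trans
      fun x hx => form_ne_zero (mem_of_mem_image hs hx).1 (mem_of_mem_image hs hx).2
    by_contra h
    exact hx (push_eventually_eq_zero hc hs h).self_of_nhds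

variable (D) in
/-- The coefficient of the Laplacian of the section with coefficient `Φ`. -/
def laplacianCoeff (Φ : ℂ → ℂ) (ζ : ℂ) : ℂ :=
  -((((‖D.q ζ‖ ^ 2 : ℝ) : ℂ))⁻¹ * ((‖ζ‖ : ℂ) ^ D.m)⁻¹ * conicalOp D.m Φ ζ)

theorem continuous_laplacianCoeff (hΦ : ContDiff ℝ ∞ Φ)
    (hs : tsupport Φ ⊆ Metric.ball 0 D.R \ {0}) : Continuous (D.laplacianCoeff Φ) := by
  rw [continuous_iff_continuousAt]
  intro ζ
  by_cases hζ : ζ ∈ tsupport Φ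
  · obtain ⟨hb, h0⟩ := hs hζ
    have hq := q_ne_zero hb
    have h1 : ContinuousAt (fun ζ => (((‖D.q ζ‖ ^ 2 : ℝ) : ℂ))⁻¹) ζ := by
      refine ContinuousAt.inv₀ (Complex.continuous_ofReal.continuousAt.comp
        ((D.analytic_q ζ hb).continuousAt.norm.pow 2)) ?_
      simpa using hq
    exact ((h1.mul (contDiffAt_norm_pow_inv h0).continuousAt).mul
      (continuousAt_conicalOp hΦ h0)).neg
  · refine (continuousAt_const (y := (0 : ℂ))).congr ?_
    filter_upwards [(isClosed_tsupport Φ).isOpen_compl.mem_nhds hζ] with w hw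
    rw [laplacianCoeff, conicalOp_eq_zero hw]
    simp

theorem laplacianCoeff_eq_zero {ζ : ℂ} (h : ζ ∉ tsupport Φ) : D.laplacianCoeff Φ ζ = 0 := by
  rw [laplacianCoeff, conicalOp_eq_zero h]
  simp

theorem hasCompactSupport_laplacianCoeff (hc : HasCompactSupport Φ) :
    HasCompactSupport (D.laplacianCoeff Φ) := by
  refine HasCompactSupport.intro hc fun ζ hζ => laplacianCoeff_eq_zero hζ

/-- In the adapted frame the weight is `|ζ|⁻ᵐ`; in another frame it is divided by the squared
modulus of the coefficient of the adapted frame. This is the form in which `dz_mul_dzbar_comp` needs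
it. -/
theorem weight_frame (τ : Trivialization ℂ (π ℂ C)) [MemTrivializationAtlas τ] {x : X}
    (hx : x ∈ D.nbhd D.R) (hxτ : x ∈ τ.baseSet) : (τ ⟨x, D.frame x⟩).2 ≠ 0 ∧
    (weight η S τ x : ℂ) = ((‖D.coordinate x‖ : ℂ) ^ D.m)⁻¹ *
      ((τ ⟨x, D.frame x⟩).2 * conj (τ ⟨x, D.frame x⟩).2)⁻¹ := by
  have h0 : D.coeff x (D.frame x) = 1 := by
    simpa using coeff_smul_frame hx 1
  have hne : (τ ⟨x, D.frame x⟩).2 ≠ 0 := by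
    intro h
    have h1 : D.frame x = 0 := by
      have h2 := τ.symm_apply_apply_mk hxτ (D.frame x)
      rw [h, ← τ.symmₗ_apply (R := ℂ) hxτ, map_zero] at h2
      exact h2.symm
    rw [h1, coeff_zero hx] at h0
    exact zero_ne_one h0
  refine ⟨hne, ?_⟩
  have h3 := herm_eq η S τ hxτ (D.frame x) (D.frame x)
  rw [herm_eq_coeff hx, h0, map_one, mul_one, mul_one] at h3
  have h4 : conj (τ ⟨x, D.frame x⟩).2 ≠ 0 := by simpa using hne
  rw [h3]
  field_simp

/-- `laplacian` at `x` is computed in the chart and the frame preferred at `x`, not in those adapted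
to `p`. The transformation rule for `∂(h ∂̄)` relates the two; off the support both sides vanish. -/
theorem laplacian_push (hΦ : ContDiff ℝ ∞ Φ) (hc : HasCompactSupport Φ)
    (hs : tsupport Φ ⊆ Metric.ball 0 D.R \ {0}) :
    laplacian η S (D.push Φ) = D.push (D.laplacianCoeff Φ) := by
  funext x
  rw [laplacian]
  set e := chartAt ℂ x
  set τ := trivializationAt ℂ C x
  have hxe : x ∈ e.source := mem_chart_source ℂ x
  have hex : e.symm (e x) = x := e.left_inv hxe
  have het : e x ∈ e.target := e.map_source hxe
  have heA : e ∈ atlas ℂ X := chart_mem_atlas ℂ x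
  have hxτ : x ∈ τ.baseSet := FiberBundle.mem_baseSet_trivializationAt' x
  have htend : Tendsto e.symm (𝓝 (e x)) (𝓝 x) := by
    have := e.symm.continuousAt het
    rwa [ContinuousAt, hex] at this
  simp only
  by_cases hx : x ∈ D.param '' tsupport Φ
  · obtain ⟨hxD, hx0⟩ := mem_of_mem_image hs hx
    set ψ : ℂ → ℂ := fun w => D.coordinate (e.symm w) with hψ
    set g : ℂ → ℂ := fun w => (τ ⟨e.symm w, D.frame (e.symm w)⟩).2 with hg
    have hψz : ψ (e x) = D.coordinate x := by rw [hψ]; simp only [hex]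
    have hgz : g (e x) = (τ ⟨x, D.frame x⟩).2 :=
      congrArg (fun y => (τ ⟨y, D.frame y⟩).2) hex
    have hψa : AnalyticAt ℂ ψ (e x) :=
      analyticAt_comp_symm heA het (contMDiffAt_coordinate (by rwa [hex]))
    have hga : AnalyticAt ℂ g (e x) :=
      analyticAt_comp_symm (f := fun y => (τ ⟨y, D.frame y⟩).2) heA het
        (contMDiffAt_frame_coeff τ (by rwa [hex]) (by rwa [hex]))
    have hg0 : g (e x) ≠ 0 := by
      rw [hgz]
      exact (weight_frame τ hxD hxτ).1
    have hev : ∀ᶠ w in 𝓝 (e x), e.symm w ∈ D.nbhd D.R ∧ e.symm w ∈ τ.baseSet :=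
      htend ((isOpen_nbhd.inter τ.open_baseSet).mem_nhds ⟨hxD, hxτ⟩)
    have key := dz_mul_dzbar_comp (u := Φ) (h := fun w => ((‖w‖ : ℂ) ^ D.m)⁻¹)
      (u' := sectionCoeff e τ (D.push Φ)) (h' := fun z => (weight η S τ (e.symm z) : ℂ))
      hψa hga hg0 hΦ.contDiffAt (by
        rw [hψz]
        exact (contDiffAt_norm_pow_inv hx0).differentiableAt (by simp))
      (hev.mono fun w hw => (trivialization_push τ hw.1 hw.2 Φ).trans (mul_comm _ _))
      (hev.mono fun w hw => (weight_frame τ hw.1 hw.2).2)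
    rw [key, hψz, hex, (weight_frame τ hxD hxτ).2, push, if_pos hxD,
      ← τ.symm_apply_apply_mk hxτ (D.laplacianCoeff Φ (D.coordinate x) • D.frame x)]
    congr 1
    have hlin : (τ ⟨x, D.laplacianCoeff Φ (D.coordinate x) • D.frame x⟩).2 =
        D.laplacianCoeff Φ (D.coordinate x) * (τ ⟨x, D.frame x⟩).2 :=
      (τ.linear ℂ hxτ).map_smul _ _
    have hder : deriv ψ (e x) = deriv (fun w => chartAt ℂ p (e.symm w)) (e x) := by
      rw [hψ]
      simp only [coordinate, deriv_sub_const_fun]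
    have htr := coeffIn_transition (chart_mem_atlas ℂ p) heA het (by rw [hex]; exact hxD.1) η.toFun
    rw [hex, form_eq hxD, ← hder] at htr
    have hη0 : coeffIn e η.toFun (e x) ≠ 0 := by
      obtain ⟨k, hk0, hk⟩ := coeffIn_eq heA het
      rw [hk, hex]
      exact mul_ne_zero hk0 fun h => form_ne_zero hxD hx0 (covector_eq_zero h)
    have hψ0 : deriv ψ (e x) ≠ 0 := fun h => hη0 (by rw [htr, h, zero_mul])
    have hq0 := q_ne_zero (coordinate_mem hxD)
    -- `|ψ'|²` from the operator cancels `|ψ'|²` from the area density. Of the factor `g ḡ` in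
    -- `h⁻¹`, the part `ḡ` cancels and `g` is the coefficient of the adapted frame.
    rw [hlin, htr, laplacianCoeff, ← hgz]
    change -(_ * _ * (_ * conicalOp D.m Φ (D.coordinate x))) = _
    have c1 : conj (g (e x)) ≠ 0 := by simpa using hg0
    have c2 : conj (deriv ψ (e x)) ≠ 0 := by simpa using hψ0
    have c3 : (‖D.coordinate x‖ : ℂ) ≠ 0 := by simpa using hx0
    have c4 : (‖D.q (D.coordinate x)‖ : ℂ) ≠ 0 := by simpa using hq0
    have c5 : ((‖deriv ψ (e x)‖ : ℝ) : ℂ) ^ 2 = deriv ψ (e x) * conj (deriv ψ (e x)) :=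
      (Complex.mul_conj' _).symm
    rw [norm_mul, norm_mul, norm_pow]
    push_cast
    rw [mul_pow, c5, map_mul, map_inv₀]
    field_simp
  · have h0 : sectionCoeff e τ (D.push Φ) =ᶠ[𝓝 (e x)] fun _ => 0 := by
      filter_upwards [htend.eventually (Filter.Eventually.and
        (push_eventually_eq_zero hc hs hx) (τ.open_baseSet.mem_nhds hxτ))] with w hw
      rw [sectionCoeff, hw.1]
      exact (τ.linear ℂ hw.2).map_zero
    rw [dz_mul_dzbar_eq_zero h0, mul_zero, neg_zero, ← τ.symmₗ_apply (R := ℂ) hxτ, map_zero]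
    by_cases hxD : x ∈ D.nbhd D.R
    · rw [push, if_pos hxD, laplacianCoeff_eq_zero fun h => hx ⟨_, h, param_coordinate hxD⟩,
        zero_smul]
    · exact (push_of_notMem hxD _).symm

end AdaptedChart

/-! ### Compactness of the domain of a self-adjoint extension -/

/-- A finite set forgets repetitions among the functionals. Scaling each by `√N`, with `N` their
number, lets every single member of the set dominate `N` times its own share, so coincidences do no
harm. -/
theorem exists_finset_sum_sq_le {E ι : Type*} [NormedAddCommGroup E] [NormedSpace ℂ E] [Fintype ι]
    (l : ι → E →L[ℂ] ℂ) : ∃ s : Finset (E →L[ℂ] ℂ), ∀ v, ∑ i, ‖l i v‖ ^ 2 ≤ ∑ f ∈ s, ‖f v‖ ^ 2 := by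
  classical
  set N : ℝ := (Fintype.card ι : ℝ) with hN
  refine ⟨Finset.univ.image fun i => (Real.sqrt N : ℂ) • l i, fun v => ?_⟩
  set T := ∑ f ∈ Finset.univ.image fun i => (Real.sqrt N : ℂ) • l i, ‖f v‖ ^ 2 with hT
  have hT0 : 0 ≤ T := Finset.sum_nonneg fun _ _ => by positivity
  have h1 : ∀ i, N * ‖l i v‖ ^ 2 ≤ T := by
    intro i
    have h2 : ‖((Real.sqrt N : ℂ) • l i) v‖ ^ 2 ≤ T :=
      Finset.single_le_sum (f := fun f : E →L[ℂ] ℂ => ‖f v‖ ^ 2) (fun _ _ => by positivity)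
        (Finset.mem_image_of_mem _ (Finset.mem_univ i))
    rwa [smul_apply, norm_smul, mul_pow, Complex.norm_real,
      Real.norm_of_nonneg (Real.sqrt_nonneg _), Real.sq_sqrt (by positivity)] at h2
  have h3 : N * ∑ i, ‖l i v‖ ^ 2 ≤ N * T := by
    rw [Finset.mul_sum]
    refine (Finset.sum_le_sum fun i _ => h1 i).trans ?_
    simp [hN]
  rcases (show 0 ≤ N by positivity).eq_or_lt with h0 | h0
  · have : IsEmpty ι := Fintype.card_eq_zero_iff.1 (Nat.cast_eq_zero.1 h0.symm)
    simpa using hT0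
  · exact le_of_mul_le_mul_left h3 h0

section Estimate

variable {X : Type*} [TopologicalSpace X] [T2Space X] [CompactSpace X] [ConnectedSpace X]
  [ChartedSpace ℂ X] [IsManifold 𝓘(ℂ) ω X] [MeasurableSpace X] [BorelSpace X]
  {C : X → Type*} [∀ x, AddCommGroup (C x)] [∀ x, Module ℂ (C x)] [∀ x, TopologicalSpace (C x)]
  [TopologicalSpace (TotalSpace ℂ C)] [FiberBundle ℂ C] [VectorBundle ℂ ℂ C]
  [ContMDiffVectorBundle ω ℂ C 𝓘(ℂ)]
  {η : HolomorphicOneForm X} {S : SpinStructure C} {p : X}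
  {A : L2 η S →ₗ.[ℂ] L2 η S}

namespace AdaptedChart

variable (D : AdaptedChart η S p)

theorem exists_inner_eq {k : ℂ → ℂ} (hk : MemLp k 2 (disc D.m D.R)) :
    ∃ w : L2 η S, ∀ U : L2 η S, inner ℂ w U =
      ∫ ζ, (‖D.q ζ‖ ^ 2 : ℝ) * (D.pull U.rep ζ * conj (k ζ)) ∂disc D.m D.R := by
  -- `push` requires a measurable function, so `k` is replaced by a measurable representative.
  have hae := hk.1.ae_eq_mk
  have hsq := isSquareIntegrable_push (D := D) hk.1.stronglyMeasurable_mk.measurable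
    ((memLp_congr_ae hae).1 hk)
  refine ⟨L2.mk _ hsq, fun U => ?_⟩
  obtain ⟨hU, hU'⟩ := L2.rep_spec η S U
  conv_lhs => rw [← hU']
  rw [inner_mk_push hsq hU]
  refine integral_congr_ae ?_
  filter_upwards [hae] with ζ hζ
  rw [← hζ]

/-- Represents a functional on the disc without the weight `|q|²`: the kernel `k̄ / |q|²` is pushed
to `X`, which is possible because `|q|⁻²` is bounded. -/
theorem exists_inner_eq_integral_pull {k : ℂ → ℂ} (hk : MemLp k 2 (disc D.m D.R)) :
    ∃ w : L2 η S, ∀ U : L2 η S, inner ℂ w U = ∫ ζ, D.pull U.rep ζ * k ζ ∂disc D.m D.R := by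
  have hm : AEStronglyMeasurable (fun ζ => (((‖D.q ζ‖ ^ 2 : ℝ) : ℂ))⁻¹) (disc D.m D.R) :=
    (aemeasurable_disc_of_continuousOn le_rfl (Complex.continuous_ofReal.comp_continuousOn
      (continuousOn_q.norm.pow 2))).inv.aestronglyMeasurable
  have hk' : MemLp (fun ζ => (((‖D.q ζ‖ ^ 2 : ℝ) : ℂ))⁻¹ * conj (k ζ)) 2 (disc D.m D.R) := by
    refine MemLp.of_le_mul (c := D.K) hk (hm.mul hk.star.1) ?_
    filter_upwards [ae_disc] with ζ hζ
    have h1 := norm_pos_iff.2 (q_ne_zero hζ)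
    rw [norm_mul, RCLike.norm_conj, norm_inv, Complex.norm_real, Real.norm_of_nonneg (by positivity)]
    refine mul_le_mul_of_nonneg_right ?_ (norm_nonneg _)
    rw [inv_le_iff_one_le_mul₀ (by positivity)]
    exact D.le_q ζ hζ
  obtain ⟨w, hw⟩ := D.exists_inner_eq hk'
  refine ⟨w, fun U => (hw U).trans (integral_congr_ae ?_)⟩
  filter_upwards [ae_disc] with ζ hζ
  have h1 : (‖D.q ζ‖ : ℂ) ≠ 0 := by simpa using q_ne_zero hζ
  rw [map_mul, map_inv₀, Complex.conj_conj, Complex.conj_ofReal]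
  push_cast
  field_simp

/-- Elements of the domain of a self-adjoint extension solve the equation on the punctured disc. -/
theorem weakLaplace_pull (hA : IsSelfAdjointExtension η S A) (y : A.domain) :
    WeakLaplace D.m D.R (D.pull (y : L2 η S).rep)
      (fun ζ => ((‖D.q ζ‖ ^ 2 : ℝ) : ℂ) * D.pull (A y).rep ζ) := by
  intro Φ hΦ hc hs
  have hLc := continuous_laplacianCoeff (D := D) hΦ hs
  have hu : IsSquareIntegrable η S (D.push Φ) := isSquareIntegrable_push hΦ.continuous.measurable
    (hΦ.continuous.memLp_of_hasCompactSupport hc)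
  have hv : IsSquareIntegrable η S (D.push (D.laplacianCoeff Φ)) :=
    isSquareIntegrable_push hLc.measurable
      (hLc.memLp_of_hasCompactSupport (hasCompactSupport_laplacianCoeff hc))
  have hmem : (L2.mk _ hu, L2.mk _ hv) ∈ A.graph := by
    refine hA.1 (Submodule.le_topologicalClosure _ (Submodule.subset_span ?_))
    refine ⟨D.push Φ, isTestSection_push hΦ hc hs, hu, ?_⟩
    rw [laplacian_push hΦ hc hs]
    exact ⟨hv, rfl⟩
  obtain ⟨x, hx1, hx2⟩ := (LinearPMap.mem_graph_iff A).1 hmem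
  -- The test section lies in the domain because `A` extends `Δ_min`, and symmetry moves the
  -- operator from `y` to it.
  have key := inner_apply_of_isSelfAdjoint hA.2 x y
  rw [hx1, hx2] at key
  obtain ⟨h1, h1'⟩ := L2.rep_spec η S (y : L2 η S)
  obtain ⟨h2, h2'⟩ := L2.rep_spec η S (A y)
  have k1 := inner_mk_push hv h1
  have k2 := inner_mk_push hu h2
  rw [h1'] at k1
  rw [h2'] at k2
  rw [k1, k2] at key
  have e1 : ∫ ζ, ((‖D.q ζ‖ ^ 2 : ℝ) : ℂ) *
      (D.pull (y : L2 η S).rep ζ * conj (D.laplacianCoeff Φ ζ)) ∂disc D.m D.R =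
      -∫ ζ, D.pull (y : L2 η S).rep ζ * (conj (conicalOp D.m Φ ζ) / (‖ζ‖ : ℂ) ^ D.m)
        ∂disc D.m D.R := by
    rw [← integral_neg]
    refine integral_congr_ae ?_
    filter_upwards [ae_disc] with ζ hζ
    have h3 : (‖D.q ζ‖ : ℂ) ≠ 0 := by simpa using q_ne_zero hζ
    rw [laplacianCoeff]
    simp only [map_neg, map_mul, map_inv₀, map_pow, Complex.conj_ofReal]
    push_cast
    field_simp
  rw [e1] at key
  rw [← neg_eq_iff_eq_neg, key]
  refine integral_congr_ae (ae_of_all _ fun ζ => ?_)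
  ring

/-- The estimate on the disc, carried to `X`: the functionals on the disc are inner products with
fixed elements of `L₂(X; C)`, hence continuous on the graph. -/
theorem exists_local_estimate (hA : IsSelfAdjointExtension η S A) {ε : ℝ} (hε : 0 < ε) :
    ∃ (ι : Type) (_ : Fintype ι) (l : ι → (L2 η S × L2 η S) →L[ℂ] ℂ), ∀ y : A.domain,
      ∫ x in D.nbhd (D.R / 4), ‖herm η S x ((y : L2 η S).rep x) ((y : L2 η S).rep x)‖
        ∂areaMeasure η ≤
      ε * (‖(y : L2 η S)‖ ^ 2 + ‖A y‖ ^ 2) + ∑ i, ‖l i (y, A y)‖ ^ 2 := by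
  have hK := D.K_pos
  have hR4 : D.R / 4 ≤ D.R := by linarith [D.R_pos]
  -- The constant `K` enters twice, in passing from the section to the disc and back, hence `ε /
  -- K²`. The functionals are multiplied by `K` once, hence the factors `√K` below.
  obtain ⟨ι, hι, k, hk, hest⟩ := exists_l2norm_disc_le D.m D.R_pos D.R_le
    (show 0 < ε / D.K ^ 2 by positivity)
  have hq : ∀ i, MemLp (fun ζ => conj (k i ζ)) 2 (disc D.m D.R) := fun i => (hk i).star
  choose w hw using fun i => D.exists_inner_eq_integral_pull (hk i)
  choose w' hw' using fun i => D.exists_inner_eq (hq i)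
  refine ⟨ι ⊕ ι, inferInstance, Sum.elim
    (fun i => (Real.sqrt D.K : ℂ) • (innerSL ℂ (w i) ∘L ContinuousLinearMap.fst ℂ _ _))
    (fun i => (Real.sqrt D.K : ℂ) • (innerSL ℂ (w' i) ∘L ContinuousLinearMap.snd ℂ _ _)),
    fun y => ?_⟩
  obtain ⟨h1, h1'⟩ := L2.rep_spec η S (y : L2 η S)
  obtain ⟨h2, h2'⟩ := L2.rep_spec η S (A y)
  have hy := hest _ _ (memLp_pull le_rfl h1) (memLp_q_mul_pull h2) (D.weakLaplace_pull hA y)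
  have b1 := l2norm_pull_sq_le (D := D) h1
  have b2 := l2norm_q_mul_pull_sq_le (D := D) h2
  rw [h1'] at b1
  rw [h2'] at b2
  refine (setIntegral_norm_herm_le hR4 h1).trans ((mul_le_mul_of_nonneg_left hy hK.le).trans ?_)
  rw [mul_add, Fintype.sum_sum_type, Finset.sum_add_distrib,
    mul_add D.K (∑ i, _)]
  have hs : ∀ c : ℂ, ‖(Real.sqrt D.K : ℂ) * c‖ ^ 2 = D.K * ‖c‖ ^ 2 := by
    intro c
    rw [norm_mul, mul_pow, Complex.norm_real, Real.norm_of_nonneg (Real.sqrt_nonneg _),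
      Real.sq_sqrt hK.le]
  refine add_le_add ?_ (add_le_add (le_of_eq ?_) (le_of_eq ?_))
  · have h3 : ε / D.K ^ 2 * (D.K * (D.K * (‖(y : L2 η S)‖ ^ 2 + ‖A y‖ ^ 2))) =
        ε * (‖(y : L2 η S)‖ ^ 2 + ‖A y‖ ^ 2) := by
      field_simp
    rw [← h3, mul_left_comm]
    refine mul_le_mul_of_nonneg_left (mul_le_mul_of_nonneg_left ?_ hK.le) (by positivity)
    linarith
  · rw [Finset.mul_sum]
    refine Finset.sum_congr rfl fun i _ => ?_
    change _ = ‖(Real.sqrt D.K : ℂ) * inner ℂ (w i) (y : L2 η S)‖ ^ 2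
    rw [hs, hw]
  · rw [Finset.mul_sum]
    refine Finset.sum_congr rfl fun i _ => ?_
    change _ = ‖(Real.sqrt D.K : ℂ) * inner ℂ (w' i) (A y)‖ ^ 2
    rw [hs, hw']
    congr 3
    refine integral_congr_ae (ae_of_all _ fun ζ => ?_)
    simp only [Complex.conj_conj]
    ring

end AdaptedChart

/-- The graph norm of a self-adjoint extension of the minimal Laplacian is compact relative to the
norm of `L₂(X; C)`. -/
theorem hasCompactDomain_of_isSelfAdjointExtension (hη : η.HasSimpleZeros)
    (hA : IsSelfAdjointExtension η S A) : HasCompactDomain A := by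
  intro ε hε
  have D := fun p => Classical.choice (exists_adaptedChart η hη S p)
  obtain ⟨t, ht⟩ := CompactSpace.elim_nhds_subcover (fun p => (D p).nbhd ((D p).R / 4)) fun p =>
    AdaptedChart.isOpen_nbhd.mem_nhds (AdaptedChart.mem_nbhd (by linarith [(D p).R_pos]))
  -- The error is divided among the finitely many discs of the cover; the `+ 1` keeps the
  -- denominator positive without assuming the cover nonempty.
  have hδ : 0 < ε / (t.card + 1) := by positivity
  choose ι hι l hl using fun p => (D p).exists_local_estimate hA hδ
  obtain ⟨s, hs⟩ := exists_finset_sum_sq_le fun i : Σ p : t, ι p => l i.1 i.2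
  refine ⟨s, fun y => ?_⟩
  obtain ⟨h1, h1'⟩ := L2.rep_spec η S (y : L2 η S)
  set f : X → ℝ := fun x => ‖herm η S x ((y : L2 η S).rep x) ((y : L2 η S).rep x)‖ with hf
  have hfi : Integrable f (areaMeasure η) := (integrable_herm h1 h1).norm
  have hfi' : ∀ p, Integrable (((D p).nbhd ((D p).R / 4)).indicator f) (areaMeasure η) := fun p =>
    hfi.indicator AdaptedChart.isOpen_nbhd.measurableSet
  have hnorm := norm_mk_sq h1
  rw [h1'] at hnorm
  rw [hnorm.trans (show _ = ∫ x, f x ∂areaMeasure η from rfl)]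
  have hcover : ∫ x, f x ∂areaMeasure η ≤
      ∑ p ∈ t, ∫ x in (D p).nbhd ((D p).R / 4), f x ∂areaMeasure η := by
    simp only [fun p => (integral_indicator (f := f) (μ := areaMeasure η)
      (AdaptedChart.isOpen_nbhd (D := D p) (t := (D p).R / 4)).measurableSet).symm]
    rw [← integral_finsetSum _ fun p _ => hfi' p]
    refine integral_mono hfi (integrable_finsetSum _ fun p _ => hfi' p) fun x => ?_
    have hx : x ∈ ⋃ p ∈ t, (D p).nbhd ((D p).R / 4) := ht ▸ Set.mem_univ x
    obtain ⟨p, hp, hxp⟩ := Set.mem_iUnion₂.1 hx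
    refine le_trans (le_of_eq (Set.indicator_of_mem hxp f).symm)
      (Finset.single_le_sum (f := fun p => ((D p).nbhd ((D p).R / 4)).indicator f x)
        (fun p _ => Set.indicator_nonneg (fun x _ => norm_nonneg _) x) hp)
  refine hcover.trans ((Finset.sum_le_sum fun p _ => hl p y).trans ?_)
  rw [Finset.sum_add_distrib, Finset.sum_const, nsmul_eq_mul]
  have hnn : 0 ≤ ‖(y : L2 η S)‖ ^ 2 + ‖A y‖ ^ 2 := by positivity
  refine add_le_add ?_ ?_
  · rw [← hnorm, ← mul_assoc]
    refine mul_le_mul_of_nonneg_right ?_ hnn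
    rw [mul_div_assoc', div_le_iff₀ (by positivity)]
    linarith
  · refine le_trans (le_of_eq ?_) (hs (y, A y))
    rw [Fintype.sum_sigma, ← Finset.sum_coe_sort t]

end Estimate

end ConicalSpinor

end

theorem mainTheorem9
    -- `X` is a compact connected Riemann surface
    {X : Type*} [TopologicalSpace X] [T2Space X] [CompactSpace X] [ConnectedSpace X]
    [ChartedSpace ℂ X] [IsManifold 𝓘(ℂ) ω X] [MeasurableSpace X] [BorelSpace X]
    -- `C` is a holomorphic line bundle over `X`
    {C : X → Type*} [∀ x, AddCommGroup (C x)] [∀ x, Module ℂ (C x)] [∀ x, TopologicalSpace (C x)]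
    [TopologicalSpace (TotalSpace ℂ C)] [FiberBundle ℂ C] [VectorBundle ℂ ℂ C]
    [ContMDiffVectorBundle ω ℂ C 𝓘(ℂ)]
    -- with `C ⊗ C ≅ K`
    (S : ConicalSpinor.SpinStructure C)
    -- `η` is a holomorphic one-form with simple zeros
    (η : ConicalSpinor.HolomorphicOneForm X) (hη : η.HasSimpleZeros)
    -- `A` is a self-adjoint extension of the minimal operator
    (A : ConicalSpinor.L2 η S →ₗ.[ℂ] ConicalSpinor.L2 η S)
    (hA : ConicalSpinor.IsSelfAdjointExtension η S A) :
    ConicalSpinor.HasDiscreteSpectrum A := by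
  exact ConicalSpinor.hasDiscreteSpectrum_of_hasCompactDomain hA.2
    (ConicalSpinor.hasCompactDomain_of_isSelfAdjointExtension hη hA)
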